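/- All graphs are finite and simple. A rooted tree $F$ is represented solely by its vertex set and its ancestor relation (every vertex is an ancestor of itself). For $u\in V(F)$ let $\mathsf{tail}_F[u]$ be the set of ancestors of $u$, $\mathsf{tree}_F[u]$ the set of descendants of $u$ (both including $u$), $\mathsf{comp}_F[u]=\mathsf{tail}_F[u]\cup\mathsf{tree}_F[u]$, and $\mathsf{chld}_F(u)$ the set of children of $u$; for $A\subseteq V(F)$ let $\mathsf{cl}_F(A)=\bigcup_{u\in A}\mathsf{tail}_F[u]$. The depth of $F$ is $\max_u|\mathsf{tail}_F[u]|$. An elimination tree of a connected graph $G$ is a rooted tree $F$ with $V(F)=V(G)$ such that for every edge $uv$ of $G$ one of $u,v$ is an ancestor of the other in $F$. An elimination tree $R$ of $G$ of depth at most $d$ is sensible with respect to an elimination tree $T$ of $G$ if for every $u\in V(G)$ and all distinct $v_1,v_2\in\mathsf{chld}_T(u)$ $$\mathsf{cl}_R(\mathsf{comp}_T[v_1])\cap\mathsf{cl}_R(\mathsf{comp}_T[v_2])=\mathsf{cl}_R(\mathsf{tail}_T[u]).$$ **Lemma (CountElimTrees).** There is a deterministic algorithm on the word RAM with words of $O(\log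 n)$ bits (more precisely $c(\lfloor\log_2 n\rfloor+1)$ bits, for a constant $c$) that, given a connected graph $G$ on $n$ vertices, an elimination tree $T$ of $G$ of depth $k$, and an integer $d$, outputs (in binary) the number of different elimination trees of $G$ of depth at most $d$ that are sensible with respect to $T$. It uses $n^{O(1)}$ words of working memory. With $d^+=\max(d,0)$, its running time is at most $$\bigl((d^+k\cdot 2^{d^+})^{k}+1\bigr)^{O(1)}\cdot n^{O(1)},$$ and this is $2^{O(dk)}\cdot n^{O(1)}$ whenever $\log k=O(d)$: for every constant $a$, on all inputs with $k\le 2^{a d^+}$ the running time is at most $D_a\cdot 2^{D_a d^+k}\cdot n^{C}$, where $D_a$ depends only on $a$, and $C$ is an absolute constant. Here $G$ and $T$ are given by the 0/1-matrices of the adjacency and of the ancestor relation on a read-only input tape, followed by the sign and the binary digits of $d$; the output is written on a write-only tape. -/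

import Mathlib

/-! ## Rooted forests, given by their ancestor relation -/

/-- A rooted forest with vertex set `V`, represented by its (reflexive) ancestor relation:
`anc u v` says that `u` is an ancestor of `v`. On a finite `V` such relations are exactly the
partial orders in which the ancestors of every vertex form a chain. Two rooted forests on `V` are
equal if and only if they have the same ancestor relation. -/
@[ext]
structure RootedForest (V : Type*) where
  anc : V → V → Prop
  refl' : ∀ u, anc u u
  trans' : ∀ u v w, anc u v → anc v w → anc u w
  antisymm' : ∀ u v, anc u v → anc v u → u = v
  chain' : ∀ u v w, anc u w → anc v w → anc u v ∨ anc v u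

namespace RootedForest

variable {V : Type*}

/-- A finite vertex set carries only finitely many rooted forests. -/
instance [Finite V] : Finite (RootedForest V) :=
  Finite.of_injective (fun F : RootedForest V => F.anc) fun _ _ h => RootedForest.ext h

/-- A rooted tree is a rooted forest with a root that is an ancestor of all vertices. -/
def IsTree (F : RootedForest V) : Prop := ∃ r, ∀ v, F.anc r v

/-- The symmetric ancestor/descendant relation. -/
def Related (F : RootedForest V) (u v : V) : Prop := F.anc u v ∨ F.anc v u

/-- All ancestors of `u`, including `u`. -/
def tail (F : RootedForest V) (u : V) : Set V := {v | F.anc v u}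

/-- All descendants of `u`, including `u`. -/
def tree (F : RootedForest V) (u : V) : Set V := {v | F.anc u v}

/-- All ancestors and descendants of `u`, including `u`. -/
def comp (F : RootedForest V) (u : V) : Set V := F.tail u ∪ F.tree u

/-- The children of `u`: the proper descendants of `u` with no vertex strictly in between. -/
def children (F : RootedForest V) (u : V) : Set V :=
  {v | v ≠ u ∧ F.anc u v ∧ ∀ w, F.anc u w → F.anc w v → w = u ∨ w = v}

/-- The ancestor closure of a set of vertices. -/
def closure (F : RootedForest V) (A : Set V) : Set V := ⋃ u ∈ A, F.tail u

/-- The depth of a vertex is the number of its ancestors; roots have depth one. -/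
noncomputable def depthAt (F : RootedForest V) (u : V) : ℕ := (F.tail u).ncard

/-- The depth of a forest is the maximum depth of a vertex. -/
noncomputable def depth [Fintype V] (F : RootedForest V) : ℕ := Finset.univ.sup F.depthAt

/-- `F` is an elimination tree of `G`: a rooted tree on the vertex set of `G` such that the ends
of every edge of `G` are in the ancestor/descendant relation. -/
def IsElimTree (F : RootedForest V) (G : SimpleGraph V) : Prop :=
  F.IsTree ∧ ∀ u v, G.Adj u v → F.Related u v

/-- `R` satisfies the sensibility condition with respect to `T`. -/
def IsSensible (R T : RootedForest V) : Prop :=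
  ∀ u, ∀ v₁ ∈ T.children u, ∀ v₂ ∈ T.children u, v₁ ≠ v₂ →
    R.closure (T.comp v₁) ∩ R.closure (T.comp v₂) = R.closure (T.tail u)

/-- The number of elimination trees of `G` of depth at most `d` that are sensible with respect
to `T`. -/
noncomputable def countSensible [Fintype V] (G : SimpleGraph V) (T : RootedForest V) (d : ℤ) : ℕ :=
  {R : RootedForest V | R.IsElimTree G ∧ (R.depth : ℤ) ≤ d ∧ R.IsSensible T}.ncard

end RootedForest

/-! ## The word RAM -/

namespace WordRAM

/-- The operations on words. Comparisons return `1` or `0`. -/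
inductive Op
  | add | sub | mul | div | mod | and | or | xor | shl | shr | lt | eq

/-- Arithmetic on words of `w` bits is modulo `2 ^ w`. -/
def Op.eval (w : ℕ) (o : Op) (a b : ℕ) : ℕ :=
  (match o with
    | .add => a + b
    | .sub => a + (2 ^ w - b)
    | .mul => a * b
    | .div => a / b
    | .mod => a % b
    | .and => a &&& b
    | .or => a ||| b
    | .xor => a ^^^ b
    | .shl => a <<< b
    | .shr => a >>> b
    | .lt => if a < b then 1 else 0
    | .eq => if a = b then 1 else 0) % 2 ^ w

/-- Programs. Registers are named by natural numbers; a program mentions only finitely many.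
There are no procedure calls: recursion has to be implemented in the memory. -/
inductive Program
  /-- do nothing -/
  | skip
  /-- `r[x] := a` -/
  | const (x a : ℕ)
  /-- `r[x] := r[y] o r[z]` -/
  | op (o : Op) (x y z : ℕ)
  /-- `r[x] := memory[r[y]]` -/
  | load (x y : ℕ)
  /-- `memory[r[x]] := r[y]` -/
  | store (x y : ℕ)
  /-- move the next word of the input tape (`0` if there is none) into `r[x]` -/
  | read (x : ℕ)
  /-- append `r[x]` to the output tape -/
  | write (x : ℕ)
  /-- sequential composition -/
  | seq (p q : Program)
  /-- if `r[x] ≠ 0` then `p` else `q` -/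
  | ite (x : ℕ) (p q : Program)
  /-- while `r[x] ≠ 0` do `p` -/
  | loop (x : ℕ) (p : Program)

/-- A state: registers, memory, the unread part of the (read-only, one-way) input tape and the
contents of the (write-only) output tape. -/
structure State where
  reg : ℕ → ℕ
  mem : ℕ → ℕ
  input : List ℕ
  output : List ℕ

/-- `Exec w S p s t s'`: on a machine with words of `w` bits and a memory of `S` words (with the
addresses `0, …, S - 1`), the program `p` started in state `s` terminates after exactly `t` steps
in state `s'`, and accesses no address outside the memory. Every elementary instruction and
every test takes one step. -/
inductive Exec (w S : ℕ) : Program → State → ℕ → State → Prop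
  | skip (s : State) : Exec w S .skip s 1 s
  | const (s : State) (x a : ℕ) :
      Exec w S (.const x a) s 1 { s with reg := Function.update s.reg x (a % 2 ^ w) }
  | op (s : State) (o : Op) (x y z : ℕ) :
      Exec w S (.op o x y z) s 1
        { s with reg := Function.update s.reg x (o.eval w (s.reg y) (s.reg z)) }
  | load (s : State) (x y : ℕ) (h : s.reg y < S) :
      Exec w S (.load x y) s 1 { s with reg := Function.update s.reg x (s.mem (s.reg y)) }
  | store (s : State) (x y : ℕ) (h : s.reg x < S) :
      Exec w S (.store x y) s 1 { s with mem := Function.update s.mem (s.reg x) (s.reg y) }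
  | read (s : State) (x : ℕ) :
      Exec w S (.read x) s 1
        { s with
          reg := Function.update s.reg x (s.input.headD 0 % 2 ^ w)
          input := s.input.tail }
  | write (s : State) (x : ℕ) :
      Exec w S (.write x) s 1 { s with output := s.output ++ [s.reg x] }
  | seq {p q : Program} {s s' s'' : State} {t t' : ℕ} (hp : Exec w S p s t s')
      (hq : Exec w S q s' t' s'') : Exec w S (.seq p q) s (t + t') s''
  | ite_true {x : ℕ} {p q : Program} {s s' : State} {t : ℕ} (h : s.reg x ≠ 0)
      (hp : Exec w S p s t s') : Exec w S (.ite x p q) s (t + 1) s'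
  | ite_false {x : ℕ} {p q : Program} {s s' : State} {t : ℕ} (h : s.reg x = 0)
      (hq : Exec w S q s t s') : Exec w S (.ite x p q) s (t + 1) s'
  | loop_true {x : ℕ} {p : Program} {s s' s'' : State} {t t' : ℕ} (h : s.reg x ≠ 0)
      (hp : Exec w S p s t s') (hl : Exec w S (.loop x p) s' t' s'') :
      Exec w S (.loop x p) s (t + t' + 1) s''
  | loop_false {x : ℕ} {p : Program} {s : State} (h : s.reg x = 0) :
      Exec w S (.loop x p) s 1 s

/-- The initial state: registers, memory and output tape are blank. -/
def initial (input : List ℕ) : State := ⟨fun _ => 0, fun _ => 0, input, []⟩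

/-- With words of `w` bits and a memory of `S` words, the program `p` on the input tape `inp`
halts after exactly `t` steps with the output tape `out`. -/
def Outputs (w S : ℕ) (p : Program) (inp : List ℕ) (t : ℕ) (out : List ℕ) : Prop :=
  ∃ s, Exec w S p (initial inp) t s ∧ s.output = out

/-- The binary digits of a natural number, most significant digit first. -/
def binary (m : ℕ) : List ℕ := (Nat.digits 2 m).reverse

/-- The 0/1-matrix of a relation, row by row. -/
noncomputable def matrixBits {n : ℕ} (r : Fin n → Fin n → Prop) : List ℕ :=
  open Classical in
  (List.finRange n).flatMap fun i => (List.finRange n).map fun j => if r i j then 1 else 0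

/-- The input tape for `(G, T, d)`: the number of vertices, the adjacency matrix of `G`, the matrix
of the ancestor relation of `T`, and `d` as a sign (`1` if negative, otherwise `0`) followed by the
binary digits of its absolute value and the end marker `2`. -/
noncomputable def encode {n : ℕ} (G : SimpleGraph (Fin n)) (T : RootedForest (Fin n)) (d : ℤ) :
    List ℕ :=
  [n] ++ matrixBits G.Adj ++ matrixBits T.anc ++
    [if d < 0 then 1 else 0] ++ binary d.natAbs ++ [2]

end WordRAM

/-! ## Total correctness with time bounds -/

namespace WordRAM

/-- `Tri w S p s B Q`: started in `s`, the program `p` halts after at most `B` steps in a state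
that satisfies `Q`. -/
def Tri (w S : ℕ) (p : Program) (s : State) (B : ℕ) (Q : State → Prop) : Prop :=
  ∃ t s', Exec w S p s t s' ∧ t ≤ B ∧ Q s'

namespace Tri

variable {w S : ℕ} {p q : Program} {s : State} {B B' B₁ B₂ : ℕ} {Q Q' R : State → Prop}

theorem weaken (h : Tri w S p s B Q) (hB : B ≤ B') (hQ : ∀ s', Q s' → Q' s') :
    Tri w S p s B' Q' := by
  obtain ⟨t, s', he, ht, hq⟩ := h
  exact ⟨t, s', he, ht.trans hB, hQ _ hq⟩

theorem seq (h : Tri w S p s B₁ R) (h' : ∀ s', R s' → Tri w S q s' B₂ Q) :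
    Tri w S (.seq p q) s (B₁ + B₂) Q := by
  obtain ⟨t, s', he, ht, hq⟩ := h
  obtain ⟨t', s'', he', ht', hq'⟩ := h' _ hq
  exact ⟨_, s'', .seq he he', by omega, hq'⟩

theorem skip (h : Q s) : Tri w S .skip s 1 Q := ⟨1, s, .skip s, le_rfl, h⟩

theorem const {x a : ℕ} (h : Q { s with reg := Function.update s.reg x (a % 2 ^ w) }) :
    Tri w S (.const x a) s 1 Q := ⟨1, _, .const s x a, le_rfl, h⟩

theorem op {o : Op} {x y z : ℕ}
    (h : Q { s with reg := Function.update s.reg x (o.eval w (s.reg y) (s.reg z)) }) :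
    Tri w S (.op o x y z) s 1 Q := ⟨1, _, .op s o x y z, le_rfl, h⟩

theorem load {x y : ℕ} (hS : s.reg y < S)
    (h : Q { s with reg := Function.update s.reg x (s.mem (s.reg y)) }) :
    Tri w S (.load x y) s 1 Q := ⟨1, _, .load s x y hS, le_rfl, h⟩

theorem store {x y : ℕ} (hS : s.reg x < S)
    (h : Q { s with mem := Function.update s.mem (s.reg x) (s.reg y) }) :
    Tri w S (.store x y) s 1 Q := ⟨1, _, .store s x y hS, le_rfl, h⟩

theorem read {x : ℕ}
    (h : Q { s with reg := Function.update s.reg x (s.input.headD 0 % 2 ^ w)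
                    input := s.input.tail }) :
    Tri w S (.read x) s 1 Q := ⟨1, _, .read s x, le_rfl, h⟩

theorem write {x : ℕ} (h : Q { s with output := s.output ++ [s.reg x] }) :
    Tri w S (.write x) s 1 Q := ⟨1, _, .write s x, le_rfl, h⟩

theorem ite {x : ℕ} (hp : s.reg x ≠ 0 → Tri w S p s B₁ Q) (hq : s.reg x = 0 → Tri w S q s B₂ Q) :
    Tri w S (.ite x p q) s (B₁ + B₂ + 1) Q := by
  by_cases h : s.reg x = 0
  · obtain ⟨t, s', he, ht, hQ⟩ := hq h
    exact ⟨_, s', .ite_false h he, by omega, hQ⟩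
  · obtain ⟨t, s', he, ht, hQ⟩ := hp h
    exact ⟨_, s', .ite_true h he, by omega, hQ⟩

/-- A loop whose number of remaining iterations is bounded by a variant. -/
theorem loop_variant {x : ℕ} (I : ℕ → State → Prop)
    (h : ∀ k s, I k s → s.reg x ≠ 0 → Tri w S p s B (fun s' => ∃ k' < k, I k' s'))
    (k : ℕ) : ∀ s, I k s →
      Tri w S (.loop x p) s (k * (B + 1) + 1) (fun s' => s'.reg x = 0 ∧ ∃ k', I k' s') := by
  induction k using Nat.strong_induction_on with
  | _ k ih =>
    intro s hs
    by_cases hx : s.reg x = 0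
    · exact ⟨1, s, .loop_false hx, by omega, hx, k, hs⟩
    · obtain ⟨t, s', he, ht, k', hk', hs'⟩ := h k s hs hx
      obtain ⟨t', s'', he', ht', hQ⟩ := ih k' hk' s' hs'
      refine ⟨_, s'', .loop_true hx he he', ?_, hQ⟩
      have : (k' + 1) * (B + 1) ≤ k * (B + 1) := Nat.mul_le_mul_right _ hk'
      nlinarith

theorem loop_count {x : ℕ} (I : ℕ → State → Prop) (m : ℕ)
    (h : ∀ k s, k < m → I k s → s.reg x ≠ 0 ∧ Tri w S p s B (I (k + 1)))
    (hm : ∀ s, I m s → s.reg x = 0) (h0 : I 0 s) :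
    Tri w S (.loop x p) s (m * (B + 1) + 1) (I m) := by
  refine weaken (loop_variant (fun k s => k ≤ m ∧ I (m - k) s) ?_ m s ⟨le_rfl, by simpa using h0⟩)
    le_rfl ?_
  · rintro k s ⟨hk, hI⟩ hx
    have : k ≠ 0 := by
      rintro rfl
      exact hx (hm s (by simpa using hI))
    refine weaken (h (m - k) s (by omega) hI).2 le_rfl fun s' hs' => ⟨k - 1, by omega, by omega, ?_⟩
    rwa [show m - (k - 1) = m - k + 1 by omega]
  · rintro s' ⟨hx, k, hk, hI⟩
    rcases Nat.eq_zero_or_pos k with rfl | hk0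
    · simpa using hI
    · exact absurd hx (h (m - k) s' (by omega) hI).1

end Tri

/-! ## A structured language with two-dimensional arrays -/

/-- Expressions. Array accesses outside `[0, N) × [0, N)` yield `0`; a fold runs at most `N`
times. -/
inductive Expr
  | lit (a : ℕ)
  | var (x : ℕ)
  | arr (a : Fin 8) (i j : Expr)
  | op (o : Op) (e f : Expr)
  | ite (c e f : Expr)
  /-- the accumulator `x` starts as `e`, and becomes `f` for `i = 0, …, b - 1` -/
  | fold (i x : ℕ) (b e f : Expr)

/-- Commands. -/
inductive Cmd
  | skip
  | assign (x : ℕ) (e : Expr)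
  | store (a : Fin 8) (i j e : Expr)
  | read (x : ℕ)
  | write (e : Expr)
  | seq (p q : Cmd)
  | ite (c : Expr) (p q : Cmd)
  /-- run `p` for `i = 0, …, b - 1`, but at most `N` times -/
  | forRange (i : ℕ) (b : Expr) (p : Cmd)

/-- The states of the structured language. -/
structure St where
  var : ℕ → ℕ
  arr : Fin 8 → ℕ → ℕ → ℕ
  input : List ℕ
  output : List ℕ

/-- The value of an accumulator after `m` rounds. -/
def iter {α : Type*} (f : ℕ → α → α) (a : α) : ℕ → α
  | 0 => a
  | m + 1 => f m (iter f a m)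

/-- The value of an expression. -/
def Expr.eval (w N : ℕ) (A : Fin 8 → ℕ → ℕ → ℕ) : Expr → (ℕ → ℕ) → ℕ
  | .lit a, _ => a % 2 ^ w
  | .var x, v => v x
  | .arr a i j, v =>
      if i.eval w N A v < N ∧ j.eval w N A v < N then A a (i.eval w N A v) (j.eval w N A v) else 0
  | .op o e f, v => o.eval w (e.eval w N A v) (f.eval w N A v)
  | .ite c e f, v => if c.eval w N A v ≠ 0 then e.eval w N A v else f.eval w N A v
  | .fold i x b e f, v =>
      iter (fun k r => f.eval w N A (Function.update (Function.update v i k) x r))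
        (e.eval w N A v) (min (b.eval w N A v) N)

/-- The effect of a command. -/
def Cmd.run (w N : ℕ) : Cmd → St → St
  | .skip, σ => σ
  | .assign x e, σ => { σ with var := Function.update σ.var x (e.eval w N σ.arr σ.var) }
  | .store a i j e, σ =>
      if i.eval w N σ.arr σ.var < N ∧ j.eval w N σ.arr σ.var < N then
        { σ with arr := Function.update σ.arr a (Function.update (σ.arr a)
            (i.eval w N σ.arr σ.var) (Function.update (σ.arr a (i.eval w N σ.arr σ.var))
              (j.eval w N σ.arr σ.var) (e.eval w N σ.arr σ.var))) }
      else σ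
  | .read x, σ =>
      { σ with var := Function.update σ.var x (σ.input.headD 0 % 2 ^ w), input := σ.input.tail }
  | .write e, σ => { σ with output := σ.output ++ [e.eval w N σ.arr σ.var] }
  | .seq p q, σ => q.run w N (p.run w N σ)
  | .ite c p q, σ => if c.eval w N σ.arr σ.var ≠ 0 then p.run w N σ else q.run w N σ
  | .forRange i b p, σ =>
      iter (fun k τ => p.run w N { τ with var := Function.update τ.var i k }) σ
        (min (b.eval w N σ.arr σ.var) N)

/-- The running time of a compiled expression. -/
def Expr.cost (N : ℕ) : Expr → ℕ
  | .lit _ => 1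
  | .var _ => 1
  | .arr _ i j => i.cost N + j.cost N + 20
  | .op _ e f => e.cost N + f.cost N + 1
  | .ite c e f => c.cost N + e.cost N + f.cost N + 1
  | .fold _ _ b e f => b.cost N + e.cost N + N * (f.cost N + 10) + 20

/-- The running time of a compiled command. -/
def Cmd.cost (N : ℕ) : Cmd → ℕ
  | .skip => 1
  | .assign _ e => e.cost N + 1
  | .store _ i j e => i.cost N + j.cost N + e.cost N + 20
  | .read _ => 1
  | .write e => e.cost N + 1
  | .seq p q => p.cost N + q.cost N
  | .ite c p q => c.cost N + p.cost N + q.cost N + 1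
  | .forRange _ b p => b.cost N + N * (p.cost N + 10) + 20

/-- The register of the variable `x`. Register `0` holds `N`. -/
def rv (x : ℕ) : ℕ := 2 * x + 2

/-- The `k`-th scratch register. -/
def sc (k : ℕ) : ℕ := 2 * k + 1

/-- Sequential composition of a list of programs. -/
def block : List Program → Program
  | [] => .skip
  | [p] => p
  | p :: q :: l => .seq p (block (q :: l))

/-- Compute the address of the cell `(r[sc b], r[sc (b + 1)])` of the array `a`. -/
def addrProg (b : ℕ) (a : Fin 8) : Program :=
  block [.op .mul (sc b) (sc b) 0, .op .add (sc b) (sc b) (sc (b + 1)), .const (sc (b + 2)) 8,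
    .op .mul (sc b) (sc b) (sc (b + 2)), .const (sc (b + 2)) a,
    .op .add (sc b) (sc b) (sc (b + 2))]

/-- Compile an expression; the value ends up in the scratch register `b`. -/
def Expr.comp : Expr → ℕ → Program
  | .lit a, b => .const (sc b) a
  | .var x, b => .op .or (sc b) (rv x) (rv x)
  | .arr a i j, b => block [i.comp b, j.comp (b + 1), .op .lt (sc (b + 2)) (sc b) 0,
      .op .lt (sc (b + 3)) (sc (b + 1)) 0, .op .and (sc (b + 2)) (sc (b + 2)) (sc (b + 3)),
      .ite (sc (b + 2)) (.seq (addrProg b a) (.load (sc b) (sc b))) (.const (sc b) 0)]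
  | .op o e f, b => block [e.comp b, f.comp (b + 1), .op o (sc b) (sc b) (sc (b + 1))]
  | .ite c e f, b => .seq (c.comp b) (.ite (sc b) (e.comp b) (f.comp b))
  | .fold i x m e f, b => block [m.comp b, .op .lt (sc (b + 1)) 0 (sc b),
      .ite (sc (b + 1)) (.op .or (sc b) 0 0) .skip, e.comp (b + 1),
      .op .or (sc (b + 2)) (rv i) (rv i), .op .or (sc (b + 3)) (rv x) (rv x),
      .const (sc (b + 4)) 0, .op .lt (sc (b + 5)) (sc (b + 4)) (sc b),
      .loop (sc (b + 5)) (block [.op .or (rv i) (sc (b + 4)) (sc (b + 4)),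
        .op .or (rv x) (sc (b + 1)) (sc (b + 1)), f.comp (b + 6),
        .op .or (sc (b + 1)) (sc (b + 6)) (sc (b + 6)), .const (sc (b + 6)) 1,
        .op .add (sc (b + 4)) (sc (b + 4)) (sc (b + 6)),
        .op .lt (sc (b + 5)) (sc (b + 4)) (sc b)]),
      .op .or (rv i) (sc (b + 2)) (sc (b + 2)), .op .or (rv x) (sc (b + 3)) (sc (b + 3)),
      .op .or (sc b) (sc (b + 1)) (sc (b + 1))]

/-- Compile a command. -/
def Cmd.comp : Cmd → ℕ → Program
  | .skip, _ => .skip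
  | .assign x e, b => .seq (e.comp b) (.op .or (rv x) (sc b) (sc b))
  | .store a i j e, b => block [e.comp b, i.comp (b + 1), j.comp (b + 2),
      .op .lt (sc (b + 3)) (sc (b + 1)) 0, .op .lt (sc (b + 4)) (sc (b + 2)) 0,
      .op .and (sc (b + 3)) (sc (b + 3)) (sc (b + 4)),
      .ite (sc (b + 3)) (.seq (addrProg (b + 1) a) (.store (sc (b + 1)) (sc b))) .skip]
  | .read x, _ => .read (rv x)
  | .write e, b => .seq (e.comp b) (.write (sc b))
  | .seq p q, b => .seq (p.comp b) (q.comp b)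
  | .ite c p q, b => .seq (c.comp b) (.ite (sc b) (p.comp b) (q.comp b))
  | .forRange i m p, b => block [m.comp b, .op .lt (sc (b + 1)) 0 (sc b),
      .ite (sc (b + 1)) (.op .or (sc b) 0 0) .skip,
      .const (sc (b + 1)) 0, .op .lt (sc (b + 2)) (sc (b + 1)) (sc b),
      .loop (sc (b + 2)) (block [.op .or (rv i) (sc (b + 1)) (sc (b + 1)), p.comp (b + 3),
        .const (sc (b + 3)) 1, .op .add (sc (b + 1)) (sc (b + 1)) (sc (b + 3)),
        .op .lt (sc (b + 2)) (sc (b + 1)) (sc b)])]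

/-! ## Correctness of the compilation -/

/-- The word size and the memory suffice for arrays of side `N`. -/
structure Fits (w S N : ℕ) : Prop where
  pos : 0 < N
  mem : 8 * N * N ≤ S
  word : 8 * N * N ≤ 2 ^ w

theorem Fits.lt {w S N : ℕ} (h : Fits w S N) : N < 2 ^ w := by
  have := h.pos
  have := h.word
  nlinarith

theorem Fits.eight {w S N : ℕ} (h : Fits w S N) : 8 ≤ 2 ^ w := by
  have := h.pos
  have := h.word
  nlinarith

theorem Op.eval_lt (w : ℕ) (o : Op) (a b : ℕ) : o.eval w a b < 2 ^ w :=
  Nat.mod_lt _ (by positivity)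

theorem Op.eval_or_self {w a : ℕ} (h : a < 2 ^ w) : Op.or.eval w a a = a := by
  simp [Op.eval, Nat.mod_eq_of_lt h]

/-- All values fit into words. -/
structure St.Bdd (w : ℕ) (σ : St) : Prop where
  var : ∀ x, σ.var x < 2 ^ w
  arr : ∀ a i j, σ.arr a i j < 2 ^ w

theorem iter_induction {α : Type*} {f : ℕ → α → α} {a : α} (P : ℕ → α → Prop) (m : ℕ)
    (h0 : P 0 a) (h : ∀ k < m, ∀ b, P k b → P (k + 1) (f k b)) : P m (iter f a m) := by
  induction m with
  | zero => exact h0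
  | succ m ih => exact h m (Nat.lt_succ_self m) _ (ih fun k hk => h k (hk.trans (Nat.lt_succ_self m)))

theorem update_lt {B : ℕ} {v : ℕ → ℕ} (h : ∀ x, v x < B) (i : ℕ) {k : ℕ} (hk : k < B) :
    ∀ x, Function.update v i k x < B := by
  intro x
  by_cases hx : x = i
  · simpa [hx] using hk
  · simpa [hx] using h x

theorem Expr.eval_lt {w N S : ℕ} (hF : Fits w S N) {A : Fin 8 → ℕ → ℕ → ℕ}
    (hA : ∀ a i j, A a i j < 2 ^ w) (e : Expr) :
    ∀ v : ℕ → ℕ, (∀ x, v x < 2 ^ w) → e.eval w N A v < 2 ^ w := by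
  have h2 : 0 < 2 ^ w := by positivity
  induction e with
  | lit a => intro v hv; exact Nat.mod_lt _ h2
  | var x => intro v hv; exact hv x
  | arr a i j _ _ =>
    intro v hv
    simp only [Expr.eval]
    split
    · exact hA _ _ _
    · exact h2
  | op o e f _ _ => intro v hv; exact Op.eval_lt _ _ _ _
  | ite c e f _ he hf =>
    intro v hv
    simp only [Expr.eval]
    split
    · exact he v hv
    · exact hf v hv
  | fold i x b e f _ he hf =>
    intro v hv
    refine iter_induction (fun _ r => r < 2 ^ w) _ (he v hv) fun k hk r hr => hf _ ?_
    exact update_lt (update_lt hv _ (by have := hF.lt; omega)) _ hr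

theorem Cmd.run_bdd {w N S : ℕ} (hF : Fits w S N) (c : Cmd) :
    ∀ σ : St, σ.Bdd w → (c.run w N σ).Bdd w := by
  have h2 : 0 < 2 ^ w := by positivity
  induction c with
  | skip => intro σ h; exact h
  | assign x e =>
    intro σ h
    exact ⟨update_lt h.var _ (e.eval_lt hF h.arr _ h.var), h.arr⟩
  | store a i j e =>
    intro σ h
    simp only [Cmd.run]
    split
    · refine ⟨h.var, fun a' i' j' => ?_⟩
      have h1 := h.arr a' i' j'
      have h2 := e.eval_lt hF h.arr _ h.var
      simp only [Function.update_apply]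
      split_ifs <;> first
        | (subst_vars; simp only [Function.update_apply]; split_ifs <;> first | exact h.arr _ _ _ | exact h2 | (simp only [Function.update_apply]; split_ifs <;> first | exact h.arr _ _ _ | exact h2))
        | exact h1
    · exact h
  | read x =>
    intro σ h
    exact ⟨update_lt h.var _ (Nat.mod_lt _ h2), h.arr⟩
  | write e => intro σ h; exact ⟨h.var, h.arr⟩
  | seq p q hp hq => intro σ h; exact hq _ (hp _ h)
  | ite c p q hp hq =>
    intro σ h
    simp only [Cmd.run]
    split
    · exact hp _ h
    · exact hq _ h
  | forRange i b p hp =>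
    intro σ h
    refine iter_induction (fun _ (τ : St) => τ.Bdd w) _ h fun k hk τ hτ => hp _ ?_
    exact ⟨update_lt hτ.var _ (by have := hF.lt; omega), hτ.arr⟩

/-- The machine state `s` represents `σ`. -/
structure Rep (w N : ℕ) (σ : St) (s : State) : Prop where
  bdd : σ.Bdd w
  size : s.reg 0 = N
  var : ∀ x, s.reg (rv x) = σ.var x
  arr : ∀ (a : Fin 8) (i j : ℕ), i < N → j < N → s.mem ((i * N + j) * 8 + a) = σ.arr a i j
  input : s.input = σ.input
  output : s.output = σ.output

namespace Rep

variable {w N : ℕ} {σ : St} {s : State}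

theorem scratch (h : Rep w N σ s) (k v : ℕ) :
    Rep w N σ { s with reg := Function.update s.reg (sc k) v } := by
  refine ⟨h.bdd, ?_, fun x => ?_, h.arr, h.input, h.output⟩
  · simpa [Function.update_apply, sc] using h.size
  · have : rv x ≠ sc k := by unfold rv sc; omega
    simpa [Function.update_apply, this] using h.var x

theorem setVar (h : Rep w N σ s) (x : ℕ) {v : ℕ} (hv : v < 2 ^ w) :
    Rep w N { σ with var := Function.update σ.var x v }
      { s with reg := Function.update s.reg (rv x) v } := by
  refine ⟨⟨update_lt h.bdd.var _ hv, h.bdd.arr⟩, ?_, fun y => ?_, h.arr, h.input, h.output⟩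
  · simpa [Function.update_apply, rv] using h.size
  · by_cases hxy : y = x
    · simp [hxy]
    · have : rv y ≠ rv x := by unfold rv; omega
      simpa [Function.update_apply, this, hxy] using h.var y

end Rep

theorem update_sc_ne {r : ℕ → ℕ} {k l v : ℕ} (h : k ≠ l) :
    Function.update r (sc l) v (sc k) = r (sc k) :=
  Function.update_of_ne (by unfold sc; omega) _ _

theorem update_rv_sc {r : ℕ → ℕ} {k x v : ℕ} : Function.update r (rv x) v (sc k) = r (sc k) :=
  Function.update_of_ne (by unfold sc rv; omega) _ _

end WordRAM

namespace WordRAM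

/-- `s'` represents `σ` and agrees with `s` on the scratch registers below `b`. -/
def Keeps (w N b : ℕ) (σ : St) (s s' : State) : Prop :=
  Rep w N σ s' ∧ ∀ k < b, s'.reg (sc k) = s.reg (sc k)

namespace Keeps

variable {w N b : ℕ} {σ τ : St} {s s' s'' : State}

theorem refl (h : Rep w N σ s) : Keeps w N b σ s s := ⟨h, fun _ _ => rfl⟩

theorem trans (h : Keeps w N b σ s s') (h' : Keeps w N b τ s' s'') : Keeps w N b τ s s'' :=
  ⟨h'.1, fun k hk => (h'.2 k hk).trans (h.2 k hk)⟩

theorem mono {b' : ℕ} (hb : b ≤ b') (h : Keeps w N b' σ s s') : Keeps w N b σ s s' :=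
  ⟨h.1, fun k hk => h.2 k (by omega)⟩

theorem scratch (h : Keeps w N b σ s s') {l : ℕ} (hl : b ≤ l) (v : ℕ) :
    Keeps w N b σ s { s' with reg := Function.update s'.reg (sc l) v } :=
  ⟨h.1.scratch l v, fun k hk => (update_sc_ne (by omega)).trans (h.2 k hk)⟩

theorem setVar (h : Keeps w N b σ s s') (x : ℕ) {v : ℕ} (hv : v < 2 ^ w) :
    Keeps w N b { σ with var := Function.update σ.var x v } s
      { s' with reg := Function.update s'.reg (rv x) v } :=
  ⟨h.1.setVar x hv, fun k hk => update_rv_sc.trans (h.2 k hk)⟩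

end Keeps

section Steps

variable {w S N b : ℕ} {σ : St} {s₀ s : State} {Q : State → Prop}

theorem Tri.scratchOp {o : Op} {l y z : ℕ} (hl : b ≤ l) (h : Keeps w N b σ s₀ s)
    (hQ : ∀ s', Keeps w N b σ s₀ s' → s'.reg (sc l) = o.eval w (s.reg y) (s.reg z) →
      (∀ k, k ≠ l → s'.reg (sc k) = s.reg (sc k)) → Q s') : Tri w S (.op o (sc l) y z) s 1 Q :=
  .op (hQ _ (h.scratch hl _) (by simp) fun _ hk => update_sc_ne hk)

theorem Tri.scratchConst {l a : ℕ} (hl : b ≤ l) (h : Keeps w N b σ s₀ s)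
    (hQ : ∀ s', Keeps w N b σ s₀ s' → s'.reg (sc l) = a % 2 ^ w →
      (∀ k, k ≠ l → s'.reg (sc k) = s.reg (sc k)) → Q s') : Tri w S (.const (sc l) a) s 1 Q :=
  .const (hQ _ (h.scratch hl _) (by simp) fun _ hk => update_sc_ne hk)

theorem Tri.varCopy {x l : ℕ} (h : Keeps w N b σ s₀ s) (hv : s.reg (sc l) < 2 ^ w)
    (hQ : ∀ s', Keeps w N b { σ with var := Function.update σ.var x (s.reg (sc l)) } s₀ s' →
      (∀ k, s'.reg (sc k) = s.reg (sc k)) → Q s') :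
    Tri w S (.op .or (rv x) (sc l) (sc l)) s 1 Q :=
  .op (hQ _ (by rw [Op.eval_or_self hv]; exact h.setVar x hv) fun _ => update_rv_sc)

theorem addrProg_spec (hF : Fits w S N) (a : Fin 8) {i j : ℕ} (hi : i < N) (hj : j < N)
    (h : Keeps w N b σ s₀ s) (hri : s.reg (sc b) = i) (hrj : s.reg (sc (b + 1)) = j) :
    Tri w S (addrProg b a) s 6 (fun s' => Keeps w N b σ s₀ s' ∧
      s'.reg (sc b) = (i * N + j) * 8 + a ∧ (i * N + j) * 8 + a < S) := by
  have hb : (i * N + j) * 8 + a < 8 * N * N := by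
    have := a.isLt
    have : (i + 1) * N ≤ N * N := Nat.mul_le_mul_right _ hi
    nlinarith
  have hw := hF.word
  have h8 : 8 < 2 ^ w ∨ 8 = 2 ^ w := hF.eight.lt_or_eq
  simp only [addrProg, block]
  refine (Tri.seq (Tri.scratchOp le_rfl h fun s1 k1 r1 f1 => ?_) fun _ h => h).weaken
    (show 1 + 5 ≤ 6 by omega) (fun _ h => h)
  refine (Tri.seq (Tri.scratchOp le_rfl k1 fun s2 k2 r2 f2 => ?_) fun _ h => h).weaken
    (show 1 + 4 ≤ 5 by omega) (fun _ h => h)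
  refine (Tri.seq (Tri.scratchConst (l := b + 2) (by omega) k2 fun s3 k3 r3 f3 => ?_)
    fun _ h => h).weaken (show 1 + 3 ≤ 4 by omega) (fun _ h => h)
  refine (Tri.seq (Tri.scratchOp le_rfl k3 fun s4 k4 r4 f4 => ?_) fun _ h => h).weaken
    (show 1 + 2 ≤ 3 by omega) (fun _ h => h)
  refine (Tri.seq (Tri.scratchConst (l := b + 2) (by omega) k4 fun s5 k5 r5 f5 => ?_)
    fun _ h => h).weaken (show 1 + 1 ≤ 2 by omega) (fun _ h => h)
  refine Tri.scratchOp le_rfl k5 fun s6 k6 r6 f6 => ⟨k6, ?_, by have := hF.mem; omega⟩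
  rw [r6, f5 b (by omega), r5, r4, f3 b (by omega), r3, r2, f1 (b + 1) (by omega), hrj, r1, hri,
    h.1.size]
  have e1 : Op.mul.eval w i N = i * N := by
    simp only [Op.eval]; exact Nat.mod_eq_of_lt (by nlinarith)
  have e2 : Op.add.eval w (i * N) j = i * N + j := by
    simp only [Op.eval]; exact Nat.mod_eq_of_lt (by nlinarith)
  have e3 : Op.mul.eval w (i * N + j) (8 % 2 ^ w) = (i * N + j) * 8 := by
    simp only [Op.eval, Nat.mul_mod_mod]; exact Nat.mod_eq_of_lt (by omega)
  rw [e1, e2, e3]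
  simp only [Op.eval, Nat.add_mod_mod]; exact Nat.mod_eq_of_lt (by omega)

end Steps

theorem Op.eval_lt_ne_zero {w a b : ℕ} (hw : 2 ≤ 2 ^ w) : Op.lt.eval w a b ≠ 0 ↔ a < b := by
  have : (1 : ℕ) % 2 ^ w = 1 := Nat.mod_eq_of_lt (by omega)
  by_cases h : a < b <;> simp [Op.eval, h, this]

theorem Op.eval_lt_eq {w a b : ℕ} (hw : 2 ≤ 2 ^ w) :
    Op.lt.eval w a b = if a < b then 1 else 0 := by
  have : (1 : ℕ) % 2 ^ w = 1 := Nat.mod_eq_of_lt (by omega)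
  by_cases h : a < b <;> simp [Op.eval, h, this]

theorem Op.eval_and_lt {w a b c d : ℕ} (hw : 2 ≤ 2 ^ w) :
    Op.and.eval w (Op.lt.eval w a b) (Op.lt.eval w c d) ≠ 0 ↔ a < b ∧ c < d := by
  have : (1 : ℕ) % 2 ^ w = 1 := Nat.mod_eq_of_lt (by omega)
  rw [Op.eval_lt_eq hw, Op.eval_lt_eq hw]
  by_cases h : a < b <;> by_cases h' : c < d <;> simp [Op.eval, h, h', this]

/-- The loop bound `min m N` is computed into the scratch register `b`. -/
theorem clamp_spec {w S N b m : ℕ} {σ : St} {s₀ s : State} (hF : Fits w S N)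
    (h : Keeps w N b σ s₀ s) (hr : s.reg (sc b) = m) {q : Program} {B : ℕ} {Q : State → Prop}
    (hQ : ∀ s', Keeps w N b σ s₀ s' → s'.reg (sc b) = min m N → Tri w S q s' B Q) :
    Tri w S (.seq (.op .lt (sc (b + 1)) 0 (sc b))
      (.seq (.ite (sc (b + 1)) (.op .or (sc b) 0 0) .skip) q)) s (B + 4) Q := by
  have h2 : 2 ≤ 2 ^ w := by have := hF.eight; omega
  refine (Tri.seq (Tri.scratchOp (l := b + 1) (by omega) h fun s1 k1 r1 f1 => ?_)
    fun _ h => h).weaken (show 1 + (3 + B) ≤ B + 4 by omega) (fun _ h => h)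
  refine Tri.seq (R := fun s' => Keeps w N b σ s₀ s' ∧ s'.reg (sc b) = min m N)
    (Tri.ite (B₁ := 1) (B₂ := 1) (fun hx => ?_) (fun hx => ?_)) (fun s' hs' => hQ s' hs'.1 hs'.2)
  · refine Tri.scratchOp le_rfl k1 fun s2 k2 r2 _ => ⟨k2, ?_⟩
    rw [r1, Op.eval_lt_ne_zero h2, h.1.size, hr] at hx
    rw [r2, k1.1.size, Op.eval_or_self hF.lt]
    omega
  · refine Tri.skip ⟨k1, ?_⟩
    rw [f1 _ (by omega), hr]
    rw [r1] at hx
    have : ¬ s.reg 0 < s.reg (sc b) := fun h => (Op.eval_lt_ne_zero h2).2 h hx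
    rw [h.1.size, hr] at this
    omega

theorem Expr.comp_spec {w S N : ℕ} (hF : Fits w S N) (e : Expr) :
    ∀ (b : ℕ) (σ : St) (s₀ s : State), Keeps w N b σ s₀ s →
      Tri w S (e.comp b) s (e.cost N) (fun s' => Keeps w N b σ s₀ s' ∧
        s'.reg (sc b) = e.eval w N σ.arr σ.var) := by
  have h2 : 2 ≤ 2 ^ w := by have := hF.eight; omega
  induction e with
  | lit a =>
    intro b σ s₀ s h
    exact Tri.scratchConst le_rfl h fun s' k r _ => ⟨k, r⟩
  | var x =>
    intro b σ s₀ s h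
    refine Tri.scratchOp le_rfl h fun s' k r _ => ⟨k, ?_⟩
    rw [r, h.1.var, Op.eval_or_self (h.1.bdd.var x)]; rfl
  | op o e f he hf =>
    intro b σ s₀ s h
    simp only [Expr.comp, block, Expr.cost]
    refine (Tri.seq (he b σ s₀ s h) fun s1 ⟨k1, r1⟩ => Tri.seq (hf (b + 1) σ s1 s1 (.refl k1.1))
      fun s2 ⟨k2, r2⟩ => Tri.scratchOp le_rfl (k1.trans (k2.mono (by omega)))
      fun s' k r _ => ⟨k, ?_⟩).weaken (by omega) (fun _ h => h)
    rw [r, k2.2 b (by omega), r1, r2]; rfl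
  | ite c e f hc he hf =>
    intro b σ s₀ s h
    simp only [Expr.comp, Expr.cost]
    refine (Tri.seq (hc b σ s₀ s h) fun s1 ⟨k1, r1⟩ => Tri.ite
      (fun hx => (he b σ s₀ s1 k1).weaken le_rfl fun s' h' => ⟨h'.1, ?_⟩)
      (fun hx => (hf b σ s₀ s1 k1).weaken le_rfl fun s' h' => ⟨h'.1, ?_⟩)).weaken
      (by omega) (fun _ h => h)
    · rw [r1] at hx; rw [h'.2]; simp [Expr.eval, hx]
    · rw [r1] at hx; rw [h'.2]; simp [Expr.eval, hx]
  | arr a i j hi hj =>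
    intro b σ s₀ s h
    simp only [Expr.comp, block, Expr.cost]
    refine (Tri.seq (hi b σ s₀ s h) fun s1 ⟨k1, r1⟩ => Tri.seq (hj (b + 1) σ s1 s1 (.refl k1.1))
      fun s2 ⟨k2, r2⟩ => Tri.seq (Tri.scratchOp (l := b + 2) (by omega)
        (k1.trans (k2.mono (by omega))) fun s3 k3 r3 f3 => ?_) fun _ h => h).weaken
      (show _ + (_ + (1 + 11)) ≤ _ by omega) (fun _ h => h)
    refine (Tri.seq (Tri.scratchOp (l := b + 3) (by omega) k3 fun s4 k4 r4 f4 => ?_)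
      fun _ h => h).weaken (show 1 + 10 ≤ 11 by omega) (fun _ h => h)
    refine (Tri.seq (Tri.scratchOp (l := b + 2) (by omega) k4 fun s5 k5 r5 f5 => ?_)
      fun _ h => h).weaken (show 1 + 9 ≤ 10 by omega) (fun _ h => h)
    have q0 : s5.reg (sc b) = i.eval w N σ.arr σ.var := by
      rw [f5 _ (by omega), f4 _ (by omega), f3 _ (by omega), k2.2 b (by omega), r1]
    have q1 : s5.reg (sc (b + 1)) = j.eval w N σ.arr σ.var := by
      rw [f5 _ (by omega), f4 _ (by omega), f3 _ (by omega), r2]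
    have hcond : s5.reg (sc (b + 2)) ≠ 0 ↔
        i.eval w N σ.arr σ.var < N ∧ j.eval w N σ.arr σ.var < N := by
      rw [r5, f4 _ (by omega), r3, r4, f3 _ (by omega), k3.1.size, k2.1.size, k2.2 b (by omega),
        r1, r2, Op.eval_and_lt h2]
    refine (Tri.ite (B₁ := 7) (B₂ := 1) (fun hx => ?_) (fun hx => ?_)).weaken
      (by omega) (fun _ h => h)
    · obtain ⟨h1, h1'⟩ := hcond.1 hx
      refine (Tri.seq (addrProg_spec hF a h1 h1' k5 q0 q1) fun s6 ⟨k6, r6, hS⟩ =>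
        Tri.load (by rw [r6]; exact hS) ⟨k6.scratch le_rfl _, ?_⟩)
      simp only [Function.update_self, r6, Expr.eval, h1, h1', and_self, if_true]
      exact k6.1.arr a _ _ h1 h1'
    · refine Tri.scratchConst le_rfl k5 fun s6 k6 r6 _ => ⟨k6, ?_⟩
      have := mt hcond.2 (not_not.2 hx)
      rw [r6, Nat.zero_mod, Expr.eval, if_neg this]
  | fold i x m e f hm he hf =>
    intro b σ s₀ s h
    simp only [Expr.comp, block, Expr.cost]
    set M := min (m.eval w N σ.arr σ.var) N with hM
    have hMw : M < 2 ^ w := by have := hF.lt; omega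
    refine (Tri.seq (hm b σ s₀ s h) fun s1 ⟨k1, r1⟩ => clamp_spec hF k1 r1
      fun s2 k2 r2 => Tri.seq (he (b + 1) σ s2 s2 (.refl k2.1)) fun s3 ⟨k3, r3⟩ =>
      Tri.seq (Tri.scratchOp (l := b + 2) (by omega) (k2.trans (k3.mono (by omega)))
        fun s4 k4 r4 f4 => ?_) fun _ h => h).weaken
      (show _ + ((_ + (1 + (N * (f.cost N + 10) + 8))) + 4) ≤ _ by omega) (fun _ h => h)
    refine (Tri.seq (Tri.scratchOp (l := b + 3) (by omega) k4
        fun s5 k5 r5 f5 => ?_) fun _ h => h).weaken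
      (show 1 + (N * (f.cost N + 10) + 7) ≤ _ by omega) (fun _ h => h)
    refine (Tri.seq (Tri.scratchConst (l := b + 4) (by omega) k5
        fun s6 k6 r6 f6 => ?_) fun _ h => h).weaken
      (show 1 + (N * (f.cost N + 10) + 6) ≤ _ by omega) (fun _ h => h)
    refine (Tri.seq (Tri.scratchOp (l := b + 5) (by omega) k6
        fun s7 k7 r7 f7 => ?_) fun _ h => h).weaken
      (show 1 + (N * (f.cost N + 10) + 5) ≤ _ by omega) (fun _ h => h)
    set F : ℕ → ℕ → ℕ := fun k r =>
      f.eval w N σ.arr (Function.update (Function.update σ.var i k) x r) with hFdef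
    set e0 := e.eval w N σ.arr σ.var with he0
    have hit : ∀ k, k ≤ M → iter F e0 k < 2 ^ w := by
      intro k hk
      refine iter_induction (fun _ r => r < 2 ^ w) k (e.eval_lt hF h.1.bdd.arr _ h.1.bdd.var)
        fun l hl r hr => f.eval_lt hF h.1.bdd.arr _ ?_
      exact update_lt (update_lt h.1.bdd.var _ (by omega)) _ hr
    -- the loop invariant
    let I : ℕ → State → Prop := fun k t =>
      (∃ vi vx, Keeps w N b
        { σ with var := Function.update (Function.update σ.var i vi) x vx } s₀ t) ∧
      t.reg (sc b) = M ∧ t.reg (sc (b + 1)) = iter F e0 k ∧ t.reg (sc (b + 2)) = σ.var i ∧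
      t.reg (sc (b + 3)) = σ.var x ∧ t.reg (sc (b + 4)) = k ∧
      t.reg (sc (b + 5)) = if k < M then 1 else 0
    refine (Tri.seq (R := I M) (Tri.loop_count (B := f.cost N + 6) I M (fun k t hk ht => ?_)
      (fun t ht => by simpa using ht.2.2.2.2.2.2) ?_) fun t ht => ?_).weaken
      (show _ + 3 ≤ _ by
        have := Nat.mul_le_mul_right (f.cost N + 6 + 1) (show M ≤ N by omega)
        have h3 : N * (f.cost N + 6 + 1) ≤ N * (f.cost N + 10) := Nat.mul_le_mul_left _ (by omega)
        omega) (fun _ h => h)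
    · obtain ⟨⟨vi, vx, kt⟩, t0, t1, t2, t3, t4, t5⟩ := ht
      refine ⟨by rw [t5, if_pos hk]; omega, ?_⟩
      refine (Tri.seq (Tri.varCopy kt (by rw [t4]; omega) fun u1 l1 g1 => ?_)
        fun _ h => h).weaken (show 1 + (f.cost N + 5) ≤ _ by omega) (fun _ h => h)
      refine (Tri.seq (Tri.varCopy l1 (by rw [g1, t1]; exact hit k hk.le) fun u2 l2 g2 => ?_)
        fun _ h => h).weaken (show 1 + (f.cost N + 4) ≤ _ by omega) (fun _ h => h)
      have hst : Function.update (Function.update (Function.update (Function.update σ.var i vi) x vx)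
          i (t.reg (sc (b + 4)))) x (u1.reg (sc (b + 1))) =
          Function.update (Function.update σ.var i k) x (iter F e0 k) := by
        rw [g1, t1, t4]
        funext y
        simp only [Function.update_apply]
        split_ifs <;> rfl
      simp only at l2
      rw [hst] at l2
      refine (Tri.seq (hf (b + 6) _ u2 u2 (.refl l2.1)) fun u3 ⟨l3, g3⟩ => ?_).weaken
        (show f.cost N + 4 ≤ _ by omega) (fun _ h => h)
      have l3' := l2.trans (l3.mono (show b ≤ b + 6 by omega))
      refine (Tri.seq (Tri.scratchOp (l := b + 1) (by omega) l3' fun u4 l4 g4 f4 => ?_)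
        fun _ h => h).weaken (show 1 + 3 ≤ _ by omega) (fun _ h => h)
      refine (Tri.seq (Tri.scratchConst (l := b + 6) (by omega) l4 fun u5 l5 g5 f5 => ?_)
        fun _ h => h).weaken (show 1 + 2 ≤ _ by omega) (fun _ h => h)
      refine (Tri.seq (Tri.scratchOp (l := b + 4) (by omega) l5 fun u6 l6 g6 f6 => ?_)
        fun _ h => h).weaken (show 1 + 1 ≤ _ by omega) (fun _ h => h)
      refine Tri.scratchOp (l := b + 5) (by omega) l6 fun u7 l7 g7 f7 => ?_
      have z (j : ℕ) (hj : j < b + 6) : u3.reg (sc j) = t.reg (sc j) := by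
        rw [l3.2 j hj, g2, g1]
      have q4 : u6.reg (sc (b + 4)) = k + 1 := by
        rw [g6, g5, f5 _ (by omega), f4 _ (by omega), z _ (by omega), t4]
        simp only [Op.eval, Nat.add_mod_mod]
        exact Nat.mod_eq_of_lt (by omega)
      have q0 : u6.reg (sc b) = M := by
        rw [f6 _ (by omega), f5 _ (by omega), f4 _ (by omega), z _ (by omega), t0]
      refine ⟨⟨_, _, l7⟩, ?_, ?_, ?_, ?_, ?_, ?_⟩
      · rw [f7 _ (by omega), q0]
      · rw [f7 _ (by omega), f6 _ (by omega), f5 _ (by omega), g4, g3]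
        exact Op.eval_or_self (hit (k + 1) hk)
      · rw [f7 _ (by omega), f6 _ (by omega), f5 _ (by omega), f4 _ (by omega), z _ (by omega), t2]
      · rw [f7 _ (by omega), f6 _ (by omega), f5 _ (by omega), f4 _ (by omega), z _ (by omega), t3]
      · rw [f7 _ (by omega), q4]
      · rw [g7, q4, q0, Op.eval_lt_eq h2]
    · refine ⟨⟨σ.var i, σ.var x, ?_⟩, ?_, ?_, ?_, ?_, ?_, ?_⟩
      · have : Function.update (Function.update σ.var i (σ.var i)) x (σ.var x) = σ.var := by
          simp
        rw [this]; exact k7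
      · rw [f7 _ (by omega), f6 _ (by omega), f5 _ (by omega), f4 _ (by omega), k3.2 b (by omega),
          r2]
      · rw [f7 _ (by omega), f6 _ (by omega), f5 _ (by omega), f4 _ (by omega), r3]; rfl
      · rw [f7 _ (by omega), f6 _ (by omega), f5 _ (by omega), r4, k3.1.var,
          Op.eval_or_self (h.1.bdd.var i)]
      · rw [f7 _ (by omega), f6 _ (by omega), r5, k4.1.var, Op.eval_or_self (h.1.bdd.var x)]
      · rw [f7 _ (by omega), r6, Nat.zero_mod]
      · rw [r7, r6, Nat.zero_mod, Op.eval_lt_eq h2, f6 _ (by omega), f5 _ (by omega),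
          f4 _ (by omega), k3.2 b (by omega), r2]
    · obtain ⟨⟨vi, vx, kt⟩, t0, t1, t2, t3, t4, t5⟩ := ht
      refine (Tri.seq (Tri.varCopy kt (by rw [t2]; exact h.1.bdd.var i) fun u1 l1 g1 => ?_)
        fun _ h => h).weaken (show 1 + 2 ≤ _ by omega) (fun _ h => h)
      refine (Tri.seq (Tri.varCopy l1 (by rw [g1, t3]; exact h.1.bdd.var x) fun u2 l2 g2 => ?_)
        fun _ h => h).weaken (show 1 + 1 ≤ _ by omega) (fun _ h => h)
      have hst : Function.update (Function.update (Function.update (Function.update σ.var i vi) x vx)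
          i (t.reg (sc (b + 2)))) x (u1.reg (sc (b + 3))) = σ.var := by
        rw [g1, t2, t3]
        funext y
        simp only [Function.update_apply]
        split_ifs with h1 h2 <;> simp_all
      simp only at l2
      rw [hst] at l2
      refine Tri.scratchOp (l := b) le_rfl l2 fun u3 l3 g3 _ => ⟨l3, ?_⟩
      rw [g3, g2, g1, t1, Op.eval_or_self (hit M le_rfl)]; rfl

theorem Cmd.comp_spec {w S N : ℕ} (hF : Fits w S N) (c : Cmd) :
    ∀ (b : ℕ) (σ : St) (s₀ s : State), Keeps w N b σ s₀ s →
      Tri w S (c.comp b) s (c.cost N) (Keeps w N b (c.run w N σ) s₀) := by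
  have h2 : 2 ≤ 2 ^ w := by have := hF.eight; omega
  induction c with
  | skip => intro b σ s₀ s h; exact Tri.skip h
  | assign x e =>
    intro b σ s₀ s h
    refine Tri.seq (e.comp_spec hF b σ s₀ s h) fun s1 ⟨k1, r1⟩ =>
      Tri.varCopy k1 (by rw [r1]; exact e.eval_lt hF h.1.bdd.arr _ h.1.bdd.var) fun s2 k2 _ => ?_
    rw [r1] at k2; exact k2
  | store a i j e =>
    intro b σ s₀ s h
    simp only [Cmd.comp, block, Cmd.cost]
    refine (Tri.seq (e.comp_spec hF b σ s₀ s h) fun s1 ⟨k1, r1⟩ =>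
      Tri.seq (i.comp_spec hF (b + 1) σ s1 s1 (.refl k1.1)) fun s2 ⟨k2, r2⟩ =>
      Tri.seq (j.comp_spec hF (b + 2) σ s2 s2 (.refl k2.1)) fun s3 ⟨k3, r3⟩ =>
      Tri.seq (Tri.scratchOp (l := b + 3) (by omega)
        ((k1.trans (k2.mono (by omega))).trans (k3.mono (by omega)))
        fun s4 k4 r4 f4 => ?_) fun _ h => h).weaken
      (show _ + (_ + (_ + (1 + 11))) ≤ _ by omega) (fun _ h => h)
    refine (Tri.seq (Tri.scratchOp (l := b + 4) (by omega) k4 fun s5 k5 r5 f5 => ?_)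
      fun _ h => h).weaken (show 1 + 10 ≤ 11 by omega) (fun _ h => h)
    refine (Tri.seq (Tri.scratchOp (l := b + 3) (by omega) k5 fun s6 k6 r6 f6 => ?_)
      fun _ h => h).weaken (show 1 + 9 ≤ 10 by omega) (fun _ h => h)
    have q0 : s6.reg (sc b) = e.eval w N σ.arr σ.var := by
      rw [f6 _ (by omega), f5 _ (by omega), f4 _ (by omega), k3.2 b (by omega),
        k2.2 b (by omega), r1]
    have q1 : s6.reg (sc (b + 1)) = i.eval w N σ.arr σ.var := by
      rw [f6 _ (by omega), f5 _ (by omega), f4 _ (by omega), k3.2 (b + 1) (by omega), r2]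
    have q2 : s6.reg (sc (b + 2)) = j.eval w N σ.arr σ.var := by
      rw [f6 _ (by omega), f5 _ (by omega), f4 _ (by omega), r3]
    have hcond : s6.reg (sc (b + 3)) ≠ 0 ↔
        i.eval w N σ.arr σ.var < N ∧ j.eval w N σ.arr σ.var < N := by
      rw [r6, f5 _ (by omega), r4, r5, f4 _ (by omega), k4.1.size, k3.1.size,
        k3.2 (b + 1) (by omega), r2, r3, Op.eval_and_lt h2]
    refine (Tri.ite (B₁ := 7) (B₂ := 1) (fun hx => ?_) (fun hx => ?_)).weaken
      (by omega) (fun _ h => h)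
    · obtain ⟨h1, h1'⟩ := hcond.1 hx
      have q2' : s6.reg (sc (b + 1 + 1)) = j.eval w N σ.arr σ.var := q2
      refine (Tri.seq (addrProg_spec (b := b + 1) hF a h1 h1' (Keeps.refl k6.1) q1 q2')
        fun s7 ⟨k7, r7, hS⟩ => Tri.store (by rw [r7]; exact hS) ?_)
      have hb := Cmd.run_bdd hF (.store a i j e) σ h.1.bdd
      have k8 : Keeps w N b σ s₀ s7 := k6.trans (k7.mono (by omega))
      refine ⟨⟨hb, k8.1.size, ?_, ?_, ?_, ?_⟩, k8.2⟩
      · intro x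
        simp only [Cmd.run, h1, h1', and_self, if_true]
        exact k8.1.var x
      · intro a' i' j' hi' hj'
        simp only [Cmd.run, h1, h1', and_self, if_true, r7]
        have hsc : s7.reg (sc b) = e.eval w N σ.arr σ.var := (k7.2 b (by omega)).trans q0
        by_cases heq : a' = a ∧ i' = i.eval w N σ.arr σ.var ∧ j' = j.eval w N σ.arr σ.var
        · obtain ⟨rfl, rfl, rfl⟩ := heq
          simp [hsc]
        · have hne : (i' * N + j') * 8 + (a' : ℕ) ≠
              (i.eval w N σ.arr σ.var * N + j.eval w N σ.arr σ.var) * 8 + (a : ℕ) := by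
            intro hcon
            apply heq
            have e1 : i' * N + j' = i.eval w N σ.arr σ.var * N + j.eval w N σ.arr σ.var := by
              have := a.isLt; have := a'.isLt; omega
            have e2 : (a' : ℕ) = a := by omega
            have e3 : i' = i.eval w N σ.arr σ.var := by
              have := congrArg (· / N) e1
              simpa [Nat.mul_comm _ N, Nat.mul_add_div hF.pos, Nat.div_eq_of_lt hj',
                Nat.div_eq_of_lt h1'] using this
            refine ⟨Fin.ext e2, e3, ?_⟩
            rw [e3] at e1; omega
          rw [Function.update_of_ne hne, k8.1.arr a' i' j' hi' hj']
          by_cases c1 : a' = a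
          · subst c1
            by_cases c2 : i' = i.eval w N σ.arr σ.var
            · subst c2
              have c3 : j' ≠ j.eval w N σ.arr σ.var := fun c3 => heq ⟨rfl, rfl, c3⟩
              simp [c3]
            · simp [c2]
          · simp [c1]
      · simp only [Cmd.run, h1, h1', and_self, if_true]; exact k8.1.input
      · simp only [Cmd.run, h1, h1', and_self, if_true]; exact k8.1.output
    · have := mt hcond.2 (not_not.2 hx)
      refine Tri.skip ?_
      rw [Cmd.run, if_neg this]
      exact k6
  | read x =>
    intro b σ s₀ s h
    refine Tri.read ?_
    rw [h.1.input]
    have := h.setVar x (v := σ.input.headD 0 % 2 ^ w) (Nat.mod_lt _ (by positivity))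
    exact ⟨⟨⟨this.1.bdd.var, this.1.bdd.arr⟩, this.1.size, this.1.var, this.1.arr, rfl, this.1.output⟩, this.2⟩
  | write e =>
    intro b σ s₀ s h
    refine Tri.seq (e.comp_spec hF b σ s₀ s h) fun s1 ⟨k1, r1⟩ => Tri.write ?_
    refine ⟨⟨⟨k1.1.bdd.var, k1.1.bdd.arr⟩, k1.1.size, k1.1.var, k1.1.arr, k1.1.input, ?_⟩, k1.2⟩
    simp only [Cmd.run, r1, k1.1.output]
  | seq p q hp hq =>
    intro b σ s₀ s h
    exact Tri.seq (hp b σ s₀ s h) fun s1 k1 => hq b _ s₀ s1 k1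
  | ite c p q hp hq =>
    intro b σ s₀ s h
    simp only [Cmd.comp, Cmd.cost]
    refine (Tri.seq (c.comp_spec hF b σ s₀ s h) fun s1 ⟨k1, r1⟩ => Tri.ite
      (fun hx => (hp b σ s₀ s1 k1).weaken le_rfl fun s' h' => ?_)
      (fun hx => (hq b σ s₀ s1 k1).weaken le_rfl fun s' h' => ?_)).weaken
      (by omega) (fun _ h => h)
    · rw [r1] at hx; simpa [Cmd.run, hx] using h'
    · rw [r1] at hx; simpa [Cmd.run, hx] using h'
  | forRange i m p hp =>
    intro b σ s₀ s h
    simp only [Cmd.comp, block, Cmd.cost]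
    set M := min (m.eval w N σ.arr σ.var) N with hM
    have hMw : M < 2 ^ w := by have := hF.lt; omega
    refine (Tri.seq (m.comp_spec hF b σ s₀ s h) fun s1 ⟨k1, r1⟩ => clamp_spec hF k1 r1
      fun s2 k2 r2 => Tri.seq (Tri.scratchConst (l := b + 1) (by omega) k2
        fun s3 k3 r3 f3 => ?_) fun _ h => h).weaken
      (show _ + ((1 + (N * (p.cost N + 10) + 5)) + 4) ≤ _ by omega) (fun _ h => h)
    refine (Tri.seq (Tri.scratchOp (l := b + 2) (by omega) k3
        fun s4 k4 r4 f4 => ?_) fun _ h => h).weaken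
      (show 1 + (N * (p.cost N + 10) + 4) ≤ _ by omega) (fun _ h => h)
    set F : ℕ → St → St := fun k τ => p.run w N { τ with var := Function.update τ.var i k }
      with hFdef
    let I : ℕ → State → Prop := fun k t =>
      Keeps w N b (iter F σ k) s₀ t ∧
      t.reg (sc b) = M ∧ t.reg (sc (b + 1)) = k ∧ t.reg (sc (b + 2)) = if k < M then 1 else 0
    refine (Tri.loop_count (B := p.cost N + 4) I M (fun k t hk ht => ?_)
      (fun t ht => by simpa using ht.2.2.2) ?_).weaken
      (by
        have := Nat.mul_le_mul_right (p.cost N + 4 + 1) (show M ≤ N by omega)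
        have h3 : N * (p.cost N + 4 + 1) ≤ N * (p.cost N + 10) := Nat.mul_le_mul_left _ (by omega)
        omega) (fun t ht => ht.1)
    · obtain ⟨kt, t0, t1, t2⟩ := ht
      refine ⟨by rw [t2, if_pos hk]; omega, ?_⟩
      refine (Tri.seq (Tri.varCopy kt (by rw [t1]; omega) fun u1 l1 g1 => ?_)
        fun _ h => h).weaken (show 1 + (p.cost N + 3) ≤ _ by omega) (fun _ h => h)
      rw [t1] at l1
      refine (Tri.seq (hp (b + 3) _ u1 u1 (.refl l1.1)) fun u3 l3 => ?_).weaken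
        (show p.cost N + 3 ≤ _ by omega) (fun _ h => h)
      have l3' := l1.trans (l3.mono (show b ≤ b + 3 by omega))
      refine (Tri.seq (Tri.scratchConst (l := b + 3) (by omega) l3' fun u5 l5 g5 f5 => ?_)
        fun _ h => h).weaken (show 1 + 2 ≤ _ by omega) (fun _ h => h)
      refine (Tri.seq (Tri.scratchOp (l := b + 1) (by omega) l5 fun u6 l6 g6 f6 => ?_)
        fun _ h => h).weaken (show 1 + 1 ≤ _ by omega) (fun _ h => h)
      refine Tri.scratchOp (l := b + 2) (by omega) l6 fun u7 l7 g7 f7 => ?_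
      have z (j : ℕ) (hj : j < b + 3) : u3.reg (sc j) = t.reg (sc j) := by
        rw [l3.2 j hj, g1]
      have q4 : u6.reg (sc (b + 1)) = k + 1 := by
        rw [g6, g5, f5 _ (by omega), z _ (by omega), t1]
        simp only [Op.eval, Nat.add_mod_mod]
        exact Nat.mod_eq_of_lt (by omega)
      have q0 : u6.reg (sc b) = M := by
        rw [f6 _ (by omega), f5 _ (by omega), z _ (by omega), t0]
      refine ⟨l7, ?_, ?_, ?_⟩
      · rw [f7 _ (by omega), q0]
      · rw [f7 _ (by omega), q4]
      · rw [g7, q4, q0, Op.eval_lt_eq h2]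
    · refine ⟨k4, ?_, ?_, ?_⟩
      · rw [f4 _ (by omega), f3 _ (by omega), r2]
      · rw [f4 _ (by omega), r3, Nat.zero_mod]
      · rw [r4, r3, Nat.zero_mod, Op.eval_lt_eq h2, f3 _ (by omega), r2]

end WordRAM

/-! ## Depths in rooted forests -/

namespace RootedForest

variable {V : Type*} [Fintype V] (F : RootedForest V)

theorem tail_subset {u v : V} (h : F.anc u v) : F.tail u ⊆ F.tail v :=
  fun w hw => F.trans' w u v hw h

theorem depthAt_mono {u v : V} (h : F.anc u v) : F.depthAt u ≤ F.depthAt v :=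
  Set.ncard_le_ncard (F.tail_subset h) (Set.toFinite _)

theorem eq_of_depthAt_le {u v : V} (h : F.anc u v) (hd : F.depthAt v ≤ F.depthAt u) : u = v := by
  have : F.tail u = F.tail v :=
    Set.eq_of_subset_of_ncard_le (F.tail_subset h) hd (Set.toFinite _)
  have hv : v ∈ F.tail u := by rw [this]; exact F.refl' v
  exact F.antisymm' _ _ h hv

theorem depthAt_lt {u v : V} (h : F.anc u v) (hne : u ≠ v) : F.depthAt u < F.depthAt v := by
  by_contra hc
  exact hne (F.eq_of_depthAt_le h (by omega))

theorem anc_of_depthAt_le {u v x : V} (hu : F.anc u x) (hv : F.anc v x)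
    (h : F.depthAt u ≤ F.depthAt v) : F.anc u v := by
  rcases F.chain' u v x hu hv with h' | h'
  · exact h'
  · rw [F.eq_of_depthAt_le h' h]; exact F.refl' _

theorem eq_of_depthAt_eq {u v x : V} (hu : F.anc u x) (hv : F.anc v x)
    (h : F.depthAt u = F.depthAt v) : u = v :=
  F.eq_of_depthAt_le (F.anc_of_depthAt_le hu hv h.le) h.ge

theorem one_le_depthAt (u : V) : 1 ≤ F.depthAt u :=
  (Set.ncard_pos (Set.toFinite _)).2 ⟨u, F.refl' u⟩

theorem depthAt_le_card (u : V) : F.depthAt u ≤ Fintype.card V := by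
  rw [← Nat.card_eq_fintype_card, ← Set.ncard_univ]
  exact Set.ncard_le_ncard (Set.subset_univ _) (Set.toFinite _)

theorem exists_depthAt_eq (u : V) {i : ℕ} (h1 : 1 ≤ i) (hi : i ≤ F.depthAt u) :
    ∃ x, F.anc x u ∧ F.depthAt x = i := by
  classical
  have hinj : Set.InjOn F.depthAt (F.tail u) := fun x hx y hy h => F.eq_of_depthAt_eq hx hy h
  have hsub : F.depthAt '' F.tail u ⊆ (Finset.Icc 1 (F.depthAt u) : Set ℕ) := by
    rintro _ ⟨x, hx, rfl⟩
    simp only [Finset.coe_Icc, Set.mem_Icc]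
    exact ⟨F.one_le_depthAt x, F.depthAt_mono hx⟩
  have heq : F.depthAt '' F.tail u = (Finset.Icc 1 (F.depthAt u) : Set ℕ) := by
    refine Set.eq_of_subset_of_ncard_le hsub ?_ (Set.toFinite _)
    rw [Set.InjOn.ncard_image hinj, Set.ncard_coe_finset, Nat.card_Icc]
    show _ ≤ F.depthAt u
    omega
  have : i ∈ F.depthAt '' F.tail u := by rw [heq]; simp [h1, hi]
  obtain ⟨x, hx, rfl⟩ := this
  exact ⟨x, hx, rfl⟩

/-- A vertex whose ancestors are in bijection with `1, …, k` has depth `k`. -/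
theorem depthAt_eq_of_bij (u : V) (k : ℕ) (f : V → ℕ) (hf : ∀ x, F.anc x u → 1 ≤ f x ∧ f x ≤ k)
    (hinj : ∀ x y, F.anc x u → F.anc y u → f x = f y → x = y)
    (hsurj : ∀ i, 1 ≤ i → i ≤ k → ∃ x, F.anc x u ∧ f x = i) : F.depthAt u = k := by
  have heq : f '' F.tail u = (Finset.Icc 1 k : Set ℕ) := by
    ext i
    simp only [Set.mem_image, Finset.coe_Icc, Set.mem_Icc]
    constructor
    · rintro ⟨x, hx, rfl⟩; exact hf x hx
    · rintro ⟨h1, h2⟩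
      obtain ⟨x, hx, h⟩ := hsurj i h1 h2
      exact ⟨x, hx, h⟩
  unfold depthAt
  rw [← Set.InjOn.ncard_image (f := f) (s := F.tail u) (fun x hx y hy h => hinj x y hx hy h),
    heq, Set.ncard_coe_finset, Nat.card_Icc]
  omega

open Classical in
/-- The ancestor of `u` at depth `i`, or `u` if there is none. -/
noncomputable def atDepth (u : V) (i : ℕ) : V :=
  if h : ∃ x, F.anc x u ∧ F.depthAt x = i then h.choose else u

theorem atDepth_anc (u : V) (i : ℕ) : F.anc (F.atDepth u i) u := by
  unfold atDepth
  split_ifs with h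
  · exact h.choose_spec.1
  · exact F.refl' u

theorem atDepth_eq {u x : V} (h : F.anc x u) : F.atDepth u (F.depthAt x) = x := by
  have hex : ∃ y, F.anc y u ∧ F.depthAt y = F.depthAt x := ⟨x, h, rfl⟩
  unfold atDepth
  rw [dif_pos hex]
  exact F.eq_of_depthAt_eq hex.choose_spec.1 h hex.choose_spec.2

theorem depthAt_atDepth {u : V} {i : ℕ} (h1 : 1 ≤ i) (hi : i ≤ F.depthAt u) :
    F.depthAt (F.atDepth u i) = i := by
  obtain ⟨x, hx, rfl⟩ := F.exists_depthAt_eq u h1 hi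
  rw [F.atDepth_eq hx]

theorem atDepth_zero (u : V) : F.atDepth u 0 = u := by
  unfold atDepth
  rw [dif_neg]
  rintro ⟨x, _, h⟩
  have := F.one_le_depthAt x
  omega

theorem depthAt_eq_one_iff (hF : F.IsTree) {u : V} : F.depthAt u = 1 ↔ ∀ v, F.anc u v := by
  obtain ⟨r, hr⟩ := hF
  constructor
  · intro h v
    have : r = u := F.eq_of_depthAt_le (hr u) (by have := F.one_le_depthAt r; omega)
    rw [← this]; exact hr v
  · intro h
    unfold depthAt
    rw [Set.ncard_eq_one]
    exact ⟨u, by ext v; exact ⟨fun hv => F.antisymm' _ _ hv (h v), by rintro rfl; exact F.refl' _⟩⟩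

/-- An equivalent form of sensibility: a vertex `x` is among the `R`-ancestors of `u` only if it
already is one of a common `T`-ancestor of `u` and `x`. -/
theorem isSensible_iff {R T : RootedForest V} (hT : T.IsTree) :
    R.IsSensible T ↔ ∀ x u, R.anc x u → ∃ u', T.anc u' u ∧ T.anc u' x ∧ R.anc x u' := by
  obtain ⟨r, hr⟩ := hT
  constructor
  · intro h x u hxu
    by_contra hcon
    push Not at hcon
    -- the deepest common ancestor of `u` and `x`
    obtain ⟨y, ⟨hyu, hyx⟩, hmax⟩ := Set.exists_max_image {y | T.anc y u ∧ T.anc y x} T.depthAt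
      (Set.toFinite _) ⟨r, hr u, hr x⟩
    have hyuN : y ≠ u := by
      rintro rfl
      exact hcon y hyu hyx hxu
    have hyxN : y ≠ x := by
      rintro rfl
      exact hcon y hyu hyx (R.refl' _)
    have child : ∀ z, T.anc y z → y ≠ z → ∃ v, v ∈ T.children y ∧ T.anc v z := by
      intro z hyz hne
      obtain ⟨v, hv, hvd⟩ := T.exists_depthAt_eq z (i := T.depthAt y + 1) (by omega)
        (T.depthAt_lt hyz hne)
      refine ⟨v, ⟨?_, T.anc_of_depthAt_le hyz hv (by omega), fun w h1 h2 => ?_⟩, hv⟩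
      · rintro rfl; omega
      · by_contra hc
        push Not at hc
        have := T.depthAt_lt h1 hc.1.symm
        have := T.depthAt_lt h2 hc.2
        omega
    obtain ⟨v₁, hv₁, h₁⟩ := child u hyu hyuN
    obtain ⟨v₂, hv₂, h₂⟩ := child x hyx hyxN
    have hne : v₁ ≠ v₂ := by
      rintro rfl
      have h3 := hmax v₁ ⟨h₁, h₂⟩
      have h4 := T.depthAt_lt hv₁.2.1 hv₁.1.symm
      omega
    have hx : x ∈ R.closure (T.comp v₁) ∩ R.closure (T.comp v₂) := by
      refine ⟨Set.mem_biUnion (x := u) (Or.inr h₁) hxu, Set.mem_biUnion (x := x) (Or.inr h₂) ?_⟩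
      exact R.refl' x
    rw [h y v₁ hv₁ v₂ hv₂ hne] at hx
    simp only [closure, Set.mem_iUnion] at hx
    obtain ⟨w, hw, hxw⟩ := hx
    exact hcon w (T.trans' _ _ _ hw hyu) (T.trans' _ _ _ hw hyx) hxw
  · intro h u v₁ hv₁ v₂ hv₂ hne
    have key : ∀ v ∈ T.children u, ∀ x ∈ R.closure (T.comp v),
        x ∈ R.closure (T.tail u) ∨ T.anc v x := by
      intro v hv x hx
      simp only [closure, Set.mem_iUnion] at hx ⊢
      obtain ⟨w, hw, hxw⟩ := hx
      obtain ⟨w', hw'w, hw'x, hxw'⟩ := h x w hxw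
      have hcases : T.anc w' v ∨ T.anc v w' := by
        rcases hw with hw | hw
        · exact Or.inl (T.trans' _ _ _ hw'w hw)
        · exact T.chain' _ _ _ hw'w hw
      rcases hcases with h1 | h1
      · by_cases h2 : w' = v
        · right; rw [← h2]; exact hw'x
        · left
          refine ⟨w', ?_, hxw'⟩
          rcases T.chain' _ _ _ h1 hv.2.1 with h3 | h3
          · exact h3
          · rcases hv.2.2 w' h3 h1 with h4 | h4
            · rw [h4]; exact T.refl' _
            · exact absurd h4 h2
      · exact Or.inr (T.trans' _ _ _ h1 hw'x)
    apply Set.Subset.antisymm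
    · rintro x ⟨hx1, hx2⟩
      rcases key v₁ hv₁ x hx1 with h1 | h1
      · exact h1
      rcases key v₂ hv₂ x hx2 with h2 | h2
      · exact h2
      exfalso
      rcases T.chain' _ _ _ h1 h2 with h3 | h3
      · rcases hv₂.2.2 v₁ hv₁.2.1 h3 with h4 | h4
        · exact hv₁.1 h4
        · exact hne h4
      · rcases hv₁.2.2 v₂ hv₂.2.1 h3 with h4 | h4
        · exact hv₂.1 h4
        · exact hne h4.symm
    · intro x hx
      simp only [closure, Set.mem_iUnion] at hx
      obtain ⟨w, hw, hxw⟩ := hx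
      exact ⟨Set.mem_biUnion (x := w) (Or.inl (T.trans' _ _ _ hw hv₁.2.1)) hxw,
        Set.mem_biUnion (x := w) (Or.inl (T.trans' _ _ _ hw hv₂.2.1)) hxw⟩

end RootedForest

/-! ## Sensible elimination trees as attachment schemes -/

namespace RootedForest

variable {V : Type*} [Fintype V]

/-- The vertex that creates the depth-`i` node on the path to `u`, where `u` attaches its own path
at depth `β u` below `a u`. -/
def own (a : V → V) (β : V → ℕ) (u : V) (i : ℕ) : V :=
  (fun x => if i ≤ β x then a x else x)^[Fintype.card V] u

section Own

variable {T : RootedForest V} {a : V → V} {β : V → ℕ}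

theorem own_iterate_anc (ha : ∀ u, T.anc (a u) u) (u : V) (i k : ℕ) :
    T.anc ((fun x => if i ≤ β x then a x else x)^[k] u) u := by
  induction k with
  | zero => exact T.refl' u
  | succ k ih =>
    rw [Function.iterate_succ_apply']
    refine T.trans' _ _ _ ?_ ih
    split_ifs
    · exact ha _
    · exact T.refl' _

theorem own_anc (ha : ∀ u, T.anc (a u) u) (u : V) (i : ℕ) : T.anc (own a β u i) u :=
  own_iterate_anc ha u i _

theorem own_of_lt {u : V} {i : ℕ} (h : β u < i) : own a β u i = u := by
  unfold own
  exact Function.iterate_fixed (by simp [Nat.not_le.2 h]) _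

theorem own_of_le (ha : ∀ u, T.anc (a u) u) {u : V} {i : ℕ} (h : i ≤ β u) :
    own a β u i = own a β (a u) i := by
  set f : V → V := fun x => if i ≤ β x then a x else x with hf
  have hfa : ∀ x, T.anc (f x) x := by
    intro x
    simp only [hf]
    split_ifs
    · exact ha _
    · exact T.refl' _
  have key : ∀ k, f (f^[k] u) = f^[k] u ∨ T.depthAt (f^[k] u) + k ≤ T.depthAt u := by
    intro k
    induction k with
    | zero => right; simp
    | succ k ih =>
      rw [Function.iterate_succ_apply']
      rcases ih with ih | ih
      · left; rw [ih, ih]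
      · by_cases hx : f (f^[k] u) = f^[k] u
        · left; rw [hx, hx]
        · right
          have := T.depthAt_lt (hfa (f^[k] u)) hx
          omega
  have hfix : f (f^[Fintype.card V] u) = f^[Fintype.card V] u := by
    rcases key (Fintype.card V) with h | h
    · exact h
    · have := T.depthAt_le_card u
      have := T.one_le_depthAt (f^[Fintype.card V] u)
      omega
  have hu : f u = a u := by simp [hf, h]
  show f^[_] u = f^[_] (a u)
  rw [← hu, ← Function.iterate_succ_apply, Function.iterate_succ_apply', hfix]

end Own

/-- A scheme describes how an elimination tree of depth at most `d` is created along `T`: the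
vertex `u` adds new nodes at the depths in `(β u, e u]` below the depth-`β u` node on the path to
its ancestor `a u`, and is placed at depth `e u`. -/
structure IsScheme (T : RootedForest V) (G : SimpleGraph V) (d : ℕ) (a : V → V) (β e : V → ℕ) :
    Prop where
  anc : ∀ u, T.anc (a u) u
  cases : ∀ u, (β u = 0 ∧ 1 ≤ e u ∧ (∀ v, T.anc u v) ∧ a u = u) ∨
    (a u ≠ u ∧ β (a u) < β u ∧ β u ≤ e (a u) ∧ β u ≤ e u)
  le : ∀ u, e u ≤ d
  adj : ∀ u w, T.anc w u → G.Adj w u →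
    own a β w (min (e w) (e u)) = own a β u (min (e w) (e u))

/-- Every node that is created at depth `i ∈ (β x, e x)` is used by exactly one vertex. -/
structure IsFilled (a : V → V) (β e : V → ℕ) : Prop where
  slot : ∀ u, β u = e u → β u < e (a u)
  uniq : ∀ u v, β u = e u → β v = e v → a u = a v → β u = β v → u = v
  surj : ∀ x i, β x < i → i < e x → ∃ u, β u = e u ∧ a u = x ∧ β u = i

namespace IsScheme

variable {T : RootedForest V} {G : SimpleGraph V} {d : ℕ} {a : V → V} {β e : V → ℕ}

theorem le_e (h : IsScheme T G d a β e) (u : V) : β u ≤ e u := by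
  rcases h.cases u with h | h <;> omega

theorem one_le_e (h : IsScheme T G d a β e) (u : V) : 1 ≤ e u := by
  rcases h.cases u with h | h <;> omega

theorem own_a (h : IsScheme T G d a β e) {u : V} (hu : 1 ≤ β u) : own a β u (β u) = a u := by
  rw [own_of_le h.anc le_rfl]
  refine own_of_lt ?_
  rcases h.cases u with h | h <;> omega

theorem own_spec (h : IsScheme T G d a β e) (u : V) {i : ℕ} (h1 : 1 ≤ i) (hi : i ≤ e u) :
    β (own a β u i) < i ∧ i ≤ e (own a β u i) ∧ own a β (own a β u i) i = own a β u i ∧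
      ∀ j ≤ i, own a β u j = own a β (own a β u i) j := by
  induction hn : T.depthAt u using Nat.strong_induction_on generalizing u with
  | _ n ih =>
    by_cases hβ : β u < i
    · rw [own_of_lt hβ]
      exact ⟨hβ, hi, own_of_lt hβ, fun _ _ => rfl⟩
    · have hβ' : i ≤ β u := by omega
      have hc : a u ≠ u ∧ β (a u) < β u ∧ β u ≤ e (a u) ∧ β u ≤ e u := by
        rcases h.cases u with h | h
        · omega
        · exact h
      rw [own_of_le h.anc hβ']
      obtain ⟨i1, i2, i3, i4⟩ := ih _ (by rw [← hn]; exact T.depthAt_lt (h.anc u) hc.1) (a u)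
        (by omega) rfl
      refine ⟨i1, i2, i3, fun j hj => ?_⟩
      rw [own_of_le h.anc (hj.trans hβ'), i4 j hj]

theorem own_prefix (h : IsScheme T G d a β e) {u v : V} {i : ℕ} (h1 : 1 ≤ i) (hu : i ≤ e u)
    (hv : i ≤ e v) (heq : own a β u i = own a β v i) {j : ℕ} (hj : j ≤ i) :
    own a β u j = own a β v j := by
  rw [(h.own_spec u h1 hu).2.2.2 j hj, (h.own_spec v h1 hv).2.2.2 j hj, heq]

theorem own_e (h : IsScheme T G d a β e) (u : V) :
    own a β u (e u) = if β u = e u then a u else u := by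
  have := h.le_e u
  have := h.one_le_e u
  split_ifs with hc
  · rw [← hc]; exact h.own_a (by omega)
  · exact own_of_lt (by omega)

theorem pos_inj (h : IsScheme T G d a β e) (hf : IsFilled a β e) {u v : V} (he : e u = e v)
    (ho : own a β u (e u) = own a β v (e v)) : u = v := by
  rw [h.own_e, h.own_e] at ho
  split_ifs at ho with hu hv hv
  · exact hf.uniq u v hu hv ho (by omega)
  · have := hf.slot u hu
    rw [ho] at this; omega
  · have := hf.slot v hv
    rw [← ho] at this; omega
  · exact ho

theorem pos_surj (h : IsScheme T G d a β e) (hf : IsFilled a β e) {x : V} {i : ℕ} (h1 : β x < i)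
    (h2 : i ≤ e x) : ∃ u, e u = i ∧ own a β u (e u) = x := by
  rcases h2.lt_or_eq with h2 | h2
  · obtain ⟨u, hu, hx, hi⟩ := hf.surj x i h1 h2
    exact ⟨u, by omega, by rw [h.own_e, if_pos hu, hx]⟩
  · exact ⟨x, h2.symm, by rw [h.own_e, if_neg (by omega)]⟩

/-- The rooted forest created by a scheme. -/
def toForest (h : IsScheme T G d a β e) (hf : IsFilled a β e) : RootedForest V where
  anc u v := e u ≤ e v ∧ own a β v (e u) = own a β u (e u)
  refl' u := ⟨le_rfl, rfl⟩
  trans' u v w h1 h2 := ⟨h1.1.trans h2.1, by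
    rw [h.own_prefix (h.one_le_e v) h2.1 le_rfl h2.2 h1.1, h1.2]⟩
  antisymm' u v h1 h2 := by
    have he : e u = e v := le_antisymm h1.1 h2.1
    exact h.pos_inj hf he (by rw [← h1.2, he])
  chain' u v w h1 h2 := by
    rcases le_total (e u) (e v) with he | he
    · exact Or.inl ⟨he, by rw [← h.own_prefix (h.one_le_e v) h2.1 le_rfl h2.2 he, h1.2]⟩
    · exact Or.inr ⟨he, by rw [← h.own_prefix (h.one_le_e u) h1.1 le_rfl h1.2 he, h2.2]⟩

theorem exists_node (h : IsScheme T G d a β e) (hf : IsFilled a β e) (v : V) {i : ℕ} (h1 : 1 ≤ i)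
    (hi : i ≤ e v) : ∃ u, (h.toForest hf).anc u v ∧ e u = i := by
  obtain ⟨i1, i2, i3, i4⟩ := h.own_spec v h1 hi
  obtain ⟨u, rfl, hu⟩ := h.pos_surj hf i1 i2
  exact ⟨u, ⟨hi, hu.symm⟩, rfl⟩

theorem depthAt_toForest (h : IsScheme T G d a β e) (hf : IsFilled a β e) (v : V) :
    (h.toForest hf).depthAt v = e v := by
  refine depthAt_eq_of_bij _ v (e v) e (fun x hx => ⟨h.one_le_e x, hx.1⟩)
    (fun x y hx hy hxy => h.pos_inj hf hxy ?_) (fun i h1 hi => h.exists_node hf v h1 hi)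
  rw [← hx.2, ← hy.2, hxy]

theorem toForest_isTree (h : IsScheme T G d a β e) (hf : IsFilled a β e) (hT : T.IsTree) :
    (h.toForest hf).IsTree := by
  obtain ⟨r, hr⟩ := hT
  have hβ : ∀ x, β x < 1 → x = r := by
    intro x hx
    rcases h.cases x with h | h
    · exact T.antisymm' _ _ (h.2.2.1 r) (hr x)
    · omega
  have hown : ∀ v, own a β v 1 = r := fun v =>
    hβ _ (h.own_spec v le_rfl (h.one_le_e v)).1
  obtain ⟨u, hu, -⟩ := h.exists_node hf r le_rfl (h.one_le_e r)
  obtain ⟨u, hu, hue⟩ := h.exists_node hf r le_rfl (h.one_le_e r)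
  refine ⟨u, fun v => ⟨by rw [hue]; exact h.one_le_e v, by rw [hue, hown, hown]⟩⟩

theorem toForest_isElimTree (h : IsScheme T G d a β e) (hf : IsFilled a β e)
    (hT : T.IsElimTree G) : (h.toForest hf).IsElimTree G := by
  refine ⟨h.toForest_isTree hf hT.1, ?_⟩
  have key : ∀ u v, T.anc u v → G.Adj u v → (h.toForest hf).Related u v := by
    intro u v huv hadj
    have := h.adj v u huv hadj
    rcases le_total (e u) (e v) with he | he
    · rw [min_eq_left he] at this
      exact Or.inl ⟨he, this.symm⟩
    · rw [min_eq_right he] at this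
      exact Or.inr ⟨he, this⟩
  intro u v hadj
  rcases hT.2 u v hadj with h' | h'
  · exact key u v h' hadj
  · exact (key v u h' hadj.symm).symm

theorem toForest_isSensible (h : IsScheme T G d a β e) (hf : IsFilled a β e) (hT : T.IsTree) :
    (h.toForest hf).IsSensible T := by
  rw [isSensible_iff hT]
  intro x u hxu
  obtain ⟨i1, i2, i3, i4⟩ := h.own_spec x (h.one_le_e x) le_rfl
  refine ⟨own a β x (e x), ?_, own_anc h.anc _ _, i2, i3⟩
  rw [← hxu.2]
  exact own_anc h.anc _ _

theorem depth_toForest_le (h : IsScheme T G d a β e) (hf : IsFilled a β e) :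
    (h.toForest hf).depth ≤ d := by
  refine Finset.sup_le fun v _ => ?_
  rw [h.depthAt_toForest]
  exact h.le v

theorem own_eq_of_toForest_eq {a' : V → V} {β' e' : V → ℕ} (h : IsScheme T G d a β e)
    (hf : IsFilled a β e) (h' : IsScheme T G d a' β' e') (hf' : IsFilled a' β' e')
    (heq : h.toForest hf = h'.toForest hf') (u : V) {i : ℕ} (h1 : 1 ≤ i) (hi : i ≤ e u) :
    T.anc (own a β u i) (own a' β' u i) := by
  have hee : ∀ v, e v = e' v := fun v => by
    rw [← h.depthAt_toForest hf, ← h'.depthAt_toForest hf', heq]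
  obtain ⟨i1, i2, i3, i4⟩ := h.own_spec u h1 hi
  obtain ⟨y, rfl, hy⟩ := h.pos_surj hf i1 i2
  have hyu : (h.toForest hf).anc y u := ⟨hi, hy.symm⟩
  have hyu' := hyu
  rw [heq] at hyu'
  -- the owner in the second scheme is above `y`
  have hw : (h'.toForest hf').anc y (own a' β' u (e y)) := by
    rw [hee y] at h1 hi ⊢
    rw [hee u] at hi
    obtain ⟨j1, j2, j3, j4⟩ := h'.own_spec u h1 hi
    exact ⟨j2, by rw [j3]; exact hyu'.2⟩
  rw [← heq] at hw
  have := hw.2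
  rw [← hyu.2] at this
  rw [← this]
  exact own_anc h.anc _ _

theorem toForest_inj {a' : V → V} {β' e' : V → ℕ} (h : IsScheme T G d a β e)
    (hf : IsFilled a β e) (h' : IsScheme T G d a' β' e') (hf' : IsFilled a' β' e')
    (heq : h.toForest hf = h'.toForest hf') : a = a' ∧ β = β' ∧ e = e' := by
  have hee : e = e' := funext fun v => by
    rw [← h.depthAt_toForest hf, ← h'.depthAt_toForest hf', heq]
  subst hee
  have hown : ∀ u i, 1 ≤ i → i ≤ e u → own a β u i = own a' β' u i := fun u i h1 hi =>
    T.antisymm' _ _ (own_eq_of_toForest_eq h hf h' hf' heq u h1 hi)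
      (own_eq_of_toForest_eq h' hf' h hf heq.symm u h1 hi)
  have hne : ∀ {a : V → V} {β : V → ℕ}, IsScheme T G d a β e → ∀ u i, 1 ≤ i → i ≤ e u →
      (own a β u i ≠ u ↔ i ≤ β u) := by
    intro a β h u i h1 hi
    constructor
    · intro hn
      by_contra hc
      exact hn (own_of_lt (by omega))
    · intro hle hn
      obtain ⟨i1, -⟩ := h.own_spec u h1 hi
      rw [hn] at i1; omega
  have hββ : β = β' := by
    funext u
    have key : ∀ i, 1 ≤ i → i ≤ e u → (i ≤ β u ↔ i ≤ β' u) := fun i h1 hi => by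
      rw [← hne h u i h1 hi, ← hne h' u i h1 hi, hown u i h1 hi]
    have := h.le_e u
    have := h'.le_e u
    by_contra hc
    rcases Nat.lt_or_gt_of_ne hc with hlt | hlt
    · have := (key (β' u) (by omega) (by omega)).2 le_rfl; omega
    · have := (key (β u) (by omega) (by omega)).1 le_rfl; omega
  subst hββ
  refine ⟨funext fun u => ?_, rfl, rfl⟩
  rcases h.cases u with hc | hc
  · rcases h'.cases u with hc' | hc'
    · rw [hc.2.2.2, hc'.2.2.2]
    · omega
  · rw [← h.own_a (u := u) (by omega), ← h'.own_a (u := u) (by omega)]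
    exact hown u _ (by omega) (h.le_e u)

end IsScheme

/-! ### The scheme of a sensible elimination tree -/

section Converse

variable (R T : RootedForest V)

/-- The number of common `R`-ancestors. -/
noncomputable def common (w u : V) : ℕ := (R.tail w ∩ R.tail u).ncard

theorem le_common_iff {w u : V} {i : ℕ} (h1 : 1 ≤ i) (hi : i ≤ R.depthAt u) :
    i ≤ R.common w u ↔ R.anc (R.atDepth u i) w := by
  have hx := R.depthAt_atDepth h1 hi
  have hxu := R.atDepth_anc u i
  constructor
  · intro h
    by_contra hc
    have hsub : R.tail w ∩ R.tail u ⊆ R.tail (R.atDepth u i) \ {R.atDepth u i} := by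
      rintro y ⟨hyw, hyu⟩
      rcases R.chain' _ _ _ hyu hxu with h' | h'
      · refine ⟨h', ?_⟩
        rintro rfl
        exact hc hyw
      · exact absurd (R.trans' _ _ _ h' hyw) hc
    have h2 := Set.ncard_le_ncard hsub (Set.toFinite _)
    have h3 : (R.tail (R.atDepth u i) \ {R.atDepth u i}).ncard < (R.tail (R.atDepth u i)).ncard :=
      Set.ncard_sdiff_singleton_lt_of_mem (R.refl' (R.atDepth u i)) (Set.toFinite _)
    have h4 : (R.tail (R.atDepth u i)).ncard = i := hx
    unfold common at h
    omega
  · intro h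
    rw [← hx]
    exact Set.ncard_le_ncard (fun y hy => ⟨R.trans' _ _ _ hy h, R.trans' _ _ _ hy hxu⟩)
      (Set.toFinite _)

theorem common_le (w u : V) : R.common w u ≤ R.depthAt w ∧ R.common w u ≤ R.depthAt u :=
  ⟨Set.ncard_le_ncard Set.inter_subset_left (Set.toFinite _),
    Set.ncard_le_ncard Set.inter_subset_right (Set.toFinite _)⟩

theorem atDepth_of_anc {u v : V} {i : ℕ} (h1 : 1 ≤ i) (hi : i ≤ R.depthAt u)
    (h : R.anc (R.atDepth u i) v) : R.atDepth v i = R.atDepth u i := by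
  conv_lhs => rw [← R.depthAt_atDepth h1 hi]
  exact R.atDepth_eq h

/-- For a vertex `u`, its attachment depth and its attachment vertex with respect to `R`. -/
theorem exists_attachment (hR : R.IsTree) (u : V) (hu : ¬ ∀ v, T.anc u v) (hT : T.IsTree) :
    ∃ a, a ≠ u ∧ T.anc a u ∧ 1 ≤ R.common a u ∧
      (∀ w, w ≠ u → T.anc w u → R.common w u ≤ R.common a u) ∧
      ∀ w, T.anc w a → R.common w u = R.common a u → w = a := by
  classical
  obtain ⟨r, hr⟩ := hT
  have hru : r ≠ u := by rintro rfl; exact hu hr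
  obtain ⟨b, ⟨hb1, hb2⟩, hb3⟩ := Set.exists_max_image {w | w ≠ u ∧ T.anc w u}
    (fun w => R.common w u) (Set.toFinite _) ⟨r, hru, hr u⟩
  obtain ⟨a, ⟨ha1, ha2, ha3⟩, ha4⟩ := Set.exists_min_image
    {w | w ≠ u ∧ T.anc w u ∧ R.common w u = R.common b u} T.depthAt (Set.toFinite _)
    ⟨b, hb1, hb2, rfl⟩
  refine ⟨a, ha1, ha2, ?_, fun w h1 h2 => by rw [ha3]; exact hb3 w ⟨h1, h2⟩, fun w h1 h2 => ?_⟩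
  · obtain ⟨q, hq⟩ := hR
    exact (Set.ncard_pos (Set.toFinite _)).2 ⟨q, hq a, hq u⟩
  · have hwu : w ≠ u := by
      rintro rfl
      exact ha1 (T.antisymm' _ _ ha2 h1)
    exact T.eq_of_depthAt_le h1 (ha4 w ⟨hwu, T.trans' _ _ _ h1 ha2, h2.trans ha3⟩)

open Classical in
/-- The attachment vertex. -/
noncomputable def attachOf (hR : R.IsTree) (hT : T.IsTree) (u : V) : V :=
  if hu : ∀ v, T.anc u v then u else (exists_attachment R T hR u hu hT).choose

open Classical in
/-- The attachment depth. -/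
noncomputable def depthOf (hR : R.IsTree) (hT : T.IsTree) (u : V) : ℕ :=
  if ∀ v, T.anc u v then 0 else R.common (attachOf R T hR hT u) u

variable {R T} (hR : R.IsTree) (hT : T.IsTree)

theorem attach_root {u : V} (hu : ∀ v, T.anc u v) :
    attachOf R T hR hT u = u ∧ depthOf R T hR hT u = 0 := by
  simp [attachOf, depthOf, hu]

theorem attach_spec {u : V} (hu : ¬ ∀ v, T.anc u v) :
    attachOf R T hR hT u ≠ u ∧ T.anc (attachOf R T hR hT u) u ∧
      depthOf R T hR hT u = R.common (attachOf R T hR hT u) u ∧ 1 ≤ depthOf R T hR hT u ∧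
      (∀ w, w ≠ u → T.anc w u → R.common w u ≤ depthOf R T hR hT u) ∧
      ∀ w, T.anc w (attachOf R T hR hT u) → R.common w u = depthOf R T hR hT u →
        w = attachOf R T hR hT u := by
  have h := (exists_attachment R T hR u hu hT).choose_spec
  have ha : attachOf R T hR hT u = (exists_attachment R T hR u hu hT).choose := by
    rw [attachOf, dif_neg hu]
  have hb : depthOf R T hR hT u = R.common (attachOf R T hR hT u) u := by
    rw [depthOf, if_neg hu]
  rw [hb, ha]
  exact ⟨h.1, h.2.1, rfl, h.2.2.1, h.2.2.2.1, h.2.2.2.2⟩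

theorem attach_anc (u : V) : T.anc (attachOf R T hR hT u) u := by
  by_cases hu : ∀ v, T.anc u v
  · rw [(attach_root hR hT hu).1]; exact T.refl' u
  · exact (attach_spec hR hT hu).2.1

theorem attach_cases (u : V) :
    (depthOf R T hR hT u = 0 ∧ 1 ≤ R.depthAt u ∧ (∀ v, T.anc u v) ∧ attachOf R T hR hT u = u) ∨
    (attachOf R T hR hT u ≠ u ∧
      depthOf R T hR hT (attachOf R T hR hT u) < depthOf R T hR hT u ∧
      depthOf R T hR hT u ≤ R.depthAt (attachOf R T hR hT u) ∧
      depthOf R T hR hT u ≤ R.depthAt u) := by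
  by_cases hu : ∀ v, T.anc u v
  · exact Or.inl ⟨(attach_root hR hT hu).2, R.one_le_depthAt u, hu, (attach_root hR hT hu).1⟩
  · obtain ⟨h1, h2, h3, h4, h5, h6⟩ := attach_spec hR hT hu
    have h7 := R.common_le (attachOf R T hR hT u) u
    refine Or.inr ⟨h1, ?_, by omega, by omega⟩
    by_contra hc
    push Not at hc
    set a := attachOf R T hR hT u with ha
    have hau : ¬ ∀ v, T.anc a v := by
      intro hau
      rw [(attach_root hR hT hau).2] at hc
      omega
    obtain ⟨g1, g2, g3, g4, g5, g6⟩ := attach_spec hR hT hau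
    set w := attachOf R T hR hT a
    -- the node at the attachment depth of `u` is already above `w`
    have k1 : R.anc (R.atDepth u (depthOf R T hR hT u)) a :=
      (R.le_common_iff h4 (by omega)).1 (by rw [h3])
    have k2 := R.atDepth_of_anc h4 (by omega) k1
    have k3 : R.anc (R.atDepth a (depthOf R T hR hT u)) w :=
      (R.le_common_iff h4 (by omega)).1 (by omega)
    rw [k2] at k3
    have k4 := (R.le_common_iff (w := w) h4 (by omega)).2 k3
    have k5 : w ≠ u := by
      intro hwu
      rw [hwu] at g2
      exact h1 (T.antisymm' _ _ h2 g2)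
    have k6 := h5 w k5 (T.trans' _ _ _ g2 h2)
    exact g1 (h6 w g2 (by omega))

/-- The owner is the least `T`-ancestor of `u` below the depth-`i` node of `u`. -/
theorem own_attach (u : V) {i : ℕ} (h1 : 1 ≤ i) (hi : i ≤ R.depthAt u) :
    R.anc (R.atDepth u i) (own (attachOf R T hR hT) (depthOf R T hR hT) u i) ∧
      ∀ w, T.anc w u → R.anc (R.atDepth u i) w →
        T.anc (own (attachOf R T hR hT) (depthOf R T hR hT) u i) w := by
  induction hn : T.depthAt u using Nat.strong_induction_on generalizing u with
  | _ n ih =>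
    by_cases hβ : depthOf R T hR hT u < i
    · rw [own_of_lt hβ]
      refine ⟨R.atDepth_anc u i, fun w hw hx => ?_⟩
      by_cases hwu : w = u
      · rw [hwu]; exact T.refl' u
      · exfalso
        have hu : ¬ ∀ v, T.anc u v := fun hu => hwu (T.antisymm' _ _ hw (hu w))
        have := (attach_spec hR hT hu).2.2.2.2.1 w hwu hw
        have := (R.le_common_iff (w := w) h1 hi).2 hx
        omega
    · have hβ' : i ≤ depthOf R T hR hT u := by omega
      have hu : ¬ ∀ v, T.anc u v := fun hu => by
        rw [(attach_root hR hT hu).2] at hβ'; omega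
      obtain ⟨g1, g2, g3, g4, g5, g6⟩ := attach_spec hR hT hu
      rw [own_of_le (attach_anc hR hT) hβ']
      have hx : R.anc (R.atDepth u i) (attachOf R T hR hT u) :=
        (R.le_common_iff h1 hi).1 (by omega)
      have hx' := R.atDepth_of_anc h1 hi hx
      have := R.common_le (attachOf R T hR hT u) u
      obtain ⟨k1, k2⟩ := ih _ (by rw [← hn]; exact T.depthAt_lt g2 g1) (attachOf R T hR hT u)
        (by omega) rfl
      rw [hx'] at k1 k2
      refine ⟨k1, fun w hw hxw => ?_⟩
      rcases T.chain' _ _ _ hw g2 with h' | h'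
      · exact k2 w h' hxw
      · exact T.trans' _ _ _ (own_anc (attach_anc hR hT) _ _) h'

theorem own_attach_eq_iff (hs : R.IsSensible T) {u v : V} {i : ℕ} (h1 : 1 ≤ i)
    (hu : i ≤ R.depthAt u) (hv : i ≤ R.depthAt v) :
    own (attachOf R T hR hT) (depthOf R T hR hT) u i =
      own (attachOf R T hR hT) (depthOf R T hR hT) v i ↔ R.atDepth u i = R.atDepth v i := by
  obtain ⟨u1, u2⟩ := own_attach hR hT u h1 hu
  obtain ⟨v1, v2⟩ := own_attach hR hT v h1 hv
  constructor
  · intro h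
    rw [← h] at v1
    exact (R.atDepth_of_anc h1 hu u1).symm.trans (R.atDepth_of_anc h1 hv v1)
  · intro h
    rw [isSensible_iff hT] at hs
    have key : ∀ u v, R.atDepth u i = R.atDepth v i → i ≤ R.depthAt u → i ≤ R.depthAt v →
        T.anc (own (attachOf R T hR hT) (depthOf R T hR hT) u i)
          (own (attachOf R T hR hT) (depthOf R T hR hT) v i) := by
      intro u v h hu hv
      obtain ⟨u1, u2⟩ := own_attach hR hT u h1 hu
      obtain ⟨v1, v2⟩ := own_attach hR hT v h1 hv
      obtain ⟨u', hu1, hu2, hu3⟩ := hs _ u (R.atDepth_anc u i)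
      obtain ⟨v', hv1, hv2, hv3⟩ := hs _ v (R.atDepth_anc v i)
      rw [← h] at v1 v2 hv2 hv3
      have e1 := u2 u' hu1 hu3
      have e2 := v2 v' hv1 hv3
      set x := own (attachOf R T hR hT) (depthOf R T hR hT) u i
      set y := own (attachOf R T hR hT) (depthOf R T hR hT) v i
      rcases T.chain' _ _ _ (T.trans' _ _ _ e1 hu2) (T.trans' _ _ _ e2 hv2) with h' | h'
      · exact h'
      · exact u2 y (T.trans' _ _ _ h' (own_anc (attach_anc hR hT) _ _)) v1
    exact T.antisymm' _ _ (key u v h hu hv) (key v u h.symm hv hu)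

theorem atDepth_self (F : RootedForest V) (u : V) : F.atDepth u (F.depthAt u) = u :=
  F.atDepth_eq (F.refl' u)

theorem isScheme_of_sensible {G : SimpleGraph V} {d : ℕ} (hs : R.IsSensible T)
    (hRG : ∀ u v, G.Adj u v → R.Related u v) (hd : R.depth ≤ d) :
    IsScheme T G d (attachOf R T hR hT) (depthOf R T hR hT) R.depthAt where
  anc := attach_anc hR hT
  cases := attach_cases hR hT
  le u := (Finset.le_sup (f := R.depthAt) (Finset.mem_univ u)).trans hd
  adj u w hwu hadj := by
    have hm : 1 ≤ min (R.depthAt w) (R.depthAt u) :=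
      le_min (R.one_le_depthAt w) (R.one_le_depthAt u)
    rw [own_attach_eq_iff hR hT hs hm (min_le_left _ _) (min_le_right _ _)]
    rcases hRG w u hadj with h | h
    · rw [min_eq_left (R.depthAt_mono h), atDepth_self, R.atDepth_eq h]
    · rw [min_eq_right (R.depthAt_mono h), atDepth_self, R.atDepth_eq h]

theorem isFilled_of_sensible (hs : R.IsSensible T) :
    IsFilled (attachOf R T hR hT) (depthOf R T hR hT) R.depthAt := by
  set a := attachOf R T hR hT with ha
  set β := depthOf R T hR hT with hβ
  have root : ∀ u, β u = R.depthAt u → ¬ ∀ v, T.anc u v := by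
    intro u h hu
    have := R.one_le_depthAt u
    rw [hβ, (attach_root hR hT hu).2] at h
    omega
  have owna : ∀ u, (¬ ∀ v, T.anc u v) → own a β u (β u) = a u := by
    intro u hu
    rw [own_of_le (attach_anc hR hT) le_rfl]
    refine own_of_lt ?_
    rcases attach_cases hR hT u with h | h
    · exact absurd h.2.2.1 hu
    · exact h.2.1
  refine ⟨fun u hu => ?_, fun u v hu hv hauv hβuv => ?_, fun x i h1 h2 => ?_⟩
  · obtain ⟨g1, g2, g3, g4, g5, g6⟩ := attach_spec hR hT (root u hu)
    have hle := (R.common_le (a u) u).1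
    rw [← hβ, ← ha] at g3
    rcases Nat.lt_or_ge (β u) (R.depthAt (a u)) with h | h
    · exact h
    · exfalso
      have h3 : R.anc (R.atDepth u (β u)) (a u) :=
        (R.le_common_iff g4 hu.le).1 (by rw [← hβ, g3])
      rw [hu, atDepth_self] at h3
      exact g1 (R.eq_of_depthAt_le h3 (by omega)).symm
  · have h1 := R.one_le_depthAt u
    have h3 : own a β u (β u) = own a β v (β u) := by
      rw [owna u (root u hu), hβuv, owna v (root v hv), hauv]
    rw [own_attach_eq_iff hR hT hs (by omega) (by omega) (by omega)] at h3
    rw [hu, atDepth_self, ← hu, hβuv, hv, atDepth_self] at h3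
    exact h3
  · have h0 : 1 ≤ i := by omega
    set y := R.atDepth x i with hy
    have hyd : R.depthAt y = i := R.depthAt_atDepth h0 h2.le
    have hown : own a β y i = x := by
      have : own a β y i = own a β x i := by
        rw [own_attach_eq_iff hR hT hs h0 (by omega) (by omega), ← hyd, atDepth_self, hyd]
      rw [this, own_of_lt h1]
    have hyx : y ≠ x := by
      intro h
      rw [h] at hyd; omega
    have hβy : i ≤ β y := by
      by_contra hc
      rw [own_of_lt (by omega)] at hown
      exact hyx hown
    have hny : ¬ ∀ v, T.anc y v := by
      intro hu
      rw [hβ, (attach_root hR hT hu).2] at hβy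
      omega
    obtain ⟨g1, g2, g3, g4, g5, g6⟩ := attach_spec hR hT hny
    have hle := (R.common_le (a y) y).2
    have hβi : β y = i := by rw [← hβ, ← ha] at g3; omega
    refine ⟨y, by omega, ?_, hβi⟩
    rw [← owna y hny, hβi, hown]

theorem toForest_of_sensible {G : SimpleGraph V} {d : ℕ} (hs : R.IsSensible T)
    (hRG : ∀ u v, G.Adj u v → R.Related u v) (hd : R.depth ≤ d) :
    (isScheme_of_sensible hR hT hs hRG hd).toForest (isFilled_of_sensible hR hT hs) = R := by
  ext u v
  show R.depthAt u ≤ R.depthAt v ∧ _ = _ ↔ _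
  constructor
  · rintro ⟨h1, h2⟩
    rw [own_attach_eq_iff hR hT hs (R.one_le_depthAt u) h1 le_rfl, atDepth_self] at h2
    rw [← h2]
    exact R.atDepth_anc _ _
  · intro h
    have h1 := R.depthAt_mono h
    refine ⟨h1, ?_⟩
    rw [own_attach_eq_iff hR hT hs (R.one_le_depthAt u) h1 le_rfl, atDepth_self, R.atDepth_eq h]

end Converse

end RootedForest

/-! ## Mixed radix digits -/

/-- The `j`-th digit of `m` in the mixed radix `r`. -/
def digit (r : ℕ → ℕ) (m j : ℕ) : ℕ := m / (∏ i ∈ Finset.range j, r i) % r j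

theorem digit_lt {r : ℕ → ℕ} (hr : ∀ j, 0 < r j) (m j : ℕ) : digit r m j < r j :=
  Nat.mod_lt _ (hr j)

theorem digit_eq_zero {r : ℕ → ℕ} {m J j : ℕ} (hr : ∀ j, 0 < r j)
    (hm : m < ∏ i ∈ Finset.range J, r i) (hj : J ≤ j) : digit r m j = 0 := by
  have : m < ∏ i ∈ Finset.range j, r i := by
    refine hm.trans_le (Finset.prod_le_prod_of_subset_of_one_le' (Finset.range_mono hj) ?_)
    intro i _ _
    exact hr i
  rw [digit, Nat.div_eq_of_lt this, Nat.zero_mod]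

theorem mod_eq_of_digit_eq {r : ℕ → ℕ} {m m' : ℕ} (J : ℕ)
    (h : ∀ j < J, digit r m j = digit r m' j) :
    m % (∏ i ∈ Finset.range J, r i) = m' % (∏ i ∈ Finset.range J, r i) := by
  induction J with
  | zero => simp [Nat.mod_one]
  | succ J ih =>
    have h1 := ih fun j hj => h j (by omega)
    have h2 := h J (by omega)
    unfold digit at h2
    rw [Finset.prod_range_succ, Nat.mod_mul, Nat.mod_mul, h1, h2]

theorem eq_of_digit_eq {r : ℕ → ℕ} {m m' J : ℕ} (hm : m < ∏ i ∈ Finset.range J, r i)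
    (hm' : m' < ∏ i ∈ Finset.range J, r i) (h : ∀ j < J, digit r m j = digit r m' j) : m = m' := by
  have := mod_eq_of_digit_eq J h
  rwa [Nat.mod_eq_of_lt hm, Nat.mod_eq_of_lt hm'] at this

/-! ## The weighted sum over choices -/

theorem sum_interval_neg_one_pow {α R : Type*} [DecidableEq α] [CommRing R] (A B U : Finset α)
    (hBU : B ⊆ U) :
    (∑ M ∈ U.powerset, if A ⊆ M ∧ M ⊆ B then (-1 : R) ^ (B \ M).card else 0) =
      if A = B then 1 else 0 := by
  by_cases hAB : A ⊆ B
  · have h1 : (∑ M ∈ U.powerset, if A ⊆ M ∧ M ⊆ B then (-1 : R) ^ (B \ M).card else 0) =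
        ∑ K ∈ (B \ A).powerset, (-1 : R) ^ K.card := by
      rw [← Finset.sum_filter]
      refine Finset.sum_nbij' (fun M => B \ M) (fun K => B \ K) ?_ ?_ ?_ ?_ ?_
      · intro M hM
        simp only [Finset.mem_filter, Finset.mem_powerset] at hM ⊢
        exact Finset.sdiff_subset_sdiff subset_rfl hM.2.1
      · intro K hK
        simp only [Finset.mem_filter, Finset.mem_powerset] at hK ⊢
        refine ⟨Finset.sdiff_subset.trans hBU, fun x hx => ?_, Finset.sdiff_subset⟩
        exact Finset.mem_sdiff.2 ⟨hAB hx, fun hxK => (Finset.mem_sdiff.1 (hK hxK)).2 hx⟩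
      · intro M hM
        simp only [Finset.mem_filter, Finset.mem_powerset] at hM
        exact Finset.sdiff_sdiff_eq_self hM.2.2
      · intro K hK
        simp only [Finset.mem_powerset] at hK
        exact Finset.sdiff_sdiff_eq_self (hK.trans Finset.sdiff_subset)
      · intro M hM; rfl
    have h2 := congrArg (Int.cast : ℤ → R) (Finset.sum_powerset_neg_one_pow_card (x := B \ A))
    push_cast at h2
    rw [h1, h2]
    by_cases hE : A = B
    · simp [hE]
    · rw [if_neg hE, if_neg]
      intro h
      exact hE (Finset.Subset.antisymm hAB (Finset.sdiff_eq_empty_iff_subset.1 h))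
  · rw [if_neg (by rintro rfl; exact hAB subset_rfl)]
    refine Finset.sum_eq_zero fun M _ => if_neg fun h => hAB (h.1.trans h.2)

namespace RootedForest

variable {V : Type*} [Fintype V] (T : RootedForest V) (G : SimpleGraph V) (d : ℕ)

/-- The radices of the choice at `u`. The digits are the depth of the vertex to attach to, the
depth to attach at, the depth of `u`, and one bit for every depth. -/
noncomputable def radix (u : V) (j : ℕ) : ℕ :=
  if j = 0 then T.depthAt u else if j ≤ 2 then d + 1 else 2

theorem radix_pos (u : V) (j : ℕ) : 0 < T.radix d u j := by
  unfold radix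
  split_ifs
  · exact T.one_le_depthAt u
  · omega
  · omega

/-- The number of choices at `u`. -/
noncomputable def numChoices (u : V) : ℕ := ∏ j ∈ Finset.range (d + 3), T.radix d u j

theorem numChoices_eq (u : V) :
    T.numChoices d u = T.depthAt u * ((d + 1) * (d + 1)) * 2 ^ d := by
  simp only [numChoices, Finset.prod_range_succ', radix]
  simp
  ring

/-- The vertex that `u` attaches to, for the table `D` of digits. -/
noncomputable def att (D : V → ℕ → ℕ) (u : V) : V := T.atDepth u (D u 0)

/-- The choice of `u` fits to the choices of its ancestors. -/
def ValidAt (D : V → ℕ → ℕ) (u : V) : Prop :=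
  (∀ i < d, D u (i + 3) = 1 → D u 1 < i ∧ i < D u 2) ∧
  (if D u 0 = 0 then T.depthAt u = 1 ∧ D u 1 = 0 ∧ 1 ≤ D u 2
    else D (T.att D u) 1 < D u 1 ∧ D u 1 ≤ D (T.att D u) 2 ∧ D u 1 ≤ D u 2 ∧
      (D u 1 = D u 2 → D (T.att D u) (D u 1 + 3) = 1)) ∧
  ∀ w, T.anc w u → G.Adj w u →
    own (T.att D) (fun x => D x 1) w (min (D w 2) (D u 2)) =
      own (T.att D) (fun x => D x 1) u (min (D w 2) (D u 2))

open Classical in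
/-- The weight of the choice of `u`. -/
noncomputable def weight {R : Type*} [CommRing R] (z : R) (D : V → ℕ → ℕ) (u : V) : R :=
  if T.ValidAt G d D u then
    (-1) ^ (Finset.card {i ∈ Finset.range d | (D u 1 < i ∧ i < D u 2) ∧ D u (i + 3) ≠ 1}) *
      z ^ (D u 2 - D u 1)
  else 0

/-- The table of digits of the choices `c`. -/
noncomputable def digits (c : V → ℕ) (u : V) (j : ℕ) : ℕ := digit (T.radix d u) (c u) j

open Classical in
/-- The table of digits for given depths and bits. -/
noncomputable def table (p : V → ℕ × ℕ × ℕ) (M : Finset (V × ℕ)) (u : V) : ℕ → ℕ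
  | 0 => (p u).1
  | 1 => (p u).2.1
  | 2 => (p u).2.2
  | i + 3 => if (u, i) ∈ M then 1 else 0

open Classical in
/-- All choices of depths. -/
noncomputable def depthChoices : Finset (V → ℕ × ℕ × ℕ) :=
  Fintype.piFinset fun u =>
    Finset.range (T.depthAt u) ×ˢ Finset.range (d + 1) ×ˢ Finset.range (d + 1)

open Classical in
theorem sum_choices {R : Type*} [CommRing R] (f : (V → ℕ → ℕ) → R) :
    (∑ c ∈ Fintype.piFinset fun u => Finset.range (T.numChoices d u), f (T.digits d c)) =
      ∑ p ∈ T.depthChoices d, ∑ M ∈ ((Finset.univ : Finset V) ×ˢ Finset.range d).powerset,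
        f (table p M) := by
  rw [← Finset.sum_product']
  set φ : (V → ℕ) → (V → ℕ × ℕ × ℕ) × Finset (V × ℕ) := fun c =>
    (fun u => (T.digits d c u 0, T.digits d c u 1, T.digits d c u 2),
      {x ∈ (Finset.univ : Finset V) ×ˢ Finset.range d | T.digits d c x.1 (x.2 + 3) = 1}) with hφ
  have htab : ∀ c ∈ Fintype.piFinset fun u => Finset.range (T.numChoices d u),
      table (φ c).1 (φ c).2 = T.digits d c := by
    intro c hc
    simp only [Fintype.mem_piFinset, Finset.mem_range] at hc
    funext u j
    match j with
    | 0 => rfl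
    | 1 => rfl
    | 2 => rfl
    | i + 3 =>
      simp only [table, hφ, Finset.mem_filter, Finset.mem_product, Finset.mem_univ, true_and,
        Finset.mem_range]
      by_cases hi : i < d
      · have : T.digits d c u (i + 3) < 2 := by
          have := digit_lt (T.radix_pos d u) (c u) (i + 3)
          simpa [radix, digits] using this
        simp only [hi, true_and]
        split_ifs <;> omega
      · have : T.digits d c u (i + 3) = 0 :=
          digit_eq_zero (T.radix_pos d u) (hc u) (by omega)
        simp [hi, this]
  have hmaps : Set.MapsTo φ (Fintype.piFinset fun u => Finset.range (T.numChoices d u))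
      (T.depthChoices d ×ˢ ((Finset.univ : Finset V) ×ˢ Finset.range d).powerset : Finset _) := by
    intro c hc
    simp only [Finset.coe_product, Set.mem_prod, Finset.mem_coe, depthChoices,
      Fintype.mem_piFinset, Finset.mem_product, Finset.mem_range, Finset.mem_powerset]
    refine ⟨fun u => ⟨?_, ?_, ?_⟩, Finset.filter_subset _ _⟩
    · exact (digit_lt (T.radix_pos d u) (c u) 0).trans_eq (by simp [radix])
    · exact (digit_lt (T.radix_pos d u) (c u) 1).trans_eq (by simp [radix])
    · exact (digit_lt (T.radix_pos d u) (c u) 2).trans_eq (by simp [radix])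
  have hinj : Set.InjOn φ (Fintype.piFinset fun u => Finset.range (T.numChoices d u)) := by
    intro c hc c' hc' h
    have h1 := htab c hc
    have h2 := htab c' hc'
    rw [h, h2] at h1
    simp only [Finset.mem_coe, Fintype.mem_piFinset, Finset.mem_range] at hc hc'
    funext u
    refine eq_of_digit_eq (hc u) (hc' u) fun j _ => ?_
    exact congrFun (congrFun h1.symm u) j
  have hcard : (T.depthChoices d ×ˢ
      ((Finset.univ : Finset V) ×ˢ Finset.range d).powerset : Finset _).card ≤
      (Fintype.piFinset fun u => Finset.range (T.numChoices d u)).card := by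
    simp only [depthChoices, Finset.card_product, Fintype.card_piFinset, Finset.card_range,
      Finset.card_powerset, T.numChoices_eq, Finset.prod_mul_distrib, Finset.prod_const,
      Finset.card_univ]
    rw [mul_comm (Fintype.card V) d, pow_mul]
  have hsurj := Finset.surjOn_of_injOn_of_card_le φ hmaps hinj hcard
  exact Finset.sum_nbij φ hmaps hinj hsurj fun c hc => by rw [htab c hc]

/-- The part of validity that does not involve the bits. -/
def DepthsValid (p : V → ℕ × ℕ × ℕ) : Prop :=
  ∀ u, (if (p u).1 = 0 then T.depthAt u = 1 ∧ (p u).2.1 = 0 ∧ 1 ≤ (p u).2.2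
    else (p (T.atDepth u (p u).1)).2.1 < (p u).2.1 ∧ (p u).2.1 ≤ (p (T.atDepth u (p u).1)).2.2 ∧
      (p u).2.1 ≤ (p u).2.2) ∧
  ∀ w, T.anc w u → G.Adj w u →
    own (fun x => T.atDepth x (p x).1) (fun x => (p x).2.1) w (min (p w).2.2 (p u).2.2) =
      own (fun x => T.atDepth x (p x).1) (fun x => (p x).2.1) u (min (p w).2.2 (p u).2.2)

open Classical in
/-- The unlabelled nodes. -/
noncomputable def slots (p : V → ℕ × ℕ × ℕ) : Finset (V × ℕ) :=
  {x ∈ (Finset.univ : Finset V) ×ˢ Finset.range d | (p x.1).2.1 < x.2 ∧ x.2 < (p x.1).2.2}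

open Classical in
/-- The vertices that do not create nodes. -/
noncomputable def fillers (p : V → ℕ × ℕ × ℕ) : Finset V := {u | (p u).2.1 = (p u).2.2}

open Classical in
/-- The old nodes at which vertices are placed. -/
noncomputable def filled (p : V → ℕ × ℕ × ℕ) : Finset (V × ℕ) :=
  (fillers p).image fun u => (T.atDepth u (p u).1, (p u).2.1)

/-- The number of nodes. -/
def nodes (p : V → ℕ × ℕ × ℕ) : ℕ := ∑ u, ((p u).2.2 - (p u).2.1)

open Classical in
theorem forall_validAt_iff (p : V → ℕ × ℕ × ℕ) {M : Finset (V × ℕ)}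
    (hM : M ⊆ Finset.univ ×ˢ Finset.range d) :
    (∀ u, T.ValidAt G d (table p M) u) ↔
      T.DepthsValid G p ∧ T.filled p ⊆ M ∧ M ⊆ slots d p := by
  have hatt : T.att (table p M) = fun x => T.atDepth x (p x).1 := rfl
  have e1 : ∀ u, table p M u 0 = (p u).1 := fun _ => rfl
  have e2 : ∀ u, table p M u 1 = (p u).2.1 := fun _ => rfl
  have e3 : ∀ u, table p M u 2 = (p u).2.2 := fun _ => rfl
  have e4 : ∀ u i, table p M u (i + 3) = 1 ↔ (u, i) ∈ M := fun u i => by simp [table]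
  simp only [ValidAt, hatt, e1, e2, e3, e4]
  constructor
  · intro h
    refine ⟨fun u => ⟨?_, (h u).2.2⟩, ?_, ?_⟩
    · have := (h u).2.1
      split_ifs at this ⊢ with h0
      · exact this
      · exact ⟨this.1, this.2.1, this.2.2.1⟩
    · intro x hx
      simp only [filled, fillers, Finset.mem_image, Finset.mem_filter, Finset.mem_univ,
        true_and] at hx
      obtain ⟨u, hu, rfl⟩ := hx
      have := (h u).2.1
      split_ifs at this with h0
      · omega
      · exact this.2.2.2 hu
    · rintro ⟨u, i⟩ hx
      have h1 := hM hx
      simp only [Finset.mem_product, Finset.mem_univ, Finset.mem_range, true_and] at h1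
      simp only [slots, Finset.mem_filter, Finset.mem_product, Finset.mem_univ, Finset.mem_range,
        true_and]
      exact ⟨h1, (h u).1 i h1 hx⟩
  · rintro ⟨h1, h2, h3⟩ u
    refine ⟨fun i hi hM => ?_, ?_, (h1 u).2⟩
    · have := h3 hM
      simp only [slots, Finset.mem_filter] at this
      exact this.2
    · have := (h1 u).1
      split_ifs at this ⊢ with h0
      · exact this
      · refine ⟨this.1, this.2.1, this.2.2, fun heq => h2 ?_⟩
        simp only [filled, fillers, Finset.mem_image, Finset.mem_filter, Finset.mem_univ, true_and]
        exact ⟨u, heq, rfl⟩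

open Classical in
theorem card_slots_sdiff (p : V → ℕ × ℕ × ℕ) (M : Finset (V × ℕ)) :
    (slots d p \ M).card = ∑ u, Finset.card {i ∈ Finset.range d |
      (table p M u 1 < i ∧ i < table p M u 2) ∧ table p M u (i + 3) ≠ 1} := by
  rw [Finset.card_eq_sum_card_fiberwise (f := Prod.fst) (t := Finset.univ)
    (fun _ _ => Finset.mem_coe.2 (Finset.mem_univ _))]
  refine Finset.sum_congr rfl fun u _ => ?_
  refine Finset.card_nbij' Prod.snd (fun i => (u, i)) ?_ ?_ ?_ ?_
  · rintro ⟨v, i⟩ h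
    simp only [Finset.coe_filter, Finset.mem_sdiff, Set.mem_ofPred_eq, slots, Finset.mem_filter,
      Finset.mem_product, Finset.mem_univ, true_and, Finset.mem_range] at h ⊢
    obtain ⟨⟨⟨h1, h2⟩, h3⟩, rfl⟩ := h
    exact ⟨h1, h2, by simpa [table] using h3⟩
  · intro i h
    simp only [Finset.coe_filter, Finset.mem_sdiff, Set.mem_ofPred_eq, slots, Finset.mem_filter,
      Finset.mem_product, Finset.mem_univ, true_and, Finset.mem_range] at h ⊢
    exact ⟨⟨⟨h.1, h.2.1⟩, by simpa [table] using h.2.2⟩, trivial⟩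
  · rintro ⟨v, i⟩ h
    simp only [Finset.coe_filter, Set.mem_ofPred_eq] at h
    rw [← h.2]
  · intro i _; rfl

open Classical in
theorem sum_bits {R : Type*} [CommRing R] (z : R) (p : V → ℕ × ℕ × ℕ) :
    (∑ M ∈ ((Finset.univ : Finset V) ×ˢ Finset.range d).powerset,
      ∏ u, T.weight G d z (table p M) u) =
      if T.DepthsValid G p ∧ T.filled p = slots d p then z ^ nodes p else 0 := by
  have h1 : ∀ M ∈ ((Finset.univ : Finset V) ×ˢ Finset.range d).powerset,
      (∏ u, T.weight G d z (table p M) u) =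
        (if T.filled p ⊆ M ∧ M ⊆ slots d p then (-1 : R) ^ (slots d p \ M).card else 0) *
          (if T.DepthsValid G p then z ^ nodes p else 0) := by
    intro M hM
    rw [Finset.mem_powerset] at hM
    by_cases hv : ∀ u, T.ValidAt G d (table p M) u
    · have hv' := (T.forall_validAt_iff G d p hM).1 hv
      simp only [weight, hv, if_true, hv'.1, hv'.2, and_self]
      rw [Finset.prod_mul_distrib, Finset.prod_pow_eq_pow_sum, Finset.prod_pow_eq_pow_sum,
        card_slots_sdiff]
      rfl
    · have hv' := mt (T.forall_validAt_iff G d p hM).2 hv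
      push Not at hv
      obtain ⟨u, hu⟩ := hv
      rw [Finset.prod_eq_zero (Finset.mem_univ u) (by rw [weight, if_neg hu])]
      by_cases h2 : T.DepthsValid G p
      · rw [if_neg fun h3 => hv' ⟨h2, h3⟩, zero_mul]
      · rw [if_neg h2, mul_zero]
  rw [Finset.sum_congr rfl h1, ← Finset.sum_mul, sum_interval_neg_one_pow]
  · by_cases h2 : T.DepthsValid G p <;> by_cases h3 : T.filled p = slots d p <;> simp [h2, h3]
  · exact Finset.filter_subset _ _

open Classical in
theorem card_slots {p : V → ℕ × ℕ × ℕ} (hp : p ∈ T.depthChoices d) :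
    (slots d p).card = ∑ u, ((p u).2.2 - (p u).2.1 - 1) := by
  have := card_slots_sdiff d p ∅
  rw [Finset.sdiff_empty] at this
  rw [this]
  refine Finset.sum_congr rfl fun u _ => ?_
  have hp' := (Fintype.mem_piFinset.1 hp) u
  simp only [Finset.mem_product, Finset.mem_range] at hp'
  have : {i ∈ Finset.range d | (table p ∅ u 1 < i ∧ i < table p ∅ u 2) ∧ table p ∅ u (i + 3) ≠ 1} =
      Finset.Ioo (p u).2.1 (p u).2.2 := by
    ext i
    simp only [table, Finset.mem_filter, Finset.mem_range, Finset.notMem_empty, if_false,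
      Finset.mem_Ioo]
    constructor
    · intro h; exact h.2.1
    · intro h; exact ⟨by omega, h, by omega⟩
  rw [this, Nat.card_Ioo]

theorem isScheme_iff (hT : T.IsTree) {p : V → ℕ × ℕ × ℕ} (hp : p ∈ T.depthChoices d) :
    T.DepthsValid G p ↔ IsScheme T G d (fun x => T.atDepth x (p x).1) (fun x => (p x).2.1)
      (fun x => (p x).2.2) := by
  classical
  have hp' := Fintype.mem_piFinset.1 hp
  simp only [Finset.mem_product, Finset.mem_range] at hp'
  have hne : ∀ u, (p u).1 ≠ 0 → T.atDepth u (p u).1 ≠ u := by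
    intro u h0 hu
    have := T.depthAt_atDepth (u := u) (i := (p u).1) (by omega) (hp' u).1.le
    rw [hu] at this
    have := (hp' u).1
    omega
  constructor
  · intro h
    refine ⟨fun u => T.atDepth_anc _ _, fun u => ?_, fun u => ?_, fun u w => (h u).2 w⟩
    · have := (h u).1
      split_ifs at this with h0
      · refine Or.inl ⟨this.2.1, this.2.2, (T.depthAt_eq_one_iff hT).1 this.1, ?_⟩
        rw [h0, atDepth_zero]
      · exact Or.inr ⟨hne u h0, this⟩
    · have := (hp' u).2.2
      omega
  · intro h u
    refine ⟨?_, fun w hw ha => h.adj u w hw ha⟩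
    split_ifs with h0
    · rcases h.cases u with h1 | h1
      · exact ⟨(T.depthAt_eq_one_iff hT).2 h1.2.2.1, h1.1, h1.2.1⟩
      · refine absurd ?_ h1.1
        rw [h0, atDepth_zero]
    · rcases h.cases u with h1 | h1
      · exact absurd h1.2.2.2 (hne u h0)
      · exact h1.2

theorem isFilled_iff {p : V → ℕ × ℕ × ℕ} (hp : p ∈ T.depthChoices d)
    (hs : IsScheme T G d (fun x => T.atDepth x (p x).1) (fun x => (p x).2.1)
      (fun x => (p x).2.2)) (hf : T.filled p = slots d p) :
    nodes p ≤ Fintype.card V ∧ (nodes p = Fintype.card V ↔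
      IsFilled (fun x => T.atDepth x (p x).1) (fun x => (p x).2.1) (fun x => (p x).2.2)) := by
  classical
  have hp' := Fintype.mem_piFinset.1 hp
  simp only [Finset.mem_product, Finset.mem_range] at hp'
  have hsum : nodes p + (fillers p).card = (slots d p).card + Fintype.card V := by
    rw [T.card_slots d hp, nodes, fillers, Finset.card_filter, ← Finset.card_univ,
      Finset.card_eq_sum_ones, ← Finset.sum_add_distrib, ← Finset.sum_add_distrib]
    refine Finset.sum_congr rfl fun u _ => ?_
    have := hs.le_e u
    split_ifs <;> omega
  have hcard : (T.filled p).card ≤ (fillers p).card := Finset.card_image_le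
  rw [hf] at hcard
  refine ⟨by omega, ?_⟩
  have h1 : nodes p = Fintype.card V ↔ (T.filled p).card = (fillers p).card := by
    rw [hf]; omega
  rw [h1, filled, Finset.card_image_iff]
  constructor
  · intro hinj
    refine ⟨fun u hu => ?_, fun u v hu hv ha hb => ?_, fun x i h1 h2 => ?_⟩
    · have hmem : (T.atDepth u (p u).1, (p u).2.1) ∈ T.filled p :=
        Finset.mem_image_of_mem _ (by simpa [fillers] using hu)
      rw [hf] at hmem
      simp only [slots, Finset.mem_filter] at hmem
      exact hmem.2.2
    · exact hinj (by simpa [fillers] using hu) (by simpa [fillers] using hv)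
        (Prod.ext ha hb)
    · have hmem : (x, i) ∈ slots d p := by
        simp only [slots, Finset.mem_filter, Finset.mem_product, Finset.mem_univ, true_and,
          Finset.mem_range]
        have := (hp' x).2.2
        exact ⟨by omega, h1, h2⟩
      rw [← hf] at hmem
      simp only [filled, fillers, Finset.mem_image, Finset.mem_filter, Finset.mem_univ, true_and,
        Prod.mk.injEq] at hmem
      exact hmem
  · intro h u hu v hv huv
    simp only [fillers, Finset.coe_filter, Finset.mem_univ, true_and, Set.mem_ofPred_eq] at hu hv
    simp only [Prod.mk.injEq] at huv
    exact h.uniq u v hu hv huv.1 huv.2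

theorem filled_eq_slots {p : V → ℕ × ℕ × ℕ} (hp : p ∈ T.depthChoices d)
    (hs : IsScheme T G d (fun x => T.atDepth x (p x).1) (fun x => (p x).2.1)
      (fun x => (p x).2.2))
    (hf : IsFilled (fun x => T.atDepth x (p x).1) (fun x => (p x).2.1) (fun x => (p x).2.2)) :
    T.filled p = slots d p := by
  classical
  have hp' := Fintype.mem_piFinset.1 hp
  simp only [Finset.mem_product, Finset.mem_range] at hp'
  ext ⟨x, i⟩
  simp only [filled, fillers, slots, Finset.mem_image, Finset.mem_filter, Finset.mem_univ,
    true_and, Prod.mk.injEq, Finset.mem_product, Finset.mem_range]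
  constructor
  · rintro ⟨u, hu, rfl, rfl⟩
    have h1 := hf.slot u hu
    have h2 := hs.one_le_e u
    have h3 := (hp' (T.atDepth u (p u).1)).2.2
    rcases hs.cases u with hc | hc
    · omega
    · exact ⟨by omega, hc.2.1, h1⟩
  · rintro ⟨hi, h1, h2⟩
    exact hf.surj x i h1 h2

open Classical in
/-- The number of sensible elimination trees is the number of filled schemes. -/
theorem countSensible_eq_card (hT : T.IsElimTree G) :
    countSensible G T d = Finset.card {p ∈ T.depthChoices d |
      (T.DepthsValid G p ∧ T.filled p = slots d p) ∧ nodes p = Fintype.card V} := by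
  have hmem : ∀ p ∈ T.depthChoices d,
      ((T.DepthsValid G p ∧ T.filled p = slots d p) ∧ nodes p = Fintype.card V) ↔
      IsScheme T G d (fun x => T.atDepth x (p x).1) (fun x => (p x).2.1) (fun x => (p x).2.2) ∧
      IsFilled (fun x => T.atDepth x (p x).1) (fun x => (p x).2.1) (fun x => (p x).2.2) := by
    intro p hp
    constructor
    · rintro ⟨⟨h1, h2⟩, h3⟩
      have h4 := (T.isScheme_iff G d hT.1 hp).1 h1
      exact ⟨h4, (T.isFilled_iff G d hp h4 h2).2.1 h3⟩
    · rintro ⟨h1, h2⟩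
      have h3 := T.filled_eq_slots G d hp h1 h2
      exact ⟨⟨(T.isScheme_iff G d hT.1 hp).2 h1, h3⟩, (T.isFilled_iff G d hp h1 h3).2.2 h2⟩
  rw [← Set.ncard_coe_finset, countSensible]
  symm
  refine Set.ncard_congr (fun p hp => ((hmem p (Finset.mem_filter.1 hp).1).1
    (Finset.mem_filter.1 hp).2).1.toForest ((hmem p (Finset.mem_filter.1 hp).1).1
    (Finset.mem_filter.1 hp).2).2) ?_ ?_ ?_
  · intro p hp
    have h := (hmem p (Finset.mem_filter.1 hp).1).1 (Finset.mem_filter.1 hp).2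
    refine ⟨h.1.toForest_isElimTree h.2 hT, ?_, h.1.toForest_isSensible h.2 hT.1⟩
    exact_mod_cast h.1.depth_toForest_le h.2
  · intro p q hp hq heq
    have h := (hmem p (Finset.mem_filter.1 hp).1).1 (Finset.mem_filter.1 hp).2
    have h' := (hmem q (Finset.mem_filter.1 hq).1).1 (Finset.mem_filter.1 hq).2
    obtain ⟨ha, hb, he⟩ := h.1.toForest_inj h.2 h'.1 h'.2 heq
    have hlevel : ∀ p ∈ T.depthChoices d, ∀ u, (p u).1 =
        if T.atDepth u (p u).1 = u then 0 else T.depthAt (T.atDepth u (p u).1) := by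
      intro p hp u
      have hp' := (Fintype.mem_piFinset.1 hp) u
      simp only [Finset.mem_product, Finset.mem_range] at hp'
      by_cases h0 : (p u).1 = 0
      · rw [h0, atDepth_zero, if_pos rfl]
      · have := T.depthAt_atDepth (u := u) (i := (p u).1) (by omega) hp'.1.le
        rw [if_neg, this]
        intro hu
        rw [hu] at this
        omega
    funext u
    refine Prod.ext ?_ (Prod.ext (congrFun hb u) (congrFun he u))
    have ha' : T.atDepth u (p u).1 = T.atDepth u (q u).1 := congrFun ha u
    rw [hlevel p (Finset.mem_filter.1 hp).1 u, hlevel q (Finset.mem_filter.1 hq).1 u, ha']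
  · rintro R ⟨⟨hR, hRG⟩, hd, hs⟩
    have hd' : R.depth ≤ d := by exact_mod_cast hd
    have h1 := isScheme_of_sensible hR hT.1 hs hRG hd'
    have h2 := isFilled_of_sensible hR hT.1 hs
    set p : V → ℕ × ℕ × ℕ := fun u =>
      (if attachOf R T hR hT.1 u = u then 0 else T.depthAt (attachOf R T hR hT.1 u),
        depthOf R T hR hT.1 u, R.depthAt u) with hpdef
    have ha : (fun x => T.atDepth x (p x).1) = attachOf R T hR hT.1 := by
      funext x
      simp only [hpdef]
      split_ifs with hx
      · rw [atDepth_zero, hx]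
      · exact T.atDepth_eq (attach_anc hR hT.1 x)
    have hp : p ∈ T.depthChoices d := by
      refine Fintype.mem_piFinset.2 fun u => ?_
      simp only [Finset.mem_product, Finset.mem_range, hpdef]
      have h3 := h1.le u
      have h4 := h1.le_e u
      refine ⟨?_, by omega, by omega⟩
      split_ifs with hu
      · exact T.one_le_depthAt u
      · exact T.depthAt_lt (attach_anc hR hT.1 u) hu
    have hb : (fun x => (p x).2.1) = depthOf R T hR hT.1 := rfl
    have he : (fun x => (p x).2.2) = R.depthAt := rfl
    have h1' : IsScheme T G d (fun x => T.atDepth x (p x).1) (fun x => (p x).2.1)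
      (fun x => (p x).2.2) := by rw [ha]; exact h1
    have h2' : IsFilled (fun x => T.atDepth x (p x).1) (fun x => (p x).2.1)
      (fun x => (p x).2.2) := by rw [ha]; exact h2
    refine ⟨p, Finset.mem_coe.2 (Finset.mem_filter.2 ⟨hp, (hmem p hp).2 ⟨h1', h2'⟩⟩), ?_⟩
    rw [← toForest_of_sensible hR hT.1 hs hRG hd']
    congr 1

open Classical in
/-- The weighted sum over all choices determines the number of sensible elimination trees. -/
theorem exists_sum_weights (hT : T.IsElimTree G) (b : ℕ) (hV : 0 < Fintype.card V)
    (hb : (T.depthChoices d).card < 2 ^ b) :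
    ∃ Z : ℕ, Z / 2 ^ (b * Fintype.card V) = countSensible G T d ∧
      Z < 2 ^ (b * (Fintype.card V + 1)) ∧
      ∀ (R : Type) [CommRing R],
        (∑ c ∈ Fintype.piFinset fun u => Finset.range (T.numChoices d u),
          ∏ u, T.weight G d ((2 : R) ^ b) (T.digits d c) u) = Z := by
  set n := Fintype.card V with hn
  set A := {p ∈ T.depthChoices d | T.DepthsValid G p ∧ T.filled p = slots d p} with hA
  have hle : ∀ p ∈ A, nodes p ≤ n := by
    intro p hp
    obtain ⟨h1, h2, h3⟩ := Finset.mem_filter.1 hp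
    exact (T.isFilled_iff G d h1 ((T.isScheme_iff G d hT.1 h1).1 h2) h3).1
  have hAc : A.card < 2 ^ b := (Finset.card_filter_le _ _).trans_lt hb
  have hcount : countSensible G T d = Finset.card {p ∈ A | nodes p = n} := by
    rw [T.countSensible_eq_card G d hT, hA, Finset.filter_filter]
  have hsplit : ∑ p ∈ A, (2 ^ b) ^ nodes p =
      countSensible G T d * 2 ^ (b * n) + ∑ p ∈ A with ¬ nodes p = n, (2 ^ b) ^ nodes p := by
    rw [← Finset.sum_filter_add_sum_filter_not A (fun p => nodes p = n), hcount,
      Finset.sum_congr rfl (g := fun _ => 2 ^ (b * n)), Finset.sum_const, smul_eq_mul]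
    intro p hp
    rw [(Finset.mem_filter.1 hp).2, ← pow_mul]
  have hrest : ∑ p ∈ A with ¬ nodes p = n, (2 ^ b) ^ nodes p < 2 ^ (b * n) := by
    calc ∑ p ∈ A with ¬ nodes p = n, (2 ^ b) ^ nodes p
        ≤ ∑ p ∈ A with ¬ nodes p = n, (2 ^ b) ^ (n - 1) := by
          refine Finset.sum_le_sum fun p hp => Nat.pow_le_pow_right (by positivity) ?_
          have h1 := hle p (Finset.mem_filter.1 hp).1
          have h2 := (Finset.mem_filter.1 hp).2
          omega
      _ ≤ A.card * (2 ^ b) ^ (n - 1) := by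
          rw [Finset.sum_const, smul_eq_mul]
          exact Nat.mul_le_mul_right _ (Finset.card_filter_le _ _)
      _ < 2 ^ b * (2 ^ b) ^ (n - 1) := Nat.mul_lt_mul_of_pos_right hAc (by positivity)
      _ = 2 ^ (b * n) := by
          rw [← pow_succ', pow_mul]
          congr 1
          omega
  refine ⟨∑ p ∈ A, (2 ^ b) ^ nodes p, ?_, ?_, fun R _ => ?_⟩
  · rw [hsplit, Nat.add_comm, Nat.add_mul_div_right _ _ (by positivity), Nat.div_eq_of_lt hrest,
      zero_add]
  · have h1 : countSensible G T d + 1 ≤ 2 ^ b := by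
      rw [hcount]
      exact (Finset.card_filter_le _ _).trans_lt hAc
    have h2 : 2 ^ (b * (n + 1)) = 2 ^ b * 2 ^ (b * n) := by
      rw [← pow_add]; congr 1; ring
    rw [hsplit, h2]
    have := Nat.mul_le_mul_right (2 ^ (b * n)) h1
    rw [add_mul, one_mul] at this
    omega
  · rw [T.sum_choices d (fun D => ∏ u, T.weight G d ((2 : R) ^ b) D u), hA, Finset.sum_filter]
    push_cast
    refine Finset.sum_congr rfl fun p _ => ?_
    rw [T.sum_bits G d]

end RootedForest

/-! ## Sums of products along a rooted forest -/

section PartialSum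

variable {V R : Type*} [Fintype V] [DecidableEq V] [CommRing R] (B : V → ℕ)

/-- The sum of `g` over all ways to change `c` on `A` to choices below `B`. -/
def partialSum (A : Finset V) (g : (V → ℕ) → R) (c : V → ℕ) : R :=
  ∑ f ∈ Fintype.piFinset fun v => if v ∈ A then Finset.range (B v) else {c v}, g f

variable {B}

theorem partialSum_empty (g : (V → ℕ) → R) (c : V → ℕ) : partialSum B ∅ g c = g c := by
  have : (Fintype.piFinset fun v => if v ∈ (∅ : Finset V) then Finset.range (B v) else {c v}) =
      {c} := by
    ext f
    simp [funext_iff]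
  rw [partialSum, this, Finset.sum_singleton]

theorem partialSum_insert {A : Finset V} {y : V} (hy : y ∉ A) (g : (V → ℕ) → R) (c : V → ℕ) :
    partialSum B (insert y A) g c =
      ∑ m ∈ Finset.range (B y), partialSum B A g (Function.update c y m) := by
  unfold partialSum
  rw [← Finset.sum_fiberwise_of_maps_to (g := fun f => f y) (t := Finset.range (B y))]
  · refine Finset.sum_congr rfl fun m hm => Finset.sum_congr ?_ fun _ _ => rfl
    ext f
    simp only [Finset.mem_filter, Fintype.mem_piFinset]
    constructor
    · rintro ⟨h, rfl⟩ v
      have := h v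
      by_cases hv : v = y
      · subst hv; simp [hy]
      · by_cases hvA : v ∈ A <;> simpa [hv, hvA] using this
    · intro h
      have hfy : f y = m := by simpa [hy] using h y
      refine ⟨fun v => ?_, hfy⟩
      have := h v
      by_cases hv : v = y
      · subst hv; rw [if_pos (Finset.mem_insert_self _ _), hfy]; exact hm
      · by_cases hvA : v ∈ A <;> simpa [hv, hvA] using this
  · intro f hf
    have := Fintype.mem_piFinset.1 hf y
    rwa [if_pos (Finset.mem_insert_self _ _)] at this

theorem partialSum_congr {A : Finset V} {g : (V → ℕ) → R} {c c' : V → ℕ} {D : Set V}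
    (hg : ∀ f f', (∀ v, v ∈ D → f v = f' v) → g f = g f')
    (hc : ∀ v, v ∈ D → v ∉ A → c v = c' v) : partialSum B A g c = partialSum B A g c' := by
  induction A using Finset.induction_on generalizing c c' with
  | empty =>
    rw [partialSum_empty, partialSum_empty]
    exact hg _ _ fun v hv => hc v hv (Finset.notMem_empty v)
  | insert y A hy ih =>
    rw [partialSum_insert hy, partialSum_insert hy]
    refine Finset.sum_congr rfl fun m _ => ih fun v hv hvA => ?_
    by_cases hvy : v = y
    · subst hvy; simp
    · simpa [hvy] using hc v hv (by simp [hvy, hvA])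

theorem partialSum_mul {A A' : Finset V} {g h : (V → ℕ) → R} {c : V → ℕ} {D D' : Set V}
    (hAA : Disjoint A A')
    (hg : ∀ f f', (∀ v, v ∈ D → f v = f' v) → g f = g f')
    (hh : ∀ f f', (∀ v, v ∈ D' → f v = f' v) → h f = h f')
    (hD : ∀ v ∈ A', v ∉ D) (hD' : ∀ v ∈ A, v ∉ D') :
    partialSum B (A ∪ A') (fun f => g f * h f) c = partialSum B A g c * partialSum B A' h c := by
  induction A using Finset.induction_on generalizing c with
  | empty =>
    rw [Finset.empty_union, partialSum_empty]
    unfold partialSum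
    rw [Finset.mul_sum]
    refine Finset.sum_congr rfl fun f hf => ?_
    show g f * h f = _
    rw [hg f c]
    intro v hv
    have := Fintype.mem_piFinset.1 hf v
    rw [if_neg fun hvA => hD v hvA hv] at this
    exact Finset.mem_singleton.1 this
  | insert y A hy ih =>
    have hyA' : y ∉ A' := Finset.disjoint_left.1 hAA (Finset.mem_insert_self _ _)
    rw [Finset.insert_union, partialSum_insert (by simp [hy, hyA']), partialSum_insert hy,
      Finset.sum_mul]
    refine Finset.sum_congr rfl fun m _ => ?_
    rw [ih (hAA.mono_left (Finset.subset_insert _ _)) fun v hv => hD' v (Finset.mem_insert_of_mem hv)]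
    congr 1
    refine partialSum_congr hh fun v hv _ => ?_
    have : v ≠ y := by
      rintro rfl
      exact hD' v (Finset.mem_insert_self _ _) hv
    simp [this]

theorem partialSum_mul_left {A : Finset V} {g h : (V → ℕ) → R} {c : V → ℕ} {D : Set V}
    (hg : ∀ f f', (∀ v, v ∈ D → f v = f' v) → g f = g f') (hD : ∀ v ∈ A, v ∉ D) :
    partialSum B A (fun f => g f * h f) c = g c * partialSum B A h c := by
  have := partialSum_mul (B := B) (A := ∅) (A' := A) (g := g) (h := h) (c := c) (D' := Set.univ)
    (Finset.disjoint_empty_left A) hg (fun f f' hf => by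
      rw [funext fun v => hf v (Set.mem_univ v)]) hD (fun v hv => absurd hv (Finset.notMem_empty v))
  rwa [Finset.empty_union, partialSum_empty] at this

theorem partialSum_prod {ι : Type*} [DecidableEq ι] (s : Finset ι) (A : ι → Finset V)
    (D : ι → Set V) (g : ι → (V → ℕ) → R) (c : V → ℕ)
    (hA : ∀ i ∈ s, ∀ j ∈ s, i ≠ j → Disjoint (A i) (A j))
    (hg : ∀ i ∈ s, ∀ f f', (∀ v, v ∈ D i → f v = f' v) → g i f = g i f')
    (hD : ∀ i ∈ s, ∀ j ∈ s, i ≠ j → ∀ v ∈ A i, v ∉ D j) :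
    partialSum B (s.biUnion A) (fun f => ∏ i ∈ s, g i f) c =
      ∏ i ∈ s, partialSum B (A i) (g i) c := by
  induction s using Finset.induction_on with
  | empty => simp [partialSum_empty]
  | insert i s hi ih =>
    have hne : ∀ j ∈ s, i ≠ j := by rintro j hj rfl; exact hi hj
    have m : ∀ j ∈ s, j ∈ insert i s := fun j hj => Finset.mem_insert_of_mem hj
    have m0 := Finset.mem_insert_self i s
    rw [Finset.biUnion_insert, Finset.prod_insert hi]
    simp only [Finset.prod_insert hi]
    rw [partialSum_mul (D := D i) (D' := ⋃ j ∈ s, D j), ih]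
    · exact fun j hj k hk => hA j (m j hj) k (m k hk)
    · exact fun j hj => hg j (m j hj)
    · exact fun j hj k hk => hD j (m j hj) k (m k hk)
    · rw [Finset.disjoint_biUnion_right]
      exact fun j hj => hA i m0 j (m j hj) (hne j hj)
    · exact hg i m0
    · intro f f' hf
      refine Finset.prod_congr rfl fun j hj => hg j (m j hj) f f' fun v hv => hf v ?_
      exact Set.mem_biUnion hj hv
    · intro v hv
      obtain ⟨j, hj, hvj⟩ := Finset.mem_biUnion.1 hv
      exact hD j (m j hj) i m0 (hne j hj).symm v hvj
    · intro v hv hvD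
      simp only [Set.mem_iUnion] at hvD
      obtain ⟨j, hj, hvj⟩ := hvD
      exact hD i m0 j (m j hj) (hne j hj) v hv hvj

end PartialSum

namespace RootedForest

variable {V R : Type*} [Fintype V] [DecidableEq V] [CommRing R] (T : RootedForest V) (B : V → ℕ)
  (W : (V → ℕ) → V → R)

open Classical in
/-- The descendants of `u` as a finset. -/
noncomputable def treeFinset (u : V) : Finset V := {v | T.anc u v}

open Classical in
/-- The children of `u` as a finset. -/
noncomputable def childFinset (u : V) : Finset V :=
  {v | T.anc u v ∧ T.depthAt v = T.depthAt u + 1}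

/-- The sum over all choices in the tree of `u`. -/
noncomputable def value (u : V) (c : V → ℕ) : R :=
  partialSum B (T.treeFinset u) (fun f => ∏ x ∈ T.treeFinset u, W f x) c

/-- The contribution of the `m`-th choice at `u` to the value of `u`. -/
noncomputable def term (u : V) (m : ℕ) (c : V → ℕ) : R :=
  W (Function.update c u m) u * ∏ z ∈ T.childFinset u, T.value B W z (Function.update c u m)

variable {T B W}

theorem mem_treeFinset {u v : V} : v ∈ T.treeFinset u ↔ T.anc u v := by simp [treeFinset]

theorem mem_childFinset {u v : V} :
    v ∈ T.childFinset u ↔ T.anc u v ∧ T.depthAt v = T.depthAt u + 1 := by simp [childFinset]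

theorem value_congr (hW : ∀ x f f', (∀ v, T.anc v x → f v = f' v) → W f x = W f' x) {u : V}
    {c c' : V → ℕ} (h : ∀ v, T.anc v u → v ≠ u → c v = c' v) :
    T.value B W u c = T.value B W u c' := by
  refine partialSum_congr (D := {v | ∃ x, T.anc u x ∧ T.anc v x}) ?_ ?_
  · intro f f' hf
    exact Finset.prod_congr rfl fun x hx => hW x f f' fun v hv =>
      hf v ⟨x, mem_treeFinset.1 hx, hv⟩
  · rintro v ⟨x, hux, hvx⟩ hv
    rw [mem_treeFinset] at hv
    rcases T.chain' _ _ _ hux hvx with h' | h'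
    · exact absurd h' hv
    · refine h v h' ?_
      rintro rfl
      exact hv h'

theorem term_congr (hW : ∀ x f f', (∀ v, T.anc v x → f v = f' v) → W f x = W f' x) {u : V} {m : ℕ}
    {c c' : V → ℕ} (h : ∀ v, T.anc v u → v ≠ u → c v = c' v) :
    T.term B W u m c = T.term B W u m c' := by
  have key : ∀ v, T.anc v u → Function.update c u m v = Function.update c' u m v := by
    intro v hv
    by_cases hvu : v = u
    · simp [hvu]
    · simpa [hvu] using h v hv hvu
  unfold term
  rw [hW u _ _ key]
  congr 1
  refine Finset.prod_congr rfl fun z hz => value_congr hW fun v hv hvz => key v ?_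
  obtain ⟨h1, h2⟩ := mem_childFinset.1 hz
  refine T.anc_of_depthAt_le hv h1 ?_
  have := T.depthAt_lt hv hvz
  omega

theorem treeFinset_eq (u : V) :
    T.treeFinset u = insert u ((T.childFinset u).biUnion T.treeFinset) := by
  ext v
  simp only [mem_treeFinset, Finset.mem_insert, Finset.mem_biUnion, mem_childFinset]
  constructor
  · intro h
    by_cases hvu : v = u
    · exact Or.inl hvu
    · right
      obtain ⟨x, hx, hxd⟩ := T.exists_depthAt_eq v (i := T.depthAt u + 1) (by omega)
        (T.depthAt_lt h (Ne.symm hvu))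
      exact ⟨x, ⟨T.anc_of_depthAt_le h hx (by omega), hxd⟩, hx⟩
  · rintro (rfl | ⟨x, ⟨hx, -⟩, hxv⟩)
    · exact T.refl' _
    · exact T.trans' _ _ _ hx hxv

theorem notMem_biUnion_child (u : V) : u ∉ (T.childFinset u).biUnion T.treeFinset := by
  intro h
  obtain ⟨z, hz, hu⟩ := Finset.mem_biUnion.1 h
  have h1 := (mem_childFinset.1 hz).2
  have h2 := T.depthAt_mono (mem_treeFinset.1 hu)
  omega

theorem child_unrelated {u z z' v : V} (hz : z ∈ T.childFinset u) (hz' : z' ∈ T.childFinset u)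
    (h : T.anc z v) (h' : T.anc z' v) : z = z' :=
  T.eq_of_depthAt_eq h h' (by rw [(mem_childFinset.1 hz).2, (mem_childFinset.1 hz').2])

theorem value_eq (hW : ∀ x f f', (∀ v, T.anc v x → f v = f' v) → W f x = W f' x) (u : V)
    (c : V → ℕ) : T.value B W u c = ∑ m ∈ Finset.range (B u), T.term B W u m c := by
  have hdisj : ∀ i ∈ T.childFinset u, ∀ j ∈ T.childFinset u, i ≠ j →
      Disjoint (T.treeFinset i) (T.treeFinset j) := by
    intro i hi j hj hij
    rw [Finset.disjoint_left]
    intro v hv hv'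
    exact hij (child_unrelated hi hj (mem_treeFinset.1 hv) (mem_treeFinset.1 hv'))
  unfold value
  rw [treeFinset_eq u, partialSum_insert (notMem_biUnion_child u)]
  refine Finset.sum_congr rfl fun m _ => ?_
  simp only [Finset.prod_insert (notMem_biUnion_child u)]
  rw [partialSum_mul_left (D := {v | T.anc v u}) (fun f f' hf => hW u f f' hf), term]
  · congr 1
    have : (fun f : V → ℕ => ∏ x ∈ (T.childFinset u).biUnion T.treeFinset, W f x) =
        fun f => ∏ z ∈ T.childFinset u, ∏ x ∈ T.treeFinset z, W f x := by
      funext f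
      exact Finset.prod_biUnion fun i hi j hj hij => hdisj i hi j hj hij
    rw [this]
    refine partialSum_prod _ _ (fun z => {v | ∃ x, T.anc z x ∧ T.anc v x}) _ _ hdisj ?_ ?_
    · intro z _ f f' hf
      exact Finset.prod_congr rfl fun x hx => hW x f f' fun v hv =>
        hf v ⟨x, mem_treeFinset.1 hx, hv⟩
    · rintro i hi j hj hij v hv ⟨x, hjx, hvx⟩
      exact hij (child_unrelated hi hj (T.trans' _ _ _ (mem_treeFinset.1 hv) hvx) hjx)
  · intro v hv hvu
    obtain ⟨z, hz, hzv⟩ := Finset.mem_biUnion.1 hv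
    have h1 := (mem_childFinset.1 hz).2
    have h2 := T.depthAt_mono (T.trans' _ _ _ (mem_treeFinset.1 hzv) hvu)
    omega

theorem value_root {r : V} (hr : ∀ v, T.anc r v) (c : V → ℕ) :
    T.value B W r c = ∑ f ∈ Fintype.piFinset fun u => Finset.range (B u), ∏ u, W f u := by
  have : T.treeFinset r = Finset.univ := by
    ext v; simp [mem_treeFinset, hr]
  simp [value, this, partialSum]

end RootedForest

/-! ## Chaotic iteration -/

namespace RootedForest

variable {V R : Type*}

/-- A configuration: the current choices, the vertices whose choices are exhausted, and the sums
so far. -/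
structure Config (V R : Type*) where
  choice : V → ℕ
  done : V → Prop
  sum : V → R

variable [Fintype V] [DecidableEq V] [CommRing R] (T : RootedForest V) (B : V → ℕ)
  (W : (V → ℕ) → V → R)

open Classical in
/-- The number of choices at `u` that are accounted for. -/
noncomputable def Config.count (σ : Config V R) (B : V → ℕ) (u : V) : ℕ :=
  if σ.done u then B u else σ.choice u

/-- The invariant: below unfinished ancestors, every sum is the sum over the choices so far. -/
structure Config.Inv (σ : Config V R) : Prop where
  lt : ∀ u, σ.choice u < B u
  done : ∀ u v, T.anc u v → σ.done u → σ.done v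
  sum : ∀ u, (∀ v, T.anc v u → v ≠ u → ¬ σ.done v) →
    σ.sum u = ∑ m ∈ Finset.range (σ.count B u), T.term B W u m σ.choice

open Classical in
/-- The number of choices at `u` that are left. -/
noncomputable def Config.left (σ : Config V R) (B : V → ℕ) (u : V) : ℕ :=
  if σ.done u then 0 else B u - σ.choice u

open Classical in
/-- The potential of a configuration. -/
noncomputable def Config.potential (σ : Config V R) (b : ℕ) : ℕ :=
  ∑ x, ∑ v with T.anc v x, σ.left B v * (b + 1) ^ (T.depthAt x - T.depthAt v)

variable {T B W}

theorem sum_geometric_add_one (b m : ℕ) :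
    ∑ i ∈ Finset.range m, b * (b + 1) ^ i + 1 = (b + 1) ^ m := by
  induction m with
  | zero => simp
  | succ m ih => rw [Finset.sum_range_succ, add_right_comm, ih]; ring

theorem sum_chain_lt {b m : ℕ} {x : V} (s : Finset V) (f : V → ℕ)
    (hs : ∀ v ∈ s, T.anc v x ∧ T.depthAt x - T.depthAt v < m) (hf : ∀ v ∈ s, f v ≤ b) :
    ∑ v ∈ s, f v * (b + 1) ^ (T.depthAt x - T.depthAt v) < (b + 1) ^ m := by
  rw [← sum_geometric_add_one, Nat.lt_succ_iff]
  calc ∑ v ∈ s, f v * (b + 1) ^ (T.depthAt x - T.depthAt v)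
      ≤ ∑ v ∈ s, b * (b + 1) ^ (T.depthAt x - T.depthAt v) :=
        Finset.sum_le_sum fun v hv => Nat.mul_le_mul_right _ (hf v hv)
    _ = ∑ i ∈ s.image (fun v => T.depthAt x - T.depthAt v), b * (b + 1) ^ i := by
        rw [Finset.sum_image]
        intro v hv w hw hvw
        have h1 := T.depthAt_mono (hs v hv).1
        have h2 := T.depthAt_mono (hs w hw).1
        exact T.eq_of_depthAt_eq (hs v hv).1 (hs w hw).1 (by simp only at hvw; omega)
    _ ≤ ∑ i ∈ Finset.range m, b * (b + 1) ^ i := by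
        refine Finset.sum_le_sum_of_subset fun i hi => ?_
        obtain ⟨v, hv, rfl⟩ := Finset.mem_image.1 hi
        exact Finset.mem_range.2 (hs v hv).2

theorem Config.left_le {σ : Config V R} {b : ℕ} (hb : ∀ u, B u ≤ b) (u : V) : σ.left B u ≤ b := by
  unfold left
  split_ifs
  · omega
  · exact (Nat.sub_le _ _).trans (hb u)

open Classical in
theorem Config.potential_le (σ : Config V R) {b k : ℕ} (hb : ∀ u, B u ≤ b)
    (hk : ∀ u, T.depthAt u ≤ k) : σ.potential T B b ≤ Fintype.card V * (b + 1) ^ k := by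
  unfold potential
  calc _ ≤ ∑ x : V, (b + 1) ^ k := by
        refine Finset.sum_le_sum fun x _ => (sum_chain_lt _ _ ?_ fun v _ => left_le hb v).le
        intro v hv
        have := T.one_le_depthAt v
        have := T.one_le_depthAt x
        have := hk x
        exact ⟨(Finset.mem_filter.1 hv).2, by omega⟩
    _ = _ := by rw [Finset.sum_const, Finset.card_univ, smul_eq_mul]

open Classical in
theorem Config.potential_lt {σ σ' : Config V R} {b : ℕ} (hb : ∀ u, B u ≤ b) {u : V}
    (hu : σ'.left B u < σ.left B u)
    (hother : ∀ v, ¬ T.anc u v → σ'.left B v = σ.left B v) :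
    σ'.potential T B b < σ.potential T B b := by
  have key : ∀ x, T.anc u x →
      ∑ v with T.anc v x, σ'.left B v * (b + 1) ^ (T.depthAt x - T.depthAt v) <
        ∑ v with T.anc v x, σ.left B v * (b + 1) ^ (T.depthAt x - T.depthAt v) := by
    intro x hux
    set s : Finset V := {v | T.anc v x} with hs
    have hus : u ∈ s := by simp [hs, hux]
    have hsplit : ∀ f : V → ℕ, ∑ v ∈ s, f v = ∑ v ∈ s with ¬ T.anc u v, f v +
        (f u + ∑ v ∈ s with T.anc u v ∧ v ≠ u, f v) := by
      intro f
      rw [← Finset.sum_filter_add_sum_filter_not s (fun v => T.anc u v), add_comm]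
      congr 1
      have : (s.filter fun v => T.anc u v) =
          insert u (s.filter fun v => T.anc u v ∧ v ≠ u) := by
        ext v
        simp only [Finset.mem_filter, Finset.mem_insert]
        constructor
        · rintro ⟨h1, h2⟩
          by_cases h : v = u
          · exact Or.inl h
          · exact Or.inr ⟨h1, h2, h⟩
        · rintro (rfl | h)
          · exact ⟨hus, T.refl' _⟩
          · exact ⟨h.1, h.2.1⟩
      rw [this, Finset.sum_insert (by simp)]
    rw [hsplit, hsplit]
    have h1 : ∑ v ∈ s with ¬ T.anc u v, σ'.left B v * (b + 1) ^ (T.depthAt x - T.depthAt v) =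
        ∑ v ∈ s with ¬ T.anc u v, σ.left B v * (b + 1) ^ (T.depthAt x - T.depthAt v) :=
      Finset.sum_congr rfl fun v hv => by rw [hother v (Finset.mem_filter.1 hv).2]
    have h2 : ∑ v ∈ s with T.anc u v ∧ v ≠ u,
        σ'.left B v * (b + 1) ^ (T.depthAt x - T.depthAt v) <
          (b + 1) ^ (T.depthAt x - T.depthAt u) := by
      refine sum_chain_lt _ _ (fun v hv => ?_) fun v _ => left_le hb v
      obtain ⟨h3, h4, h5⟩ := Finset.mem_filter.1 hv
      have h6 : T.anc v x := (Finset.mem_filter.1 h3).2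
      have := T.depthAt_lt h4 (Ne.symm h5)
      have := T.depthAt_mono h6
      exact ⟨h6, by omega⟩
    rw [h1]
    have h3 : (σ'.left B u + 1) * (b + 1) ^ (T.depthAt x - T.depthAt u) ≤
        σ.left B u * (b + 1) ^ (T.depthAt x - T.depthAt u) := Nat.mul_le_mul_right _ hu
    rw [add_mul, one_mul] at h3
    omega
  unfold potential
  refine Finset.sum_lt_sum (fun x _ => ?_) ⟨u, Finset.mem_univ u, key u (T.refl' u)⟩
  by_cases hux : T.anc u x
  · exact (key x hux).le
  · refine le_of_eq (Finset.sum_congr rfl fun v hv => ?_)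
    rw [hother v fun huv => hux (T.trans' _ _ _ huv (Finset.mem_filter.1 hv).2)]

namespace Config.Inv

variable {σ σ' : Config V R} {u : V}

theorem not_done_of_anc (h : σ.Inv T B W) (hu : ¬ σ.done u) {v : V} (hv : T.anc v u) :
    ¬ σ.done v := fun hd => hu (h.done v u hv hd)

theorem sum_child (h : σ.Inv T B W)
    (hW : ∀ x f f', (∀ v, T.anc v x → f v = f' v) → W f x = W f' x) (hu : ¬ σ.done u)
    (hdesc : ∀ v, T.anc u v → v ≠ u → σ.done v) :
    W σ.choice u * ∏ z ∈ T.childFinset u, σ.sum z = T.term B W u (σ.choice u) σ.choice := by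
  rw [term, Function.update_eq_self]
  congr 1
  refine Finset.prod_congr rfl fun z hz => ?_
  obtain ⟨h1, h2⟩ := mem_childFinset.1 hz
  rw [h.sum z, value_eq hW, count, if_pos (hdesc z h1 (by rintro rfl; omega))]
  intro v hv hvz
  refine h.not_done_of_anc hu (T.anc_of_depthAt_le hv h1 ?_)
  have := T.depthAt_lt hv hvz
  omega

theorem advance (h : σ.Inv T B W)
    (hW : ∀ x f f', (∀ v, T.anc v x → f v = f' v) → W f x = W f' x) (hu : ¬ σ.done u)
    (hdesc : ∀ v, T.anc u v → v ≠ u → σ.done v) (hB : σ.choice u + 1 < B u)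
    (hc : σ'.choice u = σ.choice u + 1) (hd : ¬ σ'.done u)
    (hs : σ'.sum u = σ.sum u + W σ.choice u * ∏ z ∈ T.childFinset u, σ.sum z)
    (hdesc' : ∀ v, T.anc u v → v ≠ u → σ'.choice v = 0 ∧ ¬ σ'.done v ∧ σ'.sum v = 0)
    (hother : ∀ v, ¬ T.anc u v →
      σ'.choice v = σ.choice v ∧ (σ'.done v ↔ σ.done v) ∧ σ'.sum v = σ.sum v) :
    σ'.Inv T B W ∧ ∀ b, (∀ u, B u ≤ b) → σ'.potential T B b < σ.potential T B b := by
  have hnd : ∀ v, T.anc u v → ¬ σ'.done v := by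
    intro v hv
    by_cases hvu : v = u
    · rw [hvu]; exact hd
    · exact (hdesc' v hv hvu).2.1
  refine ⟨⟨fun v => ?_, fun v x hvx hv => ?_, fun x hx => ?_⟩, fun b hb => ?_⟩
  · by_cases hv : T.anc u v
    · by_cases hvu : v = u
      · rw [hvu, hc]; exact hB
      · rw [(hdesc' v hv hvu).1]
        have := h.lt v
        omega
    · rw [(hother v hv).1]; exact h.lt v
  · have hv' : ¬ T.anc u v := fun h' => hnd v h' hv
    have hx := h.done v x hvx ((hother v hv').2.1.1 hv)
    by_cases hux : T.anc u x
    · exfalso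
      rcases T.chain' _ _ _ hux hvx with h' | h'
      · exact hv' h'
      · exact hu (h.done v u h' ((hother v hv').2.1.1 hv))
    · exact (hother x hux).2.1.2 hx
  · by_cases hux : T.anc u x
    · by_cases hxu : x = u
      · subst hxu
        have hold := h.sum x fun v hv _ => h.not_done_of_anc hu hv
        rw [hs, h.sum_child hW hu hdesc, hold, count, count, if_neg hu, if_neg hd, hc,
          Finset.sum_range_succ]
        have hcong : ∀ m, T.term B W x m σ.choice = T.term B W x m σ'.choice := fun m =>
          term_congr hW fun v hv hvx => ((hother v fun h' => hvx (T.antisymm' _ _ hv h')).1).symm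
        simp only [hcong]
      · obtain ⟨h1, h2, h3⟩ := hdesc' x hux hxu
        rw [h3, count, if_neg h2, h1, Finset.range_zero, Finset.sum_empty]
    · obtain ⟨h1, h2, h3⟩ := hother x hux
      have hnv : ∀ v, T.anc v x → ¬ T.anc u v := fun v hv h' => hux (T.trans' _ _ _ h' hv)
      rw [h3, h.sum x fun v hv hvx hdv => hx v hv hvx ((hother v (hnv v hv)).2.1.2 hdv)]
      have hcount : σ'.count B x = σ.count B x := by
        unfold count
        rw [h1]
        by_cases hdx : σ.done x
        · rw [if_pos hdx, if_pos (h2.2 hdx)]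
        · rw [if_neg hdx, if_neg (mt h2.1 hdx)]
      rw [hcount]
      exact Finset.sum_congr rfl fun m _ => term_congr hW fun v hv _ =>
        ((hother v (hnv v hv)).1).symm
  · refine potential_lt (u := u) hb ?_ fun v hv => ?_
    · rw [left, left, if_neg hu, if_neg hd, hc]; omega
    · obtain ⟨h1, h2, -⟩ := hother v hv
      unfold left
      rw [h1]
      by_cases hdv : σ.done v
      · rw [if_pos hdv, if_pos (h2.2 hdv)]
      · rw [if_neg hdv, if_neg (mt h2.1 hdv)]

theorem finish (h : σ.Inv T B W)
    (hW : ∀ x f f', (∀ v, T.anc v x → f v = f' v) → W f x = W f' x) (hu : ¬ σ.done u)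
    (hdesc : ∀ v, T.anc u v → v ≠ u → σ.done v) (hB : σ.choice u + 1 = B u)
    (hc : σ'.choice u = 0) (hd : σ'.done u)
    (hs : σ'.sum u = σ.sum u + W σ.choice u * ∏ z ∈ T.childFinset u, σ.sum z)
    (hother : ∀ v, v ≠ u →
      σ'.choice v = σ.choice v ∧ (σ'.done v ↔ σ.done v) ∧ σ'.sum v = σ.sum v) :
    σ'.Inv T B W ∧ ∀ b, (∀ u, B u ≤ b) → σ'.potential T B b < σ.potential T B b := by
  refine ⟨⟨fun v => ?_, fun v x hvx hv => ?_, fun x hx => ?_⟩, fun b hb => ?_⟩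
  · by_cases hvu : v = u
    · rw [hvu, hc]; omega
    · rw [(hother v hvu).1]; exact h.lt v
  · by_cases hxu : x = u
    · rw [hxu]; exact hd
    · rw [(hother x hxu).2.1]
      by_cases hvu : v = u
      · subst hvu; exact hdesc x hvx hxu
      · exact h.done v x hvx ((hother v hvu).2.1.1 hv)
  · by_cases hxu : x = u
    · subst hxu
      have hold := h.sum x fun v hv _ => h.not_done_of_anc hu hv
      rw [hs, h.sum_child hW hu hdesc, hold, count, count, if_neg hu, if_pos hd, ← hB,
        Finset.sum_range_succ]
      have hcong : ∀ m, T.term B W x m σ.choice = T.term B W x m σ'.choice := fun m =>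
        term_congr hW fun v hv hvx => ((hother v hvx).1).symm
      simp only [hcong]
    · have hux : ¬ T.anc u x := fun h' => hx u h' (Ne.symm hxu) hd
      obtain ⟨h1, h2, h3⟩ := hother x hxu
      have hne : ∀ v, T.anc v x → v ≠ u := fun v hv h' => hux (h' ▸ hv)
      rw [h3, h.sum x fun v hv hvx hdv => hx v hv hvx ((hother v (hne v hv)).2.1.2 hdv)]
      have hcount : σ'.count B x = σ.count B x := by
        unfold count
        rw [h1]
        by_cases hdx : σ.done x
        · rw [if_pos hdx, if_pos (h2.2 hdx)]
        · rw [if_neg hdx, if_neg (mt h2.1 hdx)]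
      rw [hcount]
      exact Finset.sum_congr rfl fun m _ => term_congr hW fun v hv _ =>
        ((hother v (hne v hv)).1).symm
  · refine potential_lt (u := u) hb ?_ fun v hv => ?_
    · rw [left, left, if_neg hu, if_pos hd]; omega
    · obtain ⟨h1, h2, -⟩ := hother v (fun h' => hv (h' ▸ T.refl' _))
      unfold left
      rw [h1]
      by_cases hdv : σ.done v
      · rw [if_pos hdv, if_pos (h2.2 hdv)]
      · rw [if_neg hdv, if_neg (mt h2.1 hdv)]

theorem exists_ready (hσ : ¬ ∀ u, σ.done u) :
    ∃ u, ¬ σ.done u ∧ ∀ v, T.anc u v → v ≠ u → σ.done v := by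
  push Not at hσ
  obtain ⟨u, hu, hmax⟩ := Set.exists_max_image {u | ¬ σ.done u} T.depthAt (Set.toFinite _) hσ
  refine ⟨u, hu, fun v hv hvu => ?_⟩
  by_contra hc
  have := hmax v hc
  have := T.depthAt_lt hv (Ne.symm hvu)
  omega

theorem sum_root (h : σ.Inv T B W)
    (hW : ∀ x f f', (∀ v, T.anc v x → f v = f' v) → W f x = W f' x) {r : V}
    (hr : ∀ v, T.anc r v) (hd : σ.done r) :
    σ.sum r = ∑ f ∈ Fintype.piFinset fun u => Finset.range (B u), ∏ u, W f u := by
  rw [← value_root hr σ.choice, value_eq hW, h.sum r, count, if_pos hd]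
  intro v hv hvr
  exact absurd (T.antisymm' _ _ hv (hr v)) hvr

theorem init (hB : ∀ u, 0 < B u) (hc : ∀ u, σ.choice u = 0) (hd : ∀ u, ¬ σ.done u)
    (hs : ∀ u, σ.sum u = 0) : σ.Inv T B W := by
  refine ⟨fun u => by rw [hc]; exact hB u, fun u v _ hu => absurd hu (hd u), fun u _ => ?_⟩
  rw [hs, count, if_neg (hd u), hc, Finset.range_zero, Finset.sum_empty]

end Config.Inv

/-! ### Locality of the weights -/

section Locality

variable {G : SimpleGraph V} {d : ℕ} {D D' : V → ℕ → ℕ} {x : V}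

theorem own_congr (h : ∀ v, T.anc v x → D v = D' v) (u : V) (hu : T.anc u x) (i : ℕ) :
    own (T.att D) (fun v => D v 1) u i = own (T.att D') (fun v => D' v 1) u i := by
  have hatt : ∀ u, T.anc (T.att D u) u := fun u => T.atDepth_anc u _
  have key : ∀ k, (fun v => if i ≤ D v 1 then T.att D v else v)^[k] u =
      (fun v => if i ≤ D' v 1 then T.att D' v else v)^[k] u := by
    intro k
    induction k with
    | zero => rfl
    | succ k ih =>
      rw [Function.iterate_succ_apply', Function.iterate_succ_apply', ← ih]
      have h1 := h _ (T.trans' _ _ _ (own_iterate_anc (β := fun v => D v 1) hatt u i k) hu)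
      set y := (fun v => if i ≤ D v 1 then T.att D v else v)^[k] u
      show (if i ≤ D y 1 then T.atDepth y (D y 0) else y) =
        if i ≤ D' y 1 then T.atDepth y (D' y 0) else y
      rw [show D y = D' y from h1]
  exact key _

theorem weight_congr (z : R) (h : ∀ v, T.anc v x → D v = D' v) :
    T.weight G d z D x = T.weight G d z D' x := by
  have hx := h x (T.refl' x)
  have ha : T.att D x = T.att D' x := by simp only [att, hx]
  have hax := h _ (T.atDepth_anc x (D x 0))
  have hv : T.ValidAt G d D x ↔ T.ValidAt G d D' x := by
    unfold ValidAt
    refine and_congr (by rw [hx]) (and_congr ?_ ?_)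
    · rw [← ha, ← hx]
      have hax' : D (T.att D x) = D' (T.att D x) := hax
      rw [hax']
    · refine forall_congr' fun w => imp_congr_right fun hw => imp_congr_right fun _ => ?_
      rw [own_congr h w hw, own_congr h x (T.refl' x), h w hw, hx]
  unfold weight
  simp only [hx]
  split_ifs with h1 h2 h2
  · rfl
  · exact absurd (hv.1 h1) h2
  · exact absurd (hv.2 h2) h1
  · rfl

end Locality

end RootedForest

/-! ## Derived expressions and their values -/

namespace WordRAM

namespace Expr

/-- The sum of `e` over `i < b`. -/
def sum (i x : ℕ) (b e : Expr) : Expr := .fold i x b (.lit 0) (.op .add (.var x) e)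

/-- Whether `e` is nonzero for all `i < b`. -/
def all (i x : ℕ) (b e : Expr) : Expr := .fold i x b (.lit 1) (.ite e (.var x) (.lit 0))

/-- Conjunction. -/
def conj (e f : Expr) : Expr := .ite e f (.lit 0)

/-- Negation. -/
def neg (e : Expr) : Expr := .ite e (.lit 0) (.lit 1)

/-- Implication. -/
def imp (e f : Expr) : Expr := .ite e f (.lit 1)

section

variable {w N : ℕ} {A : Fin 8 → ℕ → ℕ → ℕ} {v : ℕ → ℕ}

theorem eval_sum {i x m : ℕ} {b e : Expr} (f : ℕ → ℕ) (hb : b.eval w N A v = m) (hm : m ≤ N)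
    (he : ∀ k < m, ∀ r, e.eval w N A (Function.update (Function.update v i k) x r) = f k)
    (hf : ∑ k ∈ Finset.range m, f k < 2 ^ w) :
    (Expr.sum i x b e).eval w N A v = ∑ k ∈ Finset.range m, f k := by
  simp only [Expr.sum, eval, hb, min_eq_left hm, Nat.zero_mod]
  refine (iter_induction (fun k r => k ≤ m → r = ∑ l ∈ Finset.range k, f l) m (by simp)
    fun k hk r hr hk' => ?_) le_rfl
  rw [he k hk, Function.update_self, hr hk.le, Finset.sum_range_succ]
  refine Nat.mod_eq_of_lt (lt_of_le_of_lt ?_ hf)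
  rw [← Finset.sum_range_succ]
  exact Finset.sum_le_sum_of_subset (Finset.range_mono hk')

theorem eval_all (h2 : 2 ≤ 2 ^ w) {i x m : ℕ} {b e : Expr} (P : ℕ → Prop)
    (hb : b.eval w N A v = m) (hm : m ≤ N)
    (he : ∀ k < m, ∀ r,
      e.eval w N A (Function.update (Function.update v i k) x r) ≠ 0 ↔ P k) :
    (Expr.all i x b e).eval w N A v ≠ 0 ↔ ∀ k < m, P k := by
  simp only [Expr.all, eval, hb, min_eq_left hm]
  have h1 : (1 : ℕ) % 2 ^ w = 1 := Nat.mod_eq_of_lt (by omega)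
  rw [h1]
  refine iter_induction (fun k r => k ≤ m → (r ≠ 0 ↔ ∀ l < k, P l)) m (by simp)
    (fun k hk r hr hk' => ?_) le_rfl
  rw [Function.update_self]
  by_cases hP : P k
  · rw [if_pos ((he k hk _).2 hP), hr hk.le]
    constructor
    · intro h l hl
      rcases Nat.lt_succ_iff_lt_or_eq.1 hl with h' | rfl
      · exact h l h'
      · exact hP
    · exact fun h l hl => h l (by omega)
  · rw [if_neg fun h => hP ((he k hk _).1 h)]
    simp only [Nat.zero_mod, ne_eq, not_true, false_iff]
    exact fun h => hP (h k (by omega))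

theorem eval_conj {e f : Expr} :
    (conj e f).eval w N A v ≠ 0 ↔ e.eval w N A v ≠ 0 ∧ f.eval w N A v ≠ 0 := by
  by_cases h : e.eval w N A v = 0 <;> simp [conj, eval, h]

theorem eval_neg (h2 : 2 ≤ 2 ^ w) {e : Expr} :
    (neg e).eval w N A v ≠ 0 ↔ ¬ e.eval w N A v ≠ 0 := by
  have h1 : (1 : ℕ) % 2 ^ w = 1 := Nat.mod_eq_of_lt (by omega)
  by_cases h : e.eval w N A v = 0 <;> simp [neg, eval, h, h1]

theorem eval_imp (h2 : 2 ≤ 2 ^ w) {e f : Expr} :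
    (imp e f).eval w N A v ≠ 0 ↔ (e.eval w N A v ≠ 0 → f.eval w N A v ≠ 0) := by
  have h1 : (1 : ℕ) % 2 ^ w = 1 := Nat.mod_eq_of_lt (by omega)
  by_cases h : e.eval w N A v = 0 <;> simp [imp, eval, h, h1]

theorem eval_lt_iff (h2 : 2 ≤ 2 ^ w) {e f : Expr} :
    (op .lt e f).eval w N A v ≠ 0 ↔ e.eval w N A v < f.eval w N A v := Op.eval_lt_ne_zero h2

theorem eval_eq_iff (h2 : 2 ≤ 2 ^ w) {e f : Expr} :
    (op .eq e f).eval w N A v ≠ 0 ↔ e.eval w N A v = f.eval w N A v := by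
  have h1 : (1 : ℕ) % 2 ^ w = 1 := Nat.mod_eq_of_lt (by omega)
  by_cases h : e.eval w N A v = f.eval w N A v <;> simp [eval, Op.eval, h, h1]

theorem eval_lit {a : ℕ} (h : a < 2 ^ w) : (lit a).eval w N A v = a := Nat.mod_eq_of_lt h

theorem eval_var {x a : ℕ} (h : v x = a) : (var x).eval w N A v = a := h

theorem eval_ite_pos {c e f : Expr} (h : c.eval w N A v ≠ 0) :
    (ite c e f).eval w N A v = e.eval w N A v := if_pos h

theorem eval_ite_neg {c e f : Expr} (h : ¬ c.eval w N A v ≠ 0) :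
    (ite c e f).eval w N A v = f.eval w N A v := if_neg h

theorem eval_fold_induction {i x m : ℕ} {b e f : Expr} (P : ℕ → ℕ → Prop)
    (hb : b.eval w N A v = m) (hm : m ≤ N) (h0 : P 0 (e.eval w N A v))
    (h : ∀ k < m, ∀ r, P k r →
      P (k + 1) (f.eval w N A (Function.update (Function.update v i k) x r))) :
    P m ((fold i x b e f).eval w N A v) := by
  simp only [eval, hb, min_eq_left hm]
  exact iter_induction P m h0 h

theorem eval_arr {a : Fin 8} {e f : Expr} {i j : ℕ} (hi : e.eval w N A v = i)
    (hj : f.eval w N A v = j) (hiN : i < N) (hjN : j < N) :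
    (arr a e f).eval w N A v = A a i j := by
  simp [eval, hi, hj, hiN, hjN]

theorem eval_add {e f : Expr} {i j : ℕ} (hi : e.eval w N A v = i)
    (hj : f.eval w N A v = j) (h : i + j < 2 ^ w) : (op .add e f).eval w N A v = i + j := by
  simp only [eval, Op.eval, hi, hj]
  exact Nat.mod_eq_of_lt h

theorem eval_mul {e f : Expr} {i j : ℕ} (hi : e.eval w N A v = i)
    (hj : f.eval w N A v = j) (h : i * j < 2 ^ w) : (op .mul e f).eval w N A v = i * j := by
  simp only [eval, Op.eval, hi, hj]
  exact Nat.mod_eq_of_lt h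

theorem eval_sub {e f : Expr} {i j : ℕ} (hi : e.eval w N A v = i)
    (hj : f.eval w N A v = j) (h : i < 2 ^ w) (hji : j ≤ i) :
    (op .sub e f).eval w N A v = i - j := by
  simp only [eval, Op.eval, hi, hj]
  rw [show i + (2 ^ w - j) = (i - j) + 2 ^ w by omega, Nat.add_mod_right]
  exact Nat.mod_eq_of_lt (by omega)

theorem eval_mod {e f : Expr} {i j : ℕ} (hi : e.eval w N A v = i)
    (hj : f.eval w N A v = j) (h : i < 2 ^ w) : (op .mod e f).eval w N A v = i % j := by
  simp only [eval, Op.eval, hi, hj]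
  exact Nat.mod_eq_of_lt ((Nat.mod_le _ _).trans_lt h)

theorem eval_div {e f : Expr} {i j : ℕ} (hi : e.eval w N A v = i)
    (hj : f.eval w N A v = j) (h : i < 2 ^ w) : (op .div e f).eval w N A v = i / j := by
  simp only [eval, Op.eval, hi, hj]
  exact Nat.mod_eq_of_lt ((Nat.div_le_self _ _).trans_lt h)

end

end Expr

/-! ## The tables of the algorithm

Array `0` is the adjacency matrix, `1` the ancestor matrix, `2` holds the marks of the finished
vertices in its first column, `3` the digits of the current choices, `4` the sums, and `5` the
product that is computed. Variable `0` is the number of vertices, `1` the depth bound, `2` the number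
of bits of a coefficient, `3` tells whether to go on, `4` is the current vertex and `5` is the side of
the arrays. -/

/-- Bounds for the parameters. -/
structure Params (w N n d : ℕ) : Prop where
  pos : 0 < n
  word : 8 * N * N ≤ 2 ^ w
  size : 4 * n * n * (n + 1) ≤ N
  eight : n + 4 ≤ N
  le : d ≤ n

namespace Params

variable {w N n d : ℕ} (h : Params w N n d)
include h

theorem lt_word {a : ℕ} (ha : a ≤ 4 * N) : a < 2 ^ w := by
  have := h.word
  have := h.eight
  nlinarith

theorem two : 2 ≤ 2 ^ w := h.lt_word (a := 2) (by have := h.eight; omega) |>.le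

theorem nN : n < N := by have := h.eight; omega

end Params

open Classical in
/-- The arrays hold the graph, the tree and the digits. -/
structure Tables {n : ℕ} (d : ℕ) (G : SimpleGraph (Fin n)) (T : RootedForest (Fin n))
    (D : Fin n → ℕ → ℕ) (A : Fin 8 → ℕ → ℕ → ℕ) : Prop where
  adj : ∀ i j : Fin n, A 0 i j = if G.Adj i j then 1 else 0
  anc : ∀ i j : Fin n, A 1 i j = if T.anc i j then 1 else 0
  dig : ∀ (i : Fin n) (j : ℕ), j < d + 4 → A 3 i j = D i j

namespace Expr

/-- The depth of the vertex in the variable `x`. -/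
def depth (x : ℕ) : Expr := .sum 20 21 (.var 0) (.arr 1 (.var 20) (.var x))

/-- The vertex to which the vertex in the variable `x` attaches. -/
def att (x : ℕ) : Expr :=
  .fold 22 23 (.var 0) (.var x)
    (.ite (conj (.arr 1 (.var 22) (.var x)) (.op .eq (depth 22) (.arr 3 (.var x) (.lit 0))))
      (.var 22) (.var 23))

/-- The owner of the node at depth `i` on the path to the vertex in the variable `x`. -/
def own (x : ℕ) (i : Expr) : Expr :=
  .fold 24 25 (.var 0) (.var x)
    (.ite (.op .lt (.arr 3 (.var 25) (.lit 1)) i) (.var 25) (att 25))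

/-- The smaller of the depths of the vertices in the variables `26` and `4`. -/
def minDepth : Expr :=
  .ite (.op .lt (.arr 3 (.var 26) (.lit 2)) (.var 12)) (.arr 3 (.var 26) (.lit 2)) (.var 12)

/-- Whether the bits of the choice are in order. -/
def bitsValid : Expr :=
  .all 26 27 (.var 1) (imp (.op .eq (.arr 3 (.var 4) (.op .add (.var 26) (.lit 3))) (.lit 1))
    (conj (.op .lt (.var 11) (.var 26)) (.op .lt (.var 26) (.var 12))))

/-- Whether the depths of the choice are in order. -/
def depthsValid : Expr :=
  .ite (.var 13)
    (conj (.op .lt (.arr 3 (.var 10) (.lit 1)) (.var 11))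
      (conj (neg (.op .lt (.arr 3 (.var 10) (.lit 2)) (.var 11)))
        (conj (neg (.op .lt (.var 12) (.var 11)))
          (imp (.op .eq (.var 11) (.var 12))
            (.op .eq (.arr 3 (.var 10) (.op .add (.var 11) (.lit 3))) (.lit 1))))))
    (conj (.op .eq (depth 4) (.lit 1)) (conj (neg (.var 11)) (.var 12)))

/-- Whether the choice respects the edges to the ancestors. -/
def edgesValid : Expr :=
  .all 26 27 (.var 0) (imp (.arr 1 (.var 26) (.var 4)) (imp (.arr 0 (.var 26) (.var 4))
    (.op .eq (own 26 minDepth) (own 4 minDepth))))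

/-- The number of forbidden nodes. -/
def forbidden : Expr :=
  .sum 26 27 (.var 1) (.ite (conj (conj (.op .lt (.var 11) (.var 26)) (.op .lt (.var 26) (.var 12)))
    (neg (.op .eq (.arr 3 (.var 4) (.op .add (.var 26) (.lit 3))) (.lit 1)))) (.lit 1) (.lit 0))

section

variable {w N n d : ℕ} {G : SimpleGraph (Fin n)} {T : RootedForest (Fin n)} {D : Fin n → ℕ → ℕ}
  {A : Fin 8 → ℕ → ℕ → ℕ} {v : ℕ → ℕ}

theorem eval_table {a : Fin 8} {x : ℕ} {e : Expr} (hP : Params w N n d) {u : Fin n}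
    (hx : v x = u) {j : ℕ} (hj : e.eval w N A v = j) (hjN : j < N) :
    (arr a (var x) e).eval w N A v = A a u j :=
  eval_arr hx hj (by have := hP.nN; omega) hjN

theorem eval_depth (hP : Params w N n d) (hA : Tables d G T D A) (h0 : v 0 = n) {x : ℕ}
    (hx20 : x ≠ 20) (hx21 : x ≠ 21) {u : Fin n} (hx : v x = u) :
    (depth x).eval w N A v = T.depthAt u := by
  classical
  have hn := hP.nN
  have hsum : ∑ k ∈ Finset.range n, A 1 k u = T.depthAt u := by
    rw [Finset.sum_range]
    simp only [hA.anc]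
    rw [Finset.sum_boole, RootedForest.depthAt, RootedForest.tail, Nat.cast_id,
      ← Set.ncard_coe_finset]
    congr 1
    ext i
    simp
  rw [depth, eval_sum (fun k => A 1 k u) (eval_var h0) hn.le, hsum]
  · intro k hk r
    refine eval_arr (by simp [eval]) ?_ (by omega) (by omega)
    simp [eval, hx20, hx21, hx]
  · rw [hsum]
    have := T.depthAt_le_card u
    rw [Fintype.card_fin] at this
    exact hP.lt_word (by omega)

theorem eval_att (hP : Params w N n d) (hA : Tables d G T D A) (h0 : v 0 = n) {x : ℕ}
    (hx0 : 24 ≤ x ∨ (x < 20 ∧ x ≠ 0)) {u : Fin n} (hx : v x = u) :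
    (att x).eval w N A v = T.att D u := by
  have hn := hP.nN
  have key := eval_fold_induction (w := w) (N := N) (A := A) (v := v) (i := 22) (x := 23)
    (b := .var 0) (e := .var x) (f := .ite (conj (.arr 1 (.var 22) (.var x))
      (.op .eq (depth 22) (.arr 3 (.var x) (.lit 0)))) (.var 22) (.var 23))
    (fun k r => k ≤ n →
      ((r = u ∧ ∀ z : Fin n, (z : ℕ) < k → ¬ (T.anc z u ∧ T.depthAt z = D u 0)) ∨
      ∃ z : Fin n, r = z ∧ T.anc z u ∧ T.depthAt z = D u 0)) (eval_var h0) hn.le ?_ ?_ le_rfl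
  · rcases key with ⟨h1, h2⟩ | ⟨z, h1, h2, h3⟩
    · refine Eq.trans h1 ?_
      rw [RootedForest.att, RootedForest.atDepth, dif_neg]
      rintro ⟨z, hz⟩
      exact h2 z z.isLt hz
    · refine Eq.trans h1 ?_
      rw [RootedForest.att, ← h3, T.atDepth_eq h2]
  · intro _
    exact Or.inl ⟨hx, fun z hz => absurd hz (Nat.not_lt_zero _)⟩
  · intro k hk r hr hk'
    set z : Fin n := ⟨k, hk⟩ with hz
    have hxv : Function.update (Function.update v 22 k) 23 r x = u := by
      rw [Function.update_of_ne (by omega), Function.update_of_ne (by omega), hx]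
    have hcond : (conj (.arr 1 (.var 22) (.var x))
        (.op .eq (depth 22) (.arr 3 (.var x) (.lit 0)))).eval w N A
          (Function.update (Function.update v 22 k) 23 r) ≠ 0 ↔
        (T.anc z u ∧ T.depthAt z = D u 0) := by
      rw [eval_conj, eval_eq_iff hP.two, eval_depth hP hA (u := z) (by simp [h0]) (by omega)
        (by omega) (by simp [hz]), eval_table hP hxv (eval_lit (hP.lt_word (Nat.zero_le _)))
        (by omega), hA.dig u 0 (by omega), eval_arr (i := k) (j := u) (eval_var (by simp)) (eval_var hxv)
        (by omega) (by omega), show A 1 k u = A 1 z u from rfl, hA.anc]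
      simp
    by_cases hc : T.anc z u ∧ T.depthAt z = D u 0
    · rw [eval_ite_pos (hcond.2 hc)]
      exact Or.inr ⟨z, eval_var (by simp [hz]), hc⟩
    · rw [eval_ite_neg fun h => hc (hcond.1 h), eval_var (Function.update_self _ _ _)]
      rcases hr hk.le with ⟨h1, h2⟩ | h1
      · refine Or.inl ⟨h1, fun z' hz' => ?_⟩
        rcases Nat.lt_succ_iff_lt_or_eq.1 hz' with h3 | h3
        · exact h2 z' h3
        · rwa [show z' = z from Fin.ext h3]
      · exact Or.inr h1

theorem eval_own (hP : Params w N n d) (hA : Tables d G T D A) (h0 : v 0 = n) {x : ℕ}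
    {u : Fin n} (hx : v x = u) {e : Expr} {i : ℕ}
    (he : ∀ k r, e.eval w N A (Function.update (Function.update v 24 k) 25 r) = i) :
    (own x e).eval w N A v = RootedForest.own (T.att D) (fun y => D y 1) u i := by
  have hn := hP.nN
  rw [RootedForest.own, Fintype.card_fin]
  refine eval_fold_induction (fun k r => r =
    ((((fun y => if i ≤ D y 1 then T.att D y else y)^[k] u : Fin n) : ℕ))) (eval_var h0) hn.le hx ?_
  intro k hk r hr
  rw [Function.iterate_succ_apply']
  set y := (fun y => if i ≤ D y 1 then T.att D y else y)^[k] u with hy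
  have h25 : Function.update (Function.update v 24 k) 25 r 25 = y := by rw [Function.update_self, hr]
  have hD : (arr 3 (var 25) (lit 1)).eval w N A (Function.update (Function.update v 24 k) 25 r) =
      D y 1 := by
    have := hP.pos
    rw [eval_table hP h25 (eval_lit (hP.lt_word (by omega))) (by omega), hA.dig y 1 (by omega)]
  have hlt := eval_lt_iff (w := w) (N := N) (A := A)
    (v := Function.update (Function.update v 24 k) 25 r) hP.two
    (e := arr 3 (var 25) (lit 1)) (f := e)
  rw [hD, he] at hlt
  by_cases hc : D y 1 < i
  · rw [eval_ite_pos (hlt.2 hc), eval_var h25, if_neg (by omega)]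
  · rw [eval_ite_neg fun h => hc (hlt.1 h), if_pos (by omega)]
    exact eval_att hP hA (by simp [h0]) (by omega) h25

end

end Expr

end WordRAM

namespace WordRAM

namespace Expr

/-- Whether the choice of the vertex in the variable `4` fits to the choices of its ancestors. -/
def valid : Expr := conj bitsValid (conj depthsValid edgesValid)

section

variable {w N n d : ℕ} {G : SimpleGraph (Fin n)} {T : RootedForest (Fin n)} {D : Fin n → ℕ → ℕ}
  {A : Fin 8 → ℕ → ℕ → ℕ} {v : ℕ → ℕ}

/-- The variables describe the choice of `u`. -/
structure Loaded (T : RootedForest (Fin n)) (d : ℕ) (D : Fin n → ℕ → ℕ) (u : Fin n)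
    (v : ℕ → ℕ) : Prop where
  size : v 0 = n
  bound : v 1 = d
  vertex : v 4 = u
  att : v 10 = T.att D u
  fst : v 11 = D u 1
  snd : v 12 = D u 2
  zero : v 13 = D u 0

theorem Loaded.update {u : Fin n} (h : Loaded T d D u v) {x : ℕ} (hx : 14 ≤ x) (a : ℕ) :
    Loaded T d D u (Function.update v x a) := by
  constructor <;> rw [Function.update_of_ne (by omega)]
  exacts [h.size, h.bound, h.vertex, h.att, h.fst, h.snd, h.zero]

theorem eval_bit (hP : Params w N n d) (hA : Tables d G T D A) {x y i : ℕ} {u : Fin n}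
    (hx : v x = u) (hy : v y = i) (hi : i ≤ d) :
    (op .eq (arr 3 (var x) (op .add (var y) (lit 3))) (lit 1)).eval w N A v ≠ 0 ↔
      D u (i + 3) = 1 := by
  have h1 := hP.le
  have h2 := hP.eight
  rw [eval_eq_iff hP.two, eval_lit (hP.lt_word (by omega)),
    eval_table hP hx (eval_add (eval_var hy) (eval_lit (hP.lt_word (by omega)))
      (hP.lt_word (by omega))) (by omega), hA.dig u _ (by omega)]

theorem eval_bitsValid (hP : Params w N n d) (hA : Tables d G T D A) {u : Fin n}
    (hv : Loaded T d D u v) :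
    bitsValid.eval w N A v ≠ 0 ↔ ∀ i < d, D u (i + 3) = 1 → D u 1 < i ∧ i < D u 2 := by
  have h1 := hP.le
  have h2 := hP.eight
  refine eval_all hP.two _ (eval_var hv.bound) (by omega) fun k hk r => ?_
  have hv' := (hv.update (x := 26) (by omega) k).update (x := 27) (by omega) r
  have h26 : Function.update (Function.update v 26 k) 27 r 26 = k := by simp
  rw [eval_imp hP.two, eval_bit hP hA hv'.vertex h26 hk.le, eval_conj, eval_lt_iff hP.two,
    eval_lt_iff hP.two, eval_var hv'.fst, eval_var h26, eval_var hv'.snd]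

theorem eval_depthsValid (hP : Params w N n d) (hA : Tables d G T D A) {u : Fin n}
    (hv : Loaded T d D u v) (hD : D u 1 ≤ d) :
    depthsValid.eval w N A v ≠ 0 ↔ (if D u 0 = 0 then T.depthAt u = 1 ∧ D u 1 = 0 ∧ 1 ≤ D u 2
      else D (T.att D u) 1 < D u 1 ∧ D u 1 ≤ D (T.att D u) 2 ∧ D u 1 ≤ D u 2 ∧
      (D u 1 = D u 2 → D (T.att D u) (D u 1 + 3) = 1)) := by
  have h1 := hP.le
  have h2 := hP.eight
  have hpos := hP.pos
  have l : ∀ a ≤ 4, (lit a).eval w N A v = a := fun a ha => eval_lit (hP.lt_word (by omega))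
  by_cases h0 : D u 0 = 0
  · rw [if_pos h0, depthsValid, eval_ite_neg (by rw [eval_var hv.zero]; simpa using h0), eval_conj,
      eval_conj, eval_eq_iff hP.two, eval_depth hP hA hv.size (by omega) (by omega) hv.vertex,
      l 1 (by omega), eval_neg hP.two, eval_var hv.fst, eval_var hv.snd]
    omega
  · rw [if_neg h0, depthsValid, eval_ite_pos (by rw [eval_var hv.zero]; exact h0), eval_conj,
      eval_conj, eval_conj, eval_neg hP.two, eval_neg hP.two, eval_imp hP.two,
      eval_bit hP hA hv.att hv.fst hD, eval_lt_iff hP.two, eval_lt_iff hP.two, eval_lt_iff hP.two,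
      eval_eq_iff hP.two, eval_table hP hv.att (l 1 (by omega)) (by omega),
      eval_table hP hv.att (l 2 (by omega)) (by omega), hA.dig _ 1 (by omega),
      hA.dig _ 2 (by omega), eval_var hv.fst, eval_var hv.snd, not_lt, not_lt]

theorem eval_minDepth (hP : Params w N n d) (hA : Tables d G T D A) {u y : Fin n}
    (hv : Loaded T d D u v) (hy : v 26 = y) :
    minDepth.eval w N A v = min (D y 2) (D u 2) := by
  have hpos := hP.pos
  have h2 := hP.eight
  have h := eval_table (A := A) (a := 3) hP hy (eval_lit (N := N) (A := A) (v := v) (a := 2)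
    (hP.lt_word (by omega))) (by omega)
  rw [hA.dig _ 2 (by omega)] at h
  have hlt := eval_lt_iff (N := N) (A := A) (v := v) hP.two (e := arr 3 (var 26) (lit 2))
    (f := var 12)
  rw [h, eval_var hv.snd] at hlt
  by_cases hc : D y 2 < D u 2
  · rw [minDepth, eval_ite_pos (hlt.2 hc), h, min_eq_left hc.le]
  · rw [minDepth, eval_ite_neg (fun h' => hc (hlt.1 h')), eval_var hv.snd, min_eq_right (by omega)]

theorem eval_edgesValid (hP : Params w N n d) (hA : Tables d G T D A) {u : Fin n}
    (hv : Loaded T d D u v) :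
    edgesValid.eval w N A v ≠ 0 ↔ ∀ y, T.anc y u → G.Adj y u →
      RootedForest.own (T.att D) (fun x => D x 1) y (min (D y 2) (D u 2)) =
      RootedForest.own (T.att D) (fun x => D x 1) u (min (D y 2) (D u 2)) := by
  have hn := hP.nN
  rw [edgesValid, eval_all hP.two (fun k => ∀ y : Fin n, (y : ℕ) = k → T.anc y u → G.Adj y u →
      RootedForest.own (T.att D) (fun x => D x 1) y (min (D y 2) (D u 2)) =
      RootedForest.own (T.att D) (fun x => D x 1) u (min (D y 2) (D u 2)))
    (eval_var hv.size) hn.le]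
  · exact ⟨fun h y => h y y.isLt y rfl, fun h k _ y _ => h y⟩
  intro k hk r
  set v' := Function.update (Function.update v 26 k) 27 r with hvd
  have hv' : Loaded T d D u v' := (hv.update (x := 26) (by omega) k).update (x := 27) (by omega) r
  obtain ⟨y, rfl⟩ : ∃ y : Fin n, (y : ℕ) = k := ⟨⟨k, hk⟩, rfl⟩
  have h26 : v' 26 = y := by simp [hvd]
  have hmin : ∀ k' r', minDepth.eval w N A
      (Function.update (Function.update v' 24 k') 25 r') = min (D y 2) (D u 2) := fun k' r' =>
    eval_minDepth hP hA ((hv'.update (x := 24) (by omega) k').update (x := 25) (by omega) r')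
      (by simpa using h26)
  rw [eval_imp hP.two, eval_imp hP.two, eval_eq_iff hP.two, eval_own hP hA hv'.size h26 hmin,
    eval_own hP hA hv'.size hv'.vertex hmin, eval_table hP h26 (eval_var hv'.vertex) (by omega),
    eval_table hP h26 (eval_var hv'.vertex) (by omega), hA.anc, hA.adj]
  simp only [ne_eq, ite_eq_right_iff, one_ne_zero, imp_false, not_not]
  constructor
  · intro h z hz h1 h2
    obtain rfl : z = y := Fin.ext hz
    exact Fin.ext (h h1 h2)
  · exact fun h h1 h2 => congrArg _ (h y rfl h1 h2)

theorem eval_valid (hP : Params w N n d) (hA : Tables d G T D A) {u : Fin n}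
    (hv : Loaded T d D u v) (hD : D u 1 ≤ d) : valid.eval w N A v ≠ 0 ↔ T.ValidAt G d D u := by
  rw [valid, eval_conj, eval_conj, eval_bitsValid hP hA hv, eval_depthsValid hP hA hv hD,
    eval_edgesValid hP hA hv]
  rfl

open Classical in
theorem eval_forbidden (hP : Params w N n d) (hA : Tables d G T D A) {u : Fin n}
    (hv : Loaded T d D u v) : forbidden.eval w N A v =
      Finset.card {i ∈ Finset.range d | (D u 1 < i ∧ i < D u 2) ∧ D u (i + 3) ≠ 1} := by
  have h1 := hP.le
  have h2 := hP.eight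
  rw [Finset.card_filter]
  refine eval_sum _ (eval_var hv.bound) (by omega) (fun k hk r => ?_) ?_
  · have hv' := (hv.update (x := 26) (by omega) k).update (x := 27) (by omega) r
    have h26 : Function.update (Function.update v 26 k) 27 r 26 = k := by simp
    have hiff := eval_conj (w := w) (N := N) (A := A)
      (v := Function.update (Function.update v 26 k) 27 r)
      (e := conj (.op .lt (.var 11) (.var 26)) (.op .lt (.var 26) (.var 12)))
      (f := neg (.op .eq (.arr 3 (.var 4) (.op .add (.var 26) (.lit 3))) (.lit 1)))
    rw [eval_neg hP.two, eval_bit hP hA hv'.vertex h26 hk.le, eval_conj (f := op _ _ _),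
      eval_lt_iff hP.two, eval_lt_iff hP.two, eval_var hv'.fst, eval_var h26,
      eval_var hv'.snd] at hiff
    by_cases hc : (D u 1 < k ∧ k < D u 2) ∧ D u (k + 3) ≠ 1
    · rw [eval_ite_pos (hiff.2 hc), if_pos hc, eval_lit (hP.lt_word (by omega))]
    · rw [eval_ite_neg (fun h => hc (hiff.1 h)), if_neg hc, eval_lit (hP.lt_word (by omega))]
  · rw [← Finset.card_filter]
    refine hP.lt_word (le_trans (Finset.card_filter_le _ _) ?_)
    rw [Finset.card_range]; omega

end

end Expr

/-! ## Carries -/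

/-- The carry into position `j`, for digits `f` in base two. -/
def carry (f : ℕ → ℕ) (j : ℕ) : ℕ := iter (fun k r => (r + f k) / 2) 0 j

/-- The `j`-th bit, for digits `f` in base two. -/
def bit (f : ℕ → ℕ) (j : ℕ) : ℕ := (carry f j + f j) % 2

theorem carry_succ (f : ℕ → ℕ) (j : ℕ) : carry f (j + 1) = (carry f j + f j) / 2 := rfl

theorem carry_le {f : ℕ → ℕ} {M J : ℕ} (h : ∀ j < J, f j ≤ M) : carry f J ≤ M := by
  induction J with
  | zero => exact Nat.zero_le _
  | succ J ih =>
    have := ih fun j hj => h j (by omega)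
    have := h J (by omega)
    rw [carry_succ]; omega

theorem sum_bit (f : ℕ → ℕ) (J : ℕ) :
    ∑ j ∈ Finset.range J, bit f j * 2 ^ j + carry f J * 2 ^ J =
      ∑ j ∈ Finset.range J, f j * 2 ^ j := by
  induction J with
  | zero => simp [carry, iter]
  | succ J ih =>
    rw [Finset.sum_range_succ, Finset.sum_range_succ, ← ih, carry_succ, bit, pow_succ]
    have := Nat.div_add_mod (carry f J + f J) 2
    generalize (carry f J + f J) / 2 = a at *
    generalize (carry f J + f J) % 2 = b at *
    have h : (2 * a + b) * 2 ^ J = (carry f J + f J) * 2 ^ J := by rw [this]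
    nlinarith

/-- The number with the digits `f` in base two, modulo `2 ^ N`. -/
def rowVal (N : ℕ) (f : ℕ → ℕ) : ZMod (2 ^ N) := ((∑ j ∈ Finset.range N, f j * 2 ^ j : ℕ) : ZMod _)

theorem rowVal_congr {N : ℕ} {f g : ℕ → ℕ} (h : ∀ j < N, f j = g j) : rowVal N f = rowVal N g := by
  unfold rowVal
  congr 1
  exact Finset.sum_congr rfl fun j hj => by rw [h j (Finset.mem_range.1 hj)]

theorem rowVal_bit (N : ℕ) (f : ℕ → ℕ) : rowVal N (bit f) = rowVal N f := by
  unfold rowVal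
  rw [← sum_bit f N]
  push_cast
  have : (2 : ZMod (2 ^ N)) ^ N = 0 := by
    have := ZMod.natCast_self (2 ^ N)
    push_cast at this
    exact this
  rw [this]; ring

theorem two_pow_eq_zero {N j : ℕ} (h : N ≤ j) : (2 : ZMod (2 ^ N)) ^ j = 0 := by
  have := ZMod.natCast_self (2 ^ N)
  push_cast at this
  exact pow_eq_zero_of_le h this

theorem rowVal_eq (N : ℕ) (f : ℕ → ℕ) :
    rowVal N f = ∑ j ∈ Finset.range N, (f j : ZMod (2 ^ N)) * 2 ^ j := by
  unfold rowVal
  push_cast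
  rfl

theorem rowVal_add (N : ℕ) (f g : ℕ → ℕ) :
    rowVal N (fun j => f j + g j) = rowVal N f + rowVal N g := by
  simp only [rowVal_eq, Nat.cast_add, add_mul, Finset.sum_add_distrib]

theorem rowVal_zero (N : ℕ) : rowVal N (fun _ => 0) = 0 := by
  simp [rowVal]

theorem rowVal_single (N e : ℕ) : rowVal N (fun j => if j = e then 1 else 0) = 2 ^ e := by
  rw [rowVal_eq]
  by_cases h : e < N
  · rw [Finset.sum_eq_single e] <;> simp +contextual [h]
  · rw [two_pow_eq_zero (by omega)]
    refine Finset.sum_eq_zero fun j hj => ?_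
    have := Finset.mem_range.1 hj
    rw [if_neg (by omega)]; simp

theorem rowVal_neg (N e : ℕ) : rowVal N (fun j => if j < e then 0 else 1) = -2 ^ e := by
  rw [eq_neg_iff_add_eq_zero, ← rowVal_single, ← rowVal_add, ← rowVal_bit]
  have hc : ∀ j, carry (fun j => (if j < e then 0 else 1) + if j = e then 1 else 0) j =
      if j ≤ e then 0 else 1 := by
    intro j
    induction j with
    | zero => simp [carry, iter]
    | succ j ih => rw [carry_succ, ih]; split_ifs <;> omega
  refine (rowVal_congr fun j _ => ?_).trans (rowVal_zero N)
  rw [bit, hc]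
  split_ifs <;> omega

theorem rowVal_mul (N : ℕ) (f g : ℕ → ℕ) :
    rowVal N (fun j => ∑ i ∈ Finset.range (j + 1), f i * g (j - i)) = rowVal N f * rowVal N g := by
  simp only [rowVal_eq]
  rw [Finset.sum_mul_sum, ← Finset.sum_product', ← Finset.sum_filter_add_sum_filter_not
    (Finset.range N ×ˢ Finset.range N) (fun p => p.1 + p.2 < N),
    Finset.sum_eq_zero (s := Finset.filter (fun p => ¬ _) _), add_zero]
  · push_cast
    simp only [Finset.sum_mul]
    rw [Finset.sum_sigma']
    refine Finset.sum_nbij' (fun p => (p.2, p.1 - p.2)) (fun p => ⟨p.1 + p.2, p.1⟩) ?_ ?_ ?_ ?_ ?_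
    · rintro ⟨a, b⟩ h; simp at h ⊢; omega
    · rintro ⟨a, b⟩ h; simp at h ⊢; omega
    · rintro ⟨a, b⟩ h; simp at h ⊢; omega
    · rintro ⟨a, b⟩ h; simp at h ⊢
    · rintro ⟨a, b⟩ h
      simp at h ⊢
      rw [mul_mul_mul_comm, ← pow_add, show b + (a - b) = a by omega]
  · rintro ⟨a, b⟩ h
    simp at h
    rw [mul_mul_mul_comm, ← pow_add, two_pow_eq_zero h.2, mul_zero]

/-! ## Mixed radix increment -/

theorem forall_digit_add_one_eq {r : ℕ → ℕ} (hr : ∀ j, 0 < r j) (m J : ℕ) :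
    (∀ j < J, digit r m j + 1 = r j) ↔ m % (∏ i ∈ Finset.range J, r i) + 1 =
      ∏ i ∈ Finset.range J, r i := by
  induction J with
  | zero => simp [Nat.mod_one]
  | succ J ih =>
    have hP : 0 < ∏ i ∈ Finset.range J, r i := Finset.prod_pos fun i _ => hr i
    have h1 : (∀ j < J + 1, digit r m j + 1 = r j) ↔
        (∀ j < J, digit r m j + 1 = r j) ∧ digit r m J + 1 = r J :=
      ⟨fun h => ⟨fun j hj => h j (by omega), h J (by omega)⟩, fun h j hj => by
        rcases Nat.lt_succ_iff_lt_or_eq.1 hj with h' | rfl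
        exacts [h.1 j h', h.2]⟩
    rw [h1, ih, Finset.prod_range_succ, Nat.mod_mul, ← digit]
    have h2 := Nat.mod_lt m hP
    have h3 := digit_lt hr m J
    generalize (∏ i ∈ Finset.range J, r i) = P at *
    generalize m % P = x at *
    generalize digit r m J = y at *
    constructor
    · rintro ⟨h4, h5⟩
      rw [← h5, mul_add, mul_one, ← h4]; ring
    · intro h
      have : r J ≤ y + 1 := by
        by_contra hc
        have : P * (y + 2) ≤ P * r J := Nat.mul_le_mul_left _ (by omega)
        nlinarith
      have h5 : y + 1 = r J := by omega
      refine ⟨?_, h5⟩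
      rw [← h5] at h
      nlinarith

theorem digit_succ {r : ℕ → ℕ} (hr : ∀ j, 0 < r j) (m j : ℕ) [Decidable (∀ i < j, digit r m i + 1 = r i)] :
    digit r (m + 1) j = if ∀ i < j, digit r m i + 1 = r i then (digit r m j + 1) % r j
      else digit r m j := by
  have hP : 0 < ∏ i ∈ Finset.range j, r i := Finset.prod_pos fun i _ => hr i
  have h := forall_digit_add_one_eq hr m j
  unfold digit at *
  rw [Nat.succ_div]
  have hd : (∏ i ∈ Finset.range j, r i) ∣ m + 1 ↔
      m % (∏ i ∈ Finset.range j, r i) + 1 = ∏ i ∈ Finset.range j, r i := by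
    have h2 := Nat.mod_lt m hP
    rw [Nat.dvd_iff_mod_eq_zero, Nat.add_mod]
    constructor
    · intro h3
      by_contra hc
      by_cases h1 : (∏ i ∈ Finset.range j, r i) = 1
      · rw [h1] at h2 hc; omega
      · rw [Nat.mod_eq_of_lt (a := 1) (by omega), Nat.mod_eq_of_lt (by omega)] at h3; omega
    · intro h3
      rw [← Nat.add_mod, ← Nat.dvd_iff_mod_eq_zero]
      refine ⟨m / (∏ i ∈ Finset.range j, r i) + 1, ?_⟩
      have := Nat.div_add_mod m (∏ i ∈ Finset.range j, r i)
      rw [mul_add]; omega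
  by_cases hc : ∀ i < j, m / (∏ k ∈ Finset.range i, r k) % r i + 1 = r i
  · rw [if_pos hc, if_pos (hd.2 (h.1 hc)), Nat.mod_add_mod]
  · rw [if_neg hc, if_neg fun h' => hc (h.2 (hd.1 h')), add_zero]

end WordRAM

/-! ## The step of the iteration -/

namespace WordRAM

/-- Whether the expression does not mention the array `a`. -/
def Expr.avoids (a : Fin 8) : Expr → Bool
  | .lit _ => true
  | .var _ => true
  | .arr b i j => decide (b ≠ a) && i.avoids a && j.avoids a
  | .op _ e f => e.avoids a && f.avoids a
  | .ite c e f => c.avoids a && e.avoids a && f.avoids a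
  | .fold _ _ b e f => b.avoids a && e.avoids a && f.avoids a

theorem Expr.eval_avoids {w N : ℕ} {a : Fin 8} {A A' : Fin 8 → ℕ → ℕ → ℕ}
    (h : ∀ b ≠ a, A' b = A b) (e : Expr) (he : e.avoids a = true) :
    ∀ v, e.eval w N A' v = e.eval w N A v := by
  induction e with
  | lit _ => exact fun _ => rfl
  | var _ => exact fun _ => rfl
  | arr b i j hi hj =>
    intro v
    simp only [avoids, Bool.and_eq_true, decide_eq_true_eq] at he
    simp only [eval, hi he.1.2, hj he.2, h b he.1.1]
  | op o e f h1 h2 =>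
    intro v
    simp only [avoids, Bool.and_eq_true] at he
    simp only [eval, h1 he.1, h2 he.2]
  | ite c e f h1 h2 h3 =>
    intro v
    simp only [avoids, Bool.and_eq_true] at he
    simp only [eval, h1 he.1.1, h2 he.1.2, h3 he.2]
  | fold i x b e f h1 h2 h3 =>
    intro v
    simp only [avoids, Bool.and_eq_true] at he
    simp only [eval, h1 he.1.1, h2 he.1.2, h3 he.2]

namespace Cmd

/-- Fill the array `a` with the values of `e`, for the positions in the variables `30` and `31`. -/
def fill (a : Fin 8) (e : Expr) : Cmd :=
  .forRange 30 (.var 5) (.forRange 31 (.var 5) (.store a (.var 30) (.var 31) e))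

/-- Fill the array `a`, by means of the array `6`. -/
def setArray (a : Fin 8) (e : Expr) : Cmd :=
  .seq (fill 6 e) (fill a (.arr 6 (.var 30) (.var 31)))

variable {w N : ℕ}

/-- `τ` differs from `σ` only in the variables `30`, `31` and the arrays in `s`. -/
structure Frame (s : Set (Fin 8)) (σ τ : St) : Prop where
  var : ∀ x, x ≠ 30 → x ≠ 31 → τ.var x = σ.var x
  arr : ∀ b, b ∉ s → τ.arr b = σ.arr b
  input : τ.input = σ.input
  output : τ.output = σ.output

theorem Frame.refl (s : Set (Fin 8)) (σ : St) : Frame s σ σ :=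
  ⟨fun _ _ _ => rfl, fun _ _ => rfl, rfl, rfl⟩

theorem Frame.trans {s t : Set (Fin 8)} {σ τ ρ : St} (h : Frame s σ τ) (h' : Frame t τ ρ) :
    Frame (s ∪ t) σ ρ :=
  ⟨fun x h1 h2 => (h'.var x h1 h2).trans (h.var x h1 h2),
    fun b hb => (h'.arr b fun hh => hb (Or.inr hh)).trans (h.arr b fun hh => hb (Or.inl hh)),
    h'.input.trans h.input, h'.output.trans h.output⟩

theorem Frame.mono {s t : Set (Fin 8)} (hst : s ⊆ t) {σ τ : St} (h : Frame s σ τ) : Frame t σ τ :=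
  ⟨h.var, fun b hb => h.arr b fun hh => hb (hst hh), h.input, h.output⟩

theorem run_fill {a : Fin 8} {e : Expr} (he : e.avoids a = true) {σ : St} (h5 : σ.var 5 = N) :
    Frame {a} σ ((fill a e).run w N σ) ∧ ∀ i < N, ∀ j < N, ((fill a e).run w N σ).arr a i j =
      e.eval w N σ.arr (Function.update (Function.update σ.var 30 i) 31 j) := by
  set g : ℕ → ℕ → ℕ := fun i j =>
    e.eval w N σ.arr (Function.update (Function.update σ.var 30 i) 31 j) with hg
  simp only [fill, Cmd.run, Expr.eval, h5, min_self]
  have key := iter_induction (a := σ) (f := fun k (τ : St) =>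
      (Cmd.forRange 31 (.var 5) (.store a (.var 30) (.var 31) e)).run w N
        { τ with var := Function.update τ.var 30 k })
    (fun k τ => Frame {a} σ τ ∧ ∀ i < k, ∀ j < N, τ.arr a i j = g i j) N
    ⟨.refl _ _, fun i hi => absurd hi (Nat.not_lt_zero _)⟩ ?_
  · exact key
  rintro i hi τ ⟨hF, hA⟩
  have h5' : (Function.update τ.var 30 i) 5 = N := by
    rw [Function.update_of_ne (by omega), hF.var 5 (by omega) (by omega), h5]
  simp only [Cmd.run, Expr.eval, h5', min_self]
  have key := iter_induction (a := ({ τ with var := Function.update τ.var 30 i } : St))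
    (f := fun k (ρ : St) =>
      (Cmd.store a (.var 30) (.var 31) e).run w N { ρ with var := Function.update ρ.var 31 k })
    (fun k ρ => Frame {a} σ ρ ∧ ρ.var 30 = i ∧ (∀ i' < i, ∀ j < N, ρ.arr a i' j = g i' j) ∧
      ∀ j < k, ρ.arr a i j = g i j) N
    ⟨⟨fun x h1 h2 => by simp [Function.update_of_ne h1, hF.var x h1 h2], hF.arr, hF.input,
      hF.output⟩, by simp, hA, fun j hj => absurd hj (Nat.not_lt_zero _)⟩ ?_
  · simp only [Cmd.run, Expr.eval] at key
    refine ⟨key.1, fun i' hi' j hj => ?_⟩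
    rcases Nat.lt_succ_iff_lt_or_eq.1 hi' with h' | rfl
    · exact key.2.2.1 i' h' j hj
    · exact key.2.2.2 j hj
  rintro j hj ρ ⟨h1, h2, h3, h4⟩
  have hv : Function.update ρ.var 31 j = Function.update (Function.update σ.var 30 i) 31 j := by
    funext x
    by_cases h31 : x = 31
    · simp [h31]
    · by_cases h30 : x = 30
      · simp [h30, h2]
      · simp [h31, h30, h1.var x h30 h31]
  have heval : e.eval w N ρ.arr (Function.update ρ.var 31 j) = g i j := by
    rw [hv]
    exact e.eval_avoids (fun b hb => h1.arr b hb) he _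
  have e30 : Function.update ρ.var 31 j 30 = i := by simp [h2]
  have e31 : Function.update ρ.var 31 j 31 = j := by simp
  simp only [Cmd.run, Expr.eval, e30, e31, hi, hj, and_self, if_true, heval]
  refine ⟨⟨fun x h30 h31 => ?_, fun b hb => ?_, h1.input, h1.output⟩, trivial, fun i' hi' j' hj' => ?_,
    fun j' hj' => ?_⟩
  · simp [Function.update_of_ne h31, h1.var x h30 h31]
  · show Function.update ρ.arr a _ b = _
    rw [Function.update_of_ne hb, h1.arr b hb]
  · simp [Function.update_of_ne (show i' ≠ i by omega), h3 i' hi' j' hj']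
  · simp only [Function.update_self]
    rcases Nat.lt_succ_iff_lt_or_eq.1 hj' with h' | rfl
    · rw [Function.update_of_ne (by omega), h4 j' h']
    · rw [Function.update_self]

theorem run_setArray {a : Fin 8} (ha : a ≠ 6) {e : Expr} (he : e.avoids 6 = true) {σ : St}
    (h5 : σ.var 5 = N) :
    Frame {a, 6} σ ((setArray a e).run w N σ) ∧
      ∀ i < N, ∀ j < N, ((setArray a e).run w N σ).arr a i j =
        e.eval w N σ.arr (Function.update (Function.update σ.var 30 i) 31 j) := by
  obtain ⟨h1, h2⟩ := run_fill (w := w) he h5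
  set τ := (fill 6 e).run w N σ
  obtain ⟨h3, h4⟩ := run_fill (w := w) (a := a) (e := .arr 6 (.var 30) (.var 31)) (σ := τ) (N := N)
    (by simp [Expr.avoids, ha.symm]) (by rw [h1.var 5 (by omega) (by omega), h5])
  refine ⟨(h1.trans h3).mono (by rintro x (h | h) <;> simp_all), fun i hi j hj => ?_⟩
  refine (h4 i hi j hj).trans ?_
  rw [← h2 i hi j hj]
  simp [Expr.eval, hi, hj]

end Cmd

namespace Expr

/-- The bit at the position in the variable `31` of the number with the digits `col`. -/
def bitOf (col : ℕ → Expr) : Expr :=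
  .op .mod (.op .add (.fold 32 33 (.var 31) (.lit 0)
    (.op .div (.op .add (.var 33) (col 32)) (.lit 2))) (col 31)) (.lit 2)

/-- The digits of the product of the array `5` with a row of the array `4`. -/
def productDigit (x : ℕ) : Expr :=
  .sum 34 35 (.op .add (.var x) (.lit 1))
    (.op .mul (.arr 5 (.lit 0) (.var 34)) (.arr 4 (.var 28) (.op .sub (.var x) (.var 34))))

/-- The digits of the sum of the array `5` and a row of the array `4`. -/
def sumDigit (x : ℕ) : Expr :=
  .op .add (.arr 4 (.var 4) (.var x)) (.arr 5 (.lit 0) (.var x))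

/-- The bits of the weight of the current choice. -/
def weightBit : Expr :=
  .ite (.var 14)
    (.ite (.var 15)
      (.ite (.op .lt (.var 31) (.op .mul (.var 2) (.op .sub (.var 12) (.var 11)))) (.lit 0) (.lit 1))
      (.op .eq (.var 31) (.op .mul (.var 2) (.op .sub (.var 12) (.var 11)))))
    (.lit 0)

/-- The radix of the digit at the position in the variable `x`. -/
def radix (x : ℕ) : Expr :=
  .ite (.var x) (.ite (.op .lt (.var x) (.lit 3)) (.op .add (.var 1) (.lit 1)) (.lit 2)) (depth 4)

/-- Whether all digits below the position `e` are maximal. -/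
def maximalBelow (e : Expr) : Expr :=
  .all 36 37 e (.op .eq (.op .add (.arr 3 (.var 4) (.var 36)) (.lit 1)) (radix 36))

/-- The digit of the next choice. -/
def nextDigit : Expr :=
  .ite (conj (.op .lt (.var 31) (.op .add (.var 1) (.lit 3))) (maximalBelow (.var 31)))
    (.op .mod (.op .add (.arr 3 (.var 4) (.var 31)) (.lit 1)) (radix 31))
    (.arr 3 (.var 4) (.var 31))

/-- Use `e` for the current vertex, and reset its proper descendants unless it is finished. -/
def updated (a : Fin 8) (e : Expr) : Expr :=
  .ite (.op .eq (.var 30) (.var 4)) e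
    (.ite (conj (neg (.var 16)) (.arr 1 (.var 4) (.var 30))) (.lit 0)
      (.arr a (.var 30) (.var 31)))

/-- Whether the vertex in the variable `28` is a child of the current vertex. -/
def isChild : Expr :=
  conj (.arr 1 (.var 4) (.var 28)) (.op .eq (depth 28) (.op .add (depth 4) (.lit 1)))

/-- Whether the vertex in the variable `36` is the next one. -/
def isReady : Expr :=
  conj (neg (.arr 2 (.var 36) (.lit 0)))
    (.all 38 39 (.var 0) (imp (conj (.arr 1 (.var 36) (.var 38)) (neg (.op .eq (.var 38) (.var 36))))
      (.arr 2 (.var 38) (.lit 0))))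

section

variable {w N n d : ℕ} {G : SimpleGraph (Fin n)} {T : RootedForest (Fin n)} {D : Fin n → ℕ → ℕ}
  {A : Fin 8 → ℕ → ℕ → ℕ} {v : ℕ → ℕ}

theorem eval_bitOf (hP : Params w N n d) {col : ℕ → Expr} {f : ℕ → ℕ} {j : ℕ} (h31 : v 31 = j)
    (hj : j < N) (hf : ∀ k ≤ j, f k ≤ N)
    (h1 : ∀ k ≤ j, ∀ r,
      (col 32).eval w N A (Function.update (Function.update v 32 k) 33 r) = f k)
    (h2 : (col 31).eval w N A v = f j) : (bitOf col).eval w N A v = bit f j := by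
  have h8 := hP.eight
  have hcarry : (fold 32 33 (.var 31) (.lit 0)
      (.op .div (.op .add (.var 33) (col 32)) (.lit 2))).eval w N A v = carry f j := by
    refine eval_fold_induction (fun k r => r = carry f k) (eval_var h31) hj.le
      (eval_lit (hP.lt_word (by omega))) fun k hk r hr => ?_
    have hle : carry f k ≤ N := carry_le fun i hi => hf i (by omega)
    have := hf k hk.le
    rw [carry_succ]
    exact eval_div (eval_add (eval_var (by simp [hr])) (h1 k hk.le r) (hP.lt_word (by omega)))
      (eval_lit (hP.lt_word (by omega))) (hP.lt_word (by omega))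
  have hle : carry f j ≤ N := carry_le fun i hi => hf i (by omega)
  have := hf j le_rfl
  exact eval_mod (eval_add hcarry h2 (hP.lt_word (by omega)))
    (eval_lit (hP.lt_word (by omega))) (hP.lt_word (by omega))

theorem eval_productDigit (hP : Params w N n d) {x : ℕ} (hx34 : x ≠ 34) (hx35 : x ≠ 35) {j : ℕ}
    (hx : v x = j) (hj : j < N) {z : ℕ} (h28 : v 28 = z) (hz : z < N)
    (h5 : ∀ j < N, A 5 0 j ≤ 1) (h4 : ∀ j < N, A 4 z j ≤ 1) :
    (productDigit x).eval w N A v = ∑ i ∈ Finset.range (j + 1), A 5 0 i * A 4 z (j - i) ∧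
      ∑ i ∈ Finset.range (j + 1), A 5 0 i * A 4 z (j - i) ≤ N := by
  have h8 := hP.eight
  have hle : ∀ i < j + 1, A 5 0 i * A 4 z (j - i) ≤ 1 := fun i hi =>
    Nat.mul_le_mul (h5 i (by omega)) (h4 (j - i) (by omega))
  have hsum : ∑ i ∈ Finset.range (j + 1), A 5 0 i * A 4 z (j - i) ≤ N := by
    refine (Finset.sum_le_card_nsmul _ _ 1 fun i hi => hle i (Finset.mem_range.1 hi)).trans ?_
    simp; omega
  refine ⟨eval_sum _ (eval_add (eval_var hx) (eval_lit (hP.lt_word (by omega)))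
    (hP.lt_word (by omega))) (by omega) (fun k hk r => ?_) (hP.lt_word (by omega)), hsum⟩
  have hxv : Function.update (Function.update v 34 k) 35 r x = j := by
    rw [Function.update_of_ne hx35, Function.update_of_ne hx34, hx]
  have := hle k hk
  exact eval_mul (eval_arr (eval_lit (hP.lt_word (by omega))) (eval_var (by simp)) (by omega)
    (by omega)) (eval_arr (eval_var (by simp [h28])) (eval_sub (eval_var hxv) (eval_var (by simp))
    (hP.lt_word (by omega)) (by omega)) hz (by omega)) (hP.lt_word (by omega))

theorem eval_sumDigit (hP : Params w N n d) {x : ℕ} {j : ℕ} (hx : v x = j) (hj : j < N) {u : ℕ}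
    (h4 : v 4 = u) (hu : u < N) (h5 : A 5 0 j ≤ 1) (h4' : A 4 u j ≤ 1) :
    (sumDigit x).eval w N A v = A 4 u j + A 5 0 j := by
  have h8 := hP.eight
  exact eval_add (eval_arr (eval_var h4) (eval_var hx) hu hj)
    (eval_arr (eval_lit (hP.lt_word (by omega))) (eval_var hx) (by omega) hj)
    (hP.lt_word (by omega))

theorem eval_radix (hP : Params w N n d) (hA : Tables d G T D A) (h0 : v 0 = n) (h1 : v 1 = d)
    {u : Fin n} (h4 : v 4 = u) {x j : ℕ} (hx : v x = j) : (radix x).eval w N A v = T.radix d u j := by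
  have h8 := hP.eight
  have hd := hP.le
  rw [RootedForest.radix]
  by_cases hj : j = 0
  · rw [if_pos hj, radix, eval_ite_neg (by rw [eval_var hx]; simpa using hj)]
    exact eval_depth hP hA h0 (by omega) (by omega) h4
  · rw [if_neg hj, radix, eval_ite_pos (by rw [eval_var hx]; exact hj)]
    have hlt := eval_lt_iff (N := N) (A := A) (v := v) hP.two (e := var x) (f := lit 3)
    rw [eval_var hx, eval_lit (hP.lt_word (by omega))] at hlt
    by_cases h3 : j < 3
    · rw [eval_ite_pos (hlt.2 h3), if_pos (by omega)]
      exact eval_add (eval_var h1) (eval_lit (hP.lt_word (by omega))) (hP.lt_word (by omega))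
    · rw [eval_ite_neg (fun h => h3 (hlt.1 h)), if_neg (by omega)]
      exact eval_lit (hP.lt_word (by omega))

variable {c : Fin n → ℕ}

theorem eval_digit_add_one (hP : Params w N n d) (hA : Tables d G T (T.digits d c) A)
    {u : Fin n} (h4 : v 4 = u) {x j : ℕ} (hx : v x = j) (hj : j < d + 3) :
    (op .add (arr 3 (var 4) (var x)) (lit 1)).eval w N A v = digit (T.radix d u) (c u) j + 1 ∧
      digit (T.radix d u) (c u) j + 1 < 2 ^ w := by
  have h8 := hP.eight
  have hd := hP.le
  have h1 : digit (T.radix d u) (c u) j < T.radix d u j := digit_lt (T.radix_pos d u) _ _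
  have h2 : T.radix d u j ≤ n + 2 := by
    have := T.depthAt_le_card u
    rw [Fintype.card_fin] at this
    unfold RootedForest.radix
    split_ifs <;> omega
  have h3 : digit (T.radix d u) (c u) j + 1 < 2 ^ w := hP.lt_word (by omega)
  have h5 := eval_table (A := A) (a := 3) hP h4 (eval_var (w := w) (N := N) (A := A) hx) (by omega)
  rw [hA.dig u j (by omega)] at h5
  exact ⟨eval_add h5 (eval_lit (hP.lt_word (by omega))) h3, h3⟩

theorem eval_maximalBelow (hP : Params w N n d) (hA : Tables d G T (T.digits d c) A) (h0 : v 0 = n)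
    (h1 : v 1 = d) {u : Fin n} (h4 : v 4 = u) {e : Expr} {m : ℕ} (he : e.eval w N A v = m)
    (hm : m ≤ d + 3) : (maximalBelow e).eval w N A v ≠ 0 ↔
      ∀ j < m, digit (T.radix d u) (c u) j + 1 = T.radix d u j := by
  have h8 := hP.eight
  have hd := hP.le
  refine eval_all hP.two _ he (by omega) fun k hk r => ?_
  rw [eval_eq_iff hP.two, (eval_digit_add_one hP hA (u := u) (j := k) (by simpa using h4) (by simp)
    (by omega)).1, eval_radix hP hA (j := k) (by simpa using h0) (by simpa using h1)
    (by simpa using h4) (by simp)]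

theorem eval_overflow (hP : Params w N n d) (hA : Tables d G T (T.digits d c) A) (h0 : v 0 = n)
    (h1 : v 1 = d) {u : Fin n} (h4 : v 4 = u) (hc : c u < T.numChoices d u) :
    (maximalBelow (.op .add (.var 1) (.lit 3))).eval w N A v ≠ 0 ↔
      c u + 1 = T.numChoices d u := by
  have h8 := hP.eight
  have hd := hP.le
  rw [eval_maximalBelow hP hA h0 h1 h4 (eval_add (eval_var h1) (eval_lit (hP.lt_word (by omega)))
    (hP.lt_word (by omega))) le_rfl, forall_digit_add_one_eq (T.radix_pos d u),
    ← RootedForest.numChoices, Nat.mod_eq_of_lt hc]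

theorem digit_zero (r : ℕ → ℕ) (j : ℕ) : digit r 0 j = 0 := by simp [digit]

theorem eval_nextDigit (hP : Params w N n d) (hA : Tables d G T (T.digits d c) A) (h0 : v 0 = n)
    (h1 : v 1 = d) {u : Fin n} (h4 : v 4 = u) (hc : c u < T.numChoices d u) {j : ℕ}
    (h31 : v 31 = j) (hj : j < d + 4) : nextDigit.eval w N A v =
      digit (T.radix d u) (if c u + 1 = T.numChoices d u then 0 else c u + 1) j := by
  have h8 := hP.eight
  have hd := hP.le
  have harr := eval_table (A := A) (a := 3) hP h4 (eval_var (w := w) (N := N) (A := A) h31)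
    (by omega)
  rw [hA.dig u j hj] at harr
  have hlt := eval_lt_iff (w := w) (N := N) (A := A) (v := v) hP.two (e := var 31)
    (f := .op .add (.var 1) (.lit 3))
  rw [eval_var h31, eval_add (eval_var h1) (eval_lit (hP.lt_word (by omega)))
    (hP.lt_word (by omega))] at hlt
  by_cases hj3 : j < d + 3
  · have hmax := eval_maximalBelow hP hA h0 h1 h4 (eval_var (w := w) (N := N) (A := A) h31) hj3.le
    have hcond := eval_conj (w := w) (N := N) (A := A) (v := v)
      (e := op .lt (.var 31) (.op .add (.var 1) (.lit 3))) (f := maximalBelow (.var 31))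
    rw [hlt, hmax] at hcond
    have h5 := digit_lt (T.radix_pos d u) (c u) j
    have hval : nextDigit.eval w N A v = digit (T.radix d u) (c u + 1) j := by
      classical
      rw [digit_succ (T.radix_pos d u)]
      by_cases hm : ∀ i < j, digit (T.radix d u) (c u) i + 1 = T.radix d u i
      · rw [nextDigit, eval_ite_pos (hcond.2 ⟨hj3, hm⟩), if_pos hm]
        obtain ⟨h6, h7⟩ := eval_digit_add_one hP hA h4 h31 hj3
        exact eval_mod h6 (eval_radix hP hA h0 h1 h4 h31) h7
      · rw [nextDigit, eval_ite_neg (fun h => hm (hcond.1 h).2), if_neg hm, harr]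
        rfl
    rw [hval]
    split_ifs with hB
    · classical
      have hm := (forall_digit_add_one_eq (T.radix_pos d u) (c u) (d + 3)).2 (by
        rw [← RootedForest.numChoices, Nat.mod_eq_of_lt hc, hB])
      rw [digit_succ (T.radix_pos d u), if_pos fun i hi => hm i (by omega), hm j hj3, Nat.mod_self,
        digit_zero]
    · rfl
  · have hcond : ¬ (conj (op .lt (.var 31) (.op .add (.var 1) (.lit 3)))
        (maximalBelow (.var 31))).eval w N A v ≠ 0 := by
      rw [eval_conj, hlt]
      exact fun h => hj3 h.1
    rw [nextDigit, eval_ite_neg hcond, harr]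
    refine (digit_eq_zero (T.radix_pos d u) hc (by omega)).trans ?_
    symm
    split_ifs with hB
    · exact digit_zero _ _
    · refine digit_eq_zero (T.radix_pos d u) (J := d + 3) ?_ (by omega)
      rw [← RootedForest.numChoices]; omega

theorem eval_updated (hP : Params w N n d) (hA : Tables d G T D A) {u z : Fin n} (h4 : v 4 = u)
    (h30 : v 30 = z) {j : ℕ} (h31 : v 31 = j) (hj : j < N) (a : Fin 8) (e : Expr) :
    (z = u → (updated a e).eval w N A v = e.eval w N A v) ∧
    (z ≠ u → v 16 = 0 → T.anc u z → (updated a e).eval w N A v = 0) ∧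
    (z ≠ u → ¬ (v 16 = 0 ∧ T.anc u z) → (updated a e).eval w N A v = A a z j) := by
  have h8 := hP.eight
  have heq := eval_eq_iff (N := N) (A := A) (v := v) hP.two (e := var 30) (f := var 4)
  rw [eval_var h30, eval_var h4, ← Fin.ext_iff] at heq
  have hcond := eval_conj (w := w) (N := N) (A := A) (v := v)
    (e := neg (.var 16)) (f := .arr 1 (.var 4) (.var 30))
  rw [eval_neg hP.two, eval_table hP h4 (eval_var h30) (by omega), hA.anc, eval_var rfl,
    not_not] at hcond
  simp only [ne_eq, ite_eq_right_iff, one_ne_zero, imp_false, not_not] at hcond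
  refine ⟨fun h => ?_, fun h h1 h2 => ?_, fun h h1 => ?_⟩
  · rw [updated, eval_ite_pos (heq.2 h)]
  · rw [updated, eval_ite_neg fun h' => h (heq.1 h'), eval_ite_pos (hcond.2 ⟨h1, h2⟩),
      eval_lit (hP.lt_word (by omega))]
  · rw [updated, eval_ite_neg fun h' => h (heq.1 h'), eval_ite_neg fun h' => h1 (hcond.1 h'),
      eval_table hP h30 (eval_var h31) hj]

theorem eval_isChild (hP : Params w N n d) (hA : Tables d G T D A) (h0 : v 0 = n) {u z : Fin n}
    (h4 : v 4 = u) (h28 : v 28 = z) : isChild.eval w N A v ≠ 0 ↔ z ∈ T.childFinset u := by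
  have h8 := hP.eight
  have := T.depthAt_le_card u
  rw [Fintype.card_fin] at this
  rw [isChild, eval_conj, eval_eq_iff hP.two, eval_table hP h4 (eval_var h28) (by omega), hA.anc,
    eval_depth hP hA h0 (by omega) (by omega) h28,
    eval_add (eval_depth hP hA h0 (by omega) (by omega) h4) (eval_lit (hP.lt_word (by omega)))
      (hP.lt_word (by omega)), RootedForest.mem_childFinset]
  simp

theorem eval_isReady (hP : Params w N n d) (hA : Tables d G T D A) (h0 : v 0 = n) {u : Fin n}
    (h36 : v 36 = u) : isReady.eval w N A v ≠ 0 ↔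
      A 2 u 0 = 0 ∧ ∀ z : Fin n, T.anc u z → z ≠ u → A 2 z 0 ≠ 0 := by
  have h8 := hP.eight
  have hz : ∀ v', (lit 0).eval w N A v' = 0 := fun v' => eval_lit (hP.lt_word (by omega))
  rw [isReady, eval_conj, eval_neg hP.two, eval_table hP h36 (hz _) (by omega), not_not,
    eval_all hP.two (fun k => ∀ z : Fin n, (z : ℕ) = k → T.anc u z → z ≠ u → A 2 z 0 ≠ 0)
      (eval_var h0) hP.nN.le]
  · exact and_congr_right fun _ => ⟨fun h z => h z z.isLt z rfl, fun h k _ z _ => h z⟩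
  intro k hk r
  obtain ⟨z, rfl⟩ : ∃ z : Fin n, (z : ℕ) = k := ⟨⟨k, hk⟩, rfl⟩
  have e36 : Function.update (Function.update v 38 z) 39 r 36 = u := by simpa using h36
  have e38 : Function.update (Function.update v 38 z) 39 r 38 = z := by simp
  rw [eval_imp hP.two, eval_conj, eval_neg hP.two, eval_eq_iff hP.two, eval_var e38, eval_var e36,
    eval_table hP e36 (eval_var e38) (by omega), hA.anc, eval_table hP e38 (hz _) (by omega),
    ← Fin.ext_iff]
  simp only [ne_eq, ite_eq_right_iff, one_ne_zero, imp_false, not_not]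
  constructor
  · intro h y hy h1 h2
    obtain rfl : y = z := Fin.ext hy
    exact h ⟨h1, h2⟩
  · exact fun h h1 => h z rfl h1.1 h1.2

end

end Expr

end WordRAM

namespace WordRAM

open RootedForest

namespace Cmd

/-- Load the choice of the current vertex into variables. -/
def loadChoice : Cmd :=
  .seq (.assign 10 (.att 4)) <| .seq (.assign 11 (.arr 3 (.var 4) (.lit 1))) <|
    .seq (.assign 12 (.arr 3 (.var 4) (.lit 2))) <| .seq (.assign 13 (.arr 3 (.var 4) (.lit 0))) <|
    .seq (.assign 14 .valid) <| .seq (.assign 15 (.op .mod .forbidden (.lit 2))) <|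
    .assign 16 (.maximalBelow (.op .add (.var 1) (.lit 3)))

/-- Multiply the weight of the current choice by the sums of the children. -/
def multiply : Cmd :=
  .forRange 28 (.var 0) (.ite .isChild (setArray 5 (.bitOf .productDigit)) .skip)

/-- Find the next vertex. -/
def pick : Cmd :=
  .seq (.assign 4 (.fold 36 37 (.var 0) (.var 0) (.ite .isReady (.var 36) (.var 37))))
    (.assign 3 (.op .lt (.var 4) (.var 0)))

/-- Account for the current choice of the current vertex, and go on to its next choice. -/
def step : Cmd :=
  .seq loadChoice <| .seq (setArray 5 .weightBit) <| .seq multiply <|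
    .seq (setArray 4 (.updated 4 (.bitOf .sumDigit))) <|
    .seq (setArray 3 (.updated 3 .nextDigit)) <| .seq (setArray 2 (.updated 2 (.var 16))) pick

section

variable {w N n d : ℕ} {G : SimpleGraph (Fin n)} {T : RootedForest (Fin n)}

/-- The variables that the iteration does not change. -/
structure Constants (N n d : ℕ) (v : ℕ → ℕ) : Prop where
  size : v 0 = n
  bound : v 1 = d
  bits : v 2 = 4 * n * n
  side : v 5 = N

theorem Constants.congr {v v' : ℕ → ℕ} (h : Constants N n d v) (hv : ∀ x ≤ 5, x ≠ 3 → x ≠ 4 →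
    v' x = v x) : Constants N n d v' :=
  ⟨(hv 0 (by omega) (by omega) (by omega)).trans h.size,
    (hv 1 (by omega) (by omega) (by omega)).trans h.bound,
    (hv 2 (by omega) (by omega) (by omega)).trans h.bits,
    (hv 5 (by omega) (by omega) (by omega)).trans h.side⟩

/-- The variables after loading the choice of `u`. -/
structure Choice (G : SimpleGraph (Fin n)) (T : RootedForest (Fin n)) (d : ℕ) (c : Fin n → ℕ)
    (u : Fin n) (v : ℕ → ℕ) : Prop where
  loaded : Expr.Loaded T d (T.digits d c) u v
  valid : v 14 ≠ 0 ↔ T.ValidAt G d (T.digits d c) u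
  odd : open Classical in v 15 = Finset.card {i ∈ Finset.range d |
    (T.digits d c u 1 < i ∧ i < T.digits d c u 2) ∧ T.digits d c u (i + 3) ≠ 1} % 2
  last : v 16 ≠ 0 ↔ c u + 1 = T.numChoices d u

theorem Choice.congr {c : Fin n → ℕ} {u : Fin n} {v v' : ℕ → ℕ} (h : Choice G T d c u v)
    (hv : ∀ x ≤ 16, v' x = v x) : Choice G T d c u v' := by
  constructor
  · constructor <;> rw [hv _ (by omega)]
    exacts [h.1.1, h.1.2, h.1.3, h.1.4, h.1.5, h.1.6, h.1.7]
  · rw [hv _ (by omega)]; exact h.2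
  · rw [hv _ (by omega)]; exact h.3
  · rw [hv _ (by omega)]; exact h.4

theorem digits_le (c : Fin n → ℕ) (u : Fin n) {j : ℕ} (h1 : 1 ≤ j) (h2 : j ≤ 2) :
    T.digits d c u j ≤ d := by
  have := digit_lt (T.radix_pos d u) (c u) j
  rw [RootedForest.radix, if_neg (by omega), if_pos h2] at this
  exact Nat.lt_succ_iff.1 this

theorem run_loadChoice (hP : Params w N n d) {σ : St} {c : Fin n → ℕ}
    (hA : Tables d G T (T.digits d c) σ.arr) (hv : Constants N n d σ.var) {u : Fin n}
    (h4 : σ.var 4 = u) (hc : c u < T.numChoices d u) :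
    ∃ v, loadChoice.run w N σ = { σ with var := v } ∧ Constants N n d v ∧
      Choice G T d c u v := by
  have h8 := hP.eight
  have l : ∀ a ≤ 4, ∀ v, (Expr.lit a).eval w N σ.arr v = a := fun a ha v =>
    Expr.eval_lit (hP.lt_word (by omega))
  refine ⟨_, rfl, ?_⟩
  simp only [Cmd.run]
  set v₁ := Function.update σ.var 10 (Expr.eval w N σ.arr (Expr.att 4) σ.var) with hv₁
  set v₂ := Function.update v₁ 11 (Expr.eval w N σ.arr (Expr.arr 3 (.var 4) (.lit 1)) v₁) with hv₂
  set v₃ := Function.update v₂ 12 (Expr.eval w N σ.arr (Expr.arr 3 (.var 4) (.lit 2)) v₂) with hv₃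
  set v₄ := Function.update v₃ 13 (Expr.eval w N σ.arr (Expr.arr 3 (.var 4) (.lit 0)) v₃) with hv₄
  set v₅ := Function.update v₄ 14 (Expr.eval w N σ.arr .valid v₄) with hv₅
  set v₆ := Function.update v₅ 15 (Expr.eval w N σ.arr (.op .mod .forbidden (.lit 2)) v₅) with hv₆
  have e10 := Expr.eval_att hP hA hv.size (x := 4) (by omega) h4
  have dig : ∀ a ≤ 2, ∀ v : ℕ → ℕ, v 4 = u →
      (Expr.arr 3 (.var 4) (.lit a)).eval w N σ.arr v = T.digits d c u a := by
    intro a ha v hv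
    rw [Expr.eval_table hP hv (l a (by omega) v) (by omega), hA.dig u a (by omega)]
  have hl : Expr.Loaded T d (T.digits d c) u v₄ := by
    constructor
    · simp [hv₄, hv₃, hv₂, hv₁, hv.size]
    · simp [hv₄, hv₃, hv₂, hv₁, hv.bound]
    · simp [hv₄, hv₃, hv₂, hv₁, h4]
    · simp [hv₄, hv₃, hv₂, hv₁, e10]
    · rw [hv₄, Function.update_of_ne (by omega), hv₃, Function.update_of_ne (by omega), hv₂,
        Function.update_self]
      exact dig 1 (by omega) _ (by simp [hv₁, h4])
    · rw [hv₄, Function.update_of_ne (by omega), hv₃, Function.update_self]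
      exact dig 2 (by omega) _ (by simp [hv₂, hv₁, h4])
    · rw [hv₄, Function.update_self]
      exact dig 0 (by omega) _ (by simp [hv₃, hv₂, hv₁, h4])
  have hl₅ : Expr.Loaded T d (T.digits d c) u v₅ := hl.update (by omega) _
  have hl₆ : Expr.Loaded T d (T.digits d c) u v₆ := hl₅.update (by omega) _
  refine ⟨?_, hl₆.update (by omega) _, ?_, ?_, ?_⟩
  · refine hv.congr fun x h1 h2 h3 => ?_
    rw [Function.update_of_ne (by omega), hv₆, Function.update_of_ne (by omega), hv₅,
      Function.update_of_ne (by omega), hv₄, Function.update_of_ne (by omega), hv₃,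
      Function.update_of_ne (by omega), hv₂, Function.update_of_ne (by omega), hv₁,
      Function.update_of_ne (by omega)]
  · rw [Function.update_of_ne (by omega), hv₆, Function.update_of_ne (by omega), hv₅,
      Function.update_self, Expr.eval_valid hP hA hl (digits_le c u le_rfl (by omega))]
  · rw [Function.update_of_ne (by omega), hv₆, Function.update_self]
    refine Expr.eval_mod (Expr.eval_forbidden hP hA hl₅) (l 2 (by omega) _) ?_
    have := hP.le
    refine hP.lt_word (le_trans (Finset.card_filter_le _ _) ?_)
    rw [Finset.card_range]; omega
  · rw [Function.update_self, Expr.eval_overflow hP hA hl₆.size hl₆.bound hl₆.vertex hc]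

theorem eval_weightBit (hP : Params w N n d) {c : Fin n → ℕ} (u : Fin n) :
    ∃ f : ℕ → ℕ, (∀ j, f j ≤ 1) ∧
      rowVal N f = T.weight G d ((2 : ZMod (2 ^ N)) ^ (4 * n * n)) (T.digits d c) u ∧
      ∀ A v j, Constants N n d v → Choice G T d c u v → v 31 = j →
        Expr.weightBit.eval w N A v = f j := by
  classical
  have h8 := hP.eight
  have h2 : 2 ≤ 2 ^ w := hP.two
  set e := 4 * n * n * (T.digits d c u 2 - T.digits d c u 1) with he
  set q := Finset.card {i ∈ Finset.range d |
    (T.digits d c u 1 < i ∧ i < T.digits d c u 2) ∧ T.digits d c u (i + 3) ≠ 1} with hq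
  have hd2 := digits_le (T := T) (d := d) c u (j := 2) (by omega) le_rfl
  have hdn := hP.le
  have heN : e ≤ N := by
    refine le_trans ?_ hP.size
    exact Nat.mul_le_mul_left _ (by omega)
  by_cases hval : T.ValidAt G d (T.digits d c) u
  · have hle : T.digits d c u 1 ≤ T.digits d c u 2 := by
      have := hval.2.1
      split_ifs at this <;> omega
    have hE : ∀ (A : Fin 8 → ℕ → ℕ → ℕ) v, Constants N n d v → Choice G T d c u v →
        (Expr.op .mul (.var 2) (.op .sub (.var 12) (.var 11))).eval w N A v = e := fun A v hv hc =>
      Expr.eval_mul (Expr.eval_var hv.bits) (Expr.eval_sub (Expr.eval_var hc.loaded.snd)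
        (Expr.eval_var hc.loaded.fst) (hP.lt_word (by omega)) hle) (hP.lt_word (by omega))
    by_cases hodd : q % 2 = 0
    · refine ⟨fun j => if j = e then 1 else 0, fun j => ?_, ?_, fun A v j hv hc hj => ?_⟩
      · dsimp only; split_ifs <;> omega
      · rw [rowVal_single, RootedForest.weight, if_pos hval, ← hq, ← pow_mul, ← he,
          Even.neg_one_pow (Nat.even_iff.2 hodd), one_mul]
      · rw [Expr.weightBit, Expr.eval_ite_pos (c := .var 14) (hc.valid.2 hval),
          Expr.eval_ite_neg (by rw [Expr.eval_var hc.odd, hodd]; simp)]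
        show Op.eval w .eq (v 31) _ = if j = e then 1 else 0
        rw [hE A v hv hc, hj]
        unfold Op.eval
        dsimp only
        split_ifs
        · exact Nat.mod_eq_of_lt (by omega)
        · exact Nat.zero_mod _
    · refine ⟨fun j => if j < e then 0 else 1, fun j => ?_, ?_, fun A v j hv hc hj => ?_⟩
      · dsimp only; split_ifs <;> omega
      · rw [rowVal_neg, RootedForest.weight, if_pos hval, ← hq, ← pow_mul, ← he,
          Odd.neg_one_pow (Nat.odd_iff.2 (by omega)), neg_one_mul]
      · rw [Expr.weightBit, Expr.eval_ite_pos (c := .var 14) (hc.valid.2 hval),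
          Expr.eval_ite_pos (by rw [Expr.eval_var hc.odd]; exact hodd)]
        have hlt := Expr.eval_lt_iff (w := w) (N := N) (A := A) (v := v) h2 (e := .var 31)
          (f := .op .mul (.var 2) (.op .sub (.var 12) (.var 11)))
        rw [hE A v hv hc, Expr.eval_var hj] at hlt
        dsimp only
        by_cases hlt' : j < e
        · rw [Expr.eval_ite_pos (hlt.2 hlt'), if_pos hlt', Expr.eval_lit (by omega)]
        · rw [Expr.eval_ite_neg fun h => hlt' (hlt.1 h), if_neg hlt', Expr.eval_lit (by omega)]
  · refine ⟨fun _ => 0, fun _ => Nat.zero_le _, ?_, fun A v j hv hc hj => ?_⟩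
    · rw [rowVal_zero, RootedForest.weight, if_neg hval]
    · rw [Expr.weightBit, Expr.eval_ite_neg (c := .var 14) fun h => hval (hc.valid.1 h), Expr.eval_lit (by omega)]

theorem bit_le_one (f : ℕ → ℕ) (j : ℕ) : bit f j ≤ 1 := by
  unfold bit; omega

theorem _root_.WordRAM.Tables.congr {D : Fin n → ℕ → ℕ} {A A' : Fin 8 → ℕ → ℕ → ℕ} (h : Tables d G T D A)
    (h0 : A' 0 = A 0) (h1 : A' 1 = A 1) (h3 : A' 3 = A 3) : Tables d G T D A' := by
  constructor
  · rw [h0]; exact h.adj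
  · rw [h1]; exact h.anc
  · rw [h3]; exact h.dig

theorem run_multiply (hP : Params w N n d) {σ : St} {c : Fin n → ℕ}
    (hA : Tables d G T (T.digits d c) σ.arr) (hv : Constants N n d σ.var) {u : Fin n}
    (h4 : σ.var 4 = u) (hS : ∀ (z : Fin n), ∀ j < N, σ.arr 4 z j ≤ 1)
    (hp : ∀ j < N, σ.arr 5 0 j ≤ 1) :
    (∀ x < 20, (multiply.run w N σ).var x = σ.var x) ∧
      (∀ b, b ≠ 5 → b ≠ 6 → (multiply.run w N σ).arr b = σ.arr b) ∧
      (multiply.run w N σ).input = σ.input ∧ (multiply.run w N σ).output = σ.output ∧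
      (∀ j < N, (multiply.run w N σ).arr 5 0 j ≤ 1) ∧
      rowVal N ((multiply.run w N σ).arr 5 0) =
        rowVal N (σ.arr 5 0) * ∏ z ∈ T.childFinset u, rowVal N (σ.arr 4 z) := by
  classical
  have h8 := hP.eight
  have hn := hP.nN
  have key := iter_induction (a := σ) (f := fun k (τ : St) =>
      (Cmd.ite .isChild (setArray 5 (.bitOf .productDigit)) .skip).run w N
        { τ with var := Function.update τ.var 28 k })
    (fun k τ => k ≤ n → (∀ x < 20, τ.var x = σ.var x) ∧ (∀ b, b ≠ 5 → b ≠ 6 → τ.arr b = σ.arr b) ∧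
      τ.input = σ.input ∧ τ.output = σ.output ∧ (∀ j < N, τ.arr 5 0 j ≤ 1) ∧
      rowVal N (τ.arr 5 0) = rowVal N (σ.arr 5 0) *
        ∏ z ∈ T.childFinset u with z.1 < k, rowVal N (σ.arr 4 z)) n
    (fun _ => ⟨fun _ _ => rfl, fun _ _ _ => rfl, rfl, rfl, hp, by simp⟩) ?_ le_rfl
  · have hrun : multiply.run w N σ = iter (fun k (τ : St) =>
      (Cmd.ite .isChild (setArray 5 (.bitOf .productDigit)) .skip).run w N
        { τ with var := Function.update τ.var 28 k }) σ n := by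
      rw [multiply, Cmd.run, Expr.eval_var hv.size, min_eq_left hn.le]
    rw [hrun]
    simpa using key
  intro k hk τ hτ hk'
  obtain ⟨i1, i2, i3, i4, i5, i6⟩ := hτ hk.le
  set z : Fin n := ⟨k, hk⟩ with hz
  set τ' : St := { τ with var := Function.update τ.var 28 k } with hτ'
  have hv1 : ∀ x < 20, τ'.var x = σ.var x := fun x hx => by
    rw [hτ', ← i1 x hx]; exact Function.update_of_ne (by omega) _ _
  have hc : Expr.isChild.eval w N τ'.arr τ'.var ≠ 0 ↔ z ∈ T.childFinset u :=
    Expr.eval_isChild hP (Tables.congr hA (i2 0 (by decide) (by decide)) (i2 1 (by decide) (by decide))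
      (i2 3 (by decide) (by decide))) (by rw [hv1 0 (by omega), hv.size])
      (by rw [hv1 4 (by omega), h4]) (by simp [hτ', hz])
  by_cases hcz : z ∈ T.childFinset u
  · have hfil : (T.childFinset u).filter (fun y => y.1 < k + 1) =
        insert z ((T.childFinset u).filter fun y => y.1 < k) := by
      ext y
      simp only [Finset.mem_filter, Finset.mem_insert, Fin.ext_iff, hz]
      constructor
      · rintro ⟨h1, h2⟩
        by_cases h3 : y.1 = k
        · exact Or.inl h3
        · exact Or.inr ⟨h1, by omega⟩
      · rintro (h1 | ⟨h1, h2⟩)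
        · have : y = z := Fin.ext h1
          exact ⟨this ▸ hcz, by omega⟩
        · exact ⟨h1, by omega⟩
    have hrun : (Cmd.ite .isChild (setArray 5 (.bitOf .productDigit)) .skip).run w N τ' =
        (setArray 5 (.bitOf .productDigit)).run w N τ' := if_pos (hc.2 hcz)
    show _ ∧ _
    rw [hrun]
    obtain ⟨hF, hval⟩ := run_setArray (w := w) (N := N) (a := 5) (by decide)
      (e := .bitOf .productDigit) (by decide) (σ := τ') (by rw [hv1 5 (by omega), hv.side])
    have harr5 : ∀ j < N, ((setArray 5 (.bitOf .productDigit)).run w N τ').arr 5 0 j =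
        bit (fun j => ∑ i ∈ Finset.range (j + 1), τ.arr 5 0 i * σ.arr 4 z (j - i)) j := by
      intro j hj
      rw [hval 0 (by omega) j hj]
      have h4' : τ'.arr 4 = σ.arr 4 := i2 4 (by decide) (by decide)
      have hz4 : ∀ j < N, τ'.arr 4 z j ≤ 1 := by rw [h4']; exact hS z
      refine Expr.eval_bitOf hP (f := fun j => ∑ i ∈ Finset.range (j + 1), τ.arr 5 0 i *
        σ.arr 4 z (j - i)) (by simp) hj (fun k hk => ?_) (fun k hk r => ?_) ?_
      · have := (Expr.eval_productDigit hP (x := 0) (by omega) (by omega) (A := τ'.arr)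
          (v := Function.update (Function.update (fun _ => 0) 28 z) 0 k) (j := k) (by simp)
          (by omega) (z := z) (by simp) (by omega) i5 hz4).2
        rwa [h4'] at this
      · have := (Expr.eval_productDigit hP (x := 32) (by omega) (by omega) (A := τ'.arr)
          (v := Function.update (Function.update (Function.update (Function.update τ'.var 30 0) 31 j)
          32 k) 33 r) (j := k) (by simp) (by omega) (z := z) (by simp [hτ', hz]) (by omega) i5 hz4).1
        rwa [h4'] at this
      · have := (Expr.eval_productDigit hP (x := 31) (by omega) (by omega) (A := τ'.arr)
          (v := Function.update (Function.update τ'.var 30 0) 31 j) (j := j) (by simp) (by omega)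
          (z := z) (by simp [hτ', hz]) (by omega) i5 hz4).1
        rwa [h4'] at this
    refine ⟨fun x hx => ?_, fun b h5 h6 => ?_, hF.input.trans i3, hF.output.trans i4,
      fun j hj => ?_, ?_⟩
    · rw [hF.var x (by omega) (by omega), hv1 x hx]
    · rw [hF.arr b (by simp [h5, h6])]; exact i2 b h5 h6
    · rw [harr5 j hj]; exact bit_le_one _ _
    · rw [rowVal_congr harr5, rowVal_bit, rowVal_mul, i6, hfil, Finset.prod_insert (by simp [hz])]
      ring
  · have hfil : (T.childFinset u).filter (fun y => y.1 < k + 1) =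
        (T.childFinset u).filter fun y => y.1 < k := by
      ext y
      simp only [Finset.mem_filter]
      refine and_congr_right fun hy => ?_
      have : y.1 ≠ k := fun h => hcz ((show y = z from Fin.ext h) ▸ hy)
      omega
    have hrun : (Cmd.ite .isChild (setArray 5 (.bitOf .productDigit)) .skip).run w N τ' = τ' :=
      if_neg fun h => hcz (hc.1 h)
    rw [hrun, hfil]
    exact ⟨hv1, i2, i3, i4, i5, i6⟩

end

end Cmd

end WordRAM

namespace WordRAM

open RootedForest

namespace Cmd

section

variable {w N n d : ℕ} {G : SimpleGraph (Fin n)} {T : RootedForest (Fin n)}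

theorem run_seq (p q : Cmd) (σ : St) : (Cmd.seq p q).run w N σ = q.run w N (p.run w N σ) := rfl

/-- The arrays represent the configuration `κ`. -/
structure Holds (G : SimpleGraph (Fin n)) (T : RootedForest (Fin n)) (N d : ℕ)
    (κ : Config (Fin n) (ZMod (2 ^ N))) (A : Fin 8 → ℕ → ℕ → ℕ) : Prop where
  tables : Tables d G T (T.digits d κ.choice) A
  done : ∀ u : Fin n, A 2 u 0 ≠ 0 ↔ κ.done u
  bit : ∀ u : Fin n, ∀ j < N, A 4 u j ≤ 1
  sum : ∀ u : Fin n, rowVal N (A 4 u) = κ.sum u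

/-- The weights of the choices, modulo `2 ^ N`. -/
noncomputable def choiceWeight (G : SimpleGraph (Fin n)) (T : RootedForest (Fin n)) (N d : ℕ)
    (c : Fin n → ℕ) (u : Fin n) : ZMod (2 ^ N) :=
  T.weight G d ((2 : ZMod (2 ^ N)) ^ (4 * n * n)) (T.digits d c) u

theorem choiceWeight_congr (x : Fin n) (f f' : Fin n → ℕ) (h : ∀ v, T.anc v x → f v = f' v) :
    choiceWeight G T N d f x = choiceWeight G T N d f' x :=
  T.weight_congr _ fun v hv => by
    funext j
    rw [digits, digits, h v hv]

/-- The next vertex, or the number of vertices if all are done. -/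
def IsNext (T : RootedForest (Fin n)) (κ : Config (Fin n) (ZMod (2 ^ N))) (y : ℕ) : Prop :=
  (∃ u : Fin n, y = u ∧ ¬ κ.done u ∧ ∀ v, T.anc u v → v ≠ u → κ.done v) ∨
    (y = n ∧ ∀ u, κ.done u)

theorem run_pick (hP : Params w N n d) {σ : St} {κ : Config (Fin n) (ZMod (2 ^ N))}
    (hH : Holds G T N d κ σ.arr) (hv : Constants N n d σ.var) :
    ∃ v, pick.run w N σ = { σ with var := v } ∧ Constants N n d v ∧ IsNext T κ (v 4) ∧
      (v 3 ≠ 0 ↔ v 4 < n) := by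
  have hn := hP.nN
  refine ⟨_, rfl, ?_⟩
  simp only [Cmd.run]
  set y := Expr.eval w N σ.arr (.fold 36 37 (.var 0) (.var 0)
    (.ite .isReady (.var 36) (.var 37))) σ.var with hy
  have e4 : Function.update σ.var 4 y 4 = y := by simp
  refine ⟨hv.congr fun x _ h3 h4 => by
    rw [Function.update_of_ne h3, Function.update_of_ne h4], ?_, ?_⟩
  · rw [Function.update_of_ne (by omega), e4]
    have key : (∃ u : Fin n, y = u ∧ ¬ κ.done u ∧ ∀ v, T.anc u v → v ≠ u → κ.done v) ∨
        (y = n ∧ ∀ u : Fin n, u.1 < n → ¬ (¬ κ.done u ∧ ∀ v, T.anc u v → v ≠ u → κ.done v)) := by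
      refine Expr.eval_fold_induction (fun k r =>
        (∃ u : Fin n, r = u ∧ ¬ κ.done u ∧ ∀ v, T.anc u v → v ≠ u → κ.done v) ∨
        (r = n ∧ ∀ u : Fin n, u.1 < k → ¬ (¬ κ.done u ∧ ∀ v, T.anc u v → v ≠ u → κ.done v)))
        (Expr.eval_var hv.size) hn.le
        (Or.inr ⟨hv.size, fun u hu => absurd hu (Nat.not_lt_zero _)⟩) ?_
      intro k hk r hr
      obtain ⟨u, rfl⟩ : ∃ u : Fin n, u.1 = k := ⟨⟨k, hk⟩, rfl⟩
      set v' := Function.update (Function.update σ.var 36 u.1) 37 r with hv'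
      have hready := Expr.eval_isReady hP hH.tables (v := v') (u := u) (by simp [hv', hv.size])
        (by simp [hv'])
      simp only [hH.done] at hready
      have h0 : σ.arr 2 u 0 = 0 ↔ ¬ κ.done u := by rw [← hH.done, not_not]
      rw [h0] at hready
      by_cases hc : ¬ κ.done u ∧ ∀ v, T.anc u v → v ≠ u → κ.done v
      · rw [Expr.eval_ite_pos (hready.2 hc)]
        exact Or.inl ⟨u, by simp [Expr.eval, hv'], hc⟩
      · rw [Expr.eval_ite_neg fun h => hc (hready.1 h)]
        have e37 : Expr.eval w N σ.arr (.var 37) v' = r := by simp [Expr.eval, hv']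
        rw [e37]
        refine hr.imp_right fun ⟨h1, h2⟩ => ⟨h1, fun z hz => ?_⟩
        rcases Nat.lt_succ_iff_lt_or_eq.1 hz with h3 | h3
        · exact h2 z h3
        · rwa [show z = u from Fin.ext h3]
    refine key.imp_right fun ⟨h1, h2⟩ => ⟨h1, ?_⟩
    by_contra hc
    obtain ⟨u, hu⟩ := Config.Inv.exists_ready (T := T) hc
    exact h2 u u.isLt hu
  · rw [Function.update_self, Function.update_of_ne (by omega), Expr.eval_lt_iff hP.two,
      Expr.eval_var e4, Expr.eval_var (by rw [Function.update_of_ne (by omega), hv.size]), e4]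

theorem run_step (hP : Params w N n d) {σ : St} {κ : Config (Fin n) (ZMod (2 ^ N))}
    (hH : Holds G T N d κ σ.arr) (hI : κ.Inv T (T.numChoices d) (choiceWeight G T N d))
    (hv : Constants N n d σ.var) (hnext : IsNext T κ (σ.var 4)) (h4 : σ.var 4 < n) :
    ∃ κ' : Config (Fin n) (ZMod (2 ^ N)), Holds G T N d κ' (step.run w N σ).arr ∧
      κ'.Inv T (T.numChoices d) (choiceWeight G T N d) ∧
      (∀ b, (∀ u, T.numChoices d u ≤ b) →
        κ'.potential T (T.numChoices d) b < κ.potential T (T.numChoices d) b) ∧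
      Constants N n d (step.run w N σ).var ∧ IsNext T κ' ((step.run w N σ).var 4) ∧
      ((step.run w N σ).var 3 ≠ 0 ↔ (step.run w N σ).var 4 < n) ∧
      (step.run w N σ).input = σ.input ∧ (step.run w N σ).output = σ.output := by
  classical
  have hn := hP.nN
  have h8 := hP.eight
  have hdn := hP.le
  obtain ⟨u, hu, hund, hdesc⟩ | ⟨h, -⟩ := hnext
  swap
  · omega
  have hW := choiceWeight_congr (G := G) (T := T) (N := N) (d := d)
  obtain ⟨v₁, r₁, c₁, l₁⟩ := run_loadChoice hP hH.tables hv hu (hI.lt u)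
  rw [step, run_seq, r₁, run_seq, run_seq, run_seq, run_seq, run_seq]
  set σ₁ : St := { σ with var := v₁ } with hσ₁
  -- the weight
  obtain ⟨f, hf1, hfw, hfe⟩ := eval_weightBit (G := G) (T := T) (N := N) hP (c := κ.choice) u
  obtain ⟨F₂, V₂⟩ := run_setArray (w := w) (N := N) (a := 5) (by decide) (e := .weightBit)
    (by decide) (σ := σ₁) c₁.side
  set σ₂ := (setArray 5 .weightBit).run w N σ₁ with hσ₂
  have c₂ : Constants N n d σ₂.var := c₁.congr fun x h _ _ => F₂.var x (by omega) (by omega)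
  have l₂ : Choice G T d κ.choice u σ₂.var := l₁.congr fun x h => F₂.var x (by omega) (by omega)
  have p₂ : ∀ j < N, σ₂.arr 5 0 j = f j := by
    intro j hj
    rw [V₂ 0 (by omega) j hj]
    refine hfe _ _ j ?_ ?_ (by simp)
    · exact c₁.congr fun x h _ _ => by
        rw [Function.update_of_ne (by omega), Function.update_of_ne (by omega)]
    · exact l₁.congr fun x h => by
        rw [Function.update_of_ne (by omega), Function.update_of_ne (by omega)]
  have a₂ : ∀ b, b ≠ 5 → b ≠ 6 → σ₂.arr b = σ.arr b := fun b h5 h6 =>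
    F₂.arr b (by simp [h5, h6])
  have t₂ : Tables d G T (T.digits d κ.choice) σ₂.arr := hH.tables.congr
    (a₂ 0 (by decide) (by decide)) (a₂ 1 (by decide) (by decide)) (a₂ 3 (by decide) (by decide))
  -- the product
  obtain ⟨m1, m2, m3, m4, m5, m6⟩ := run_multiply (w := w) hP t₂ c₂ l₂.loaded.vertex
    (by rw [a₂ 4 (by decide) (by decide)]; exact hH.bit)
    (fun j hj => by rw [p₂ j hj]; exact hf1 j)
  set σ₃ := multiply.run w N σ₂ with hσ₃
  have c₃ : Constants N n d σ₃.var := c₂.congr fun x h _ _ => m1 x (by omega)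
  have l₃ : Choice G T d κ.choice u σ₃.var := l₂.congr fun x h => m1 x (by omega)
  have a₃ : ∀ b, b ≠ 5 → b ≠ 6 → σ₃.arr b = σ.arr b := fun b h5 h6 =>
    (m2 b h5 h6).trans (a₂ b h5 h6)
  have t₃ : Tables d G T (T.digits d κ.choice) σ₃.arr := hH.tables.congr
    (a₃ 0 (by decide) (by decide)) (a₃ 1 (by decide) (by decide)) (a₃ 3 (by decide) (by decide))
  have p₃ : rowVal N (σ₃.arr 5 0) =
      choiceWeight G T N d κ.choice u * ∏ z ∈ T.childFinset u, κ.sum z := by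
    rw [m6, rowVal_congr p₂, hfw, choiceWeight, a₂ 4 (by decide) (by decide)]
    congr 1
    exact Finset.prod_congr rfl fun z _ => hH.sum z
  -- the sums
  obtain ⟨F₄, V₄⟩ := run_setArray (w := w) (N := N) (a := 4) (by decide)
    (e := .updated 4 (.bitOf .sumDigit)) (by decide) (σ := σ₃) c₃.side
  set σ₄ := (setArray 4 (.updated 4 (.bitOf .sumDigit))).run w N σ₃ with hσ₄
  have c₄ : Constants N n d σ₄.var := c₃.congr fun x h _ _ => F₄.var x (by omega) (by omega)
  have l₄ : Choice G T d κ.choice u σ₄.var := l₃.congr fun x h => F₄.var x (by omega) (by omega)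
  have a₄ : ∀ b, b ≠ 4 → b ≠ 5 → b ≠ 6 → σ₄.arr b = σ.arr b := fun b h4 h5 h6 =>
    (F₄.arr b (by simp [h4, h6])).trans (a₃ b h5 h6)
  have t₄ : Tables d G T (T.digits d κ.choice) σ₄.arr := hH.tables.congr
    (a₄ 0 (by decide) (by decide) (by decide)) (a₄ 1 (by decide) (by decide) (by decide))
    (a₄ 3 (by decide) (by decide) (by decide))
  -- the digits
  obtain ⟨F₅, V₅⟩ := run_setArray (w := w) (N := N) (a := 3) (by decide)
    (e := .updated 3 .nextDigit) (by decide) (σ := σ₄) c₄.side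
  set σ₅ := (setArray 3 (.updated 3 .nextDigit)).run w N σ₄ with hσ₅
  have c₅ : Constants N n d σ₅.var := c₄.congr fun x h _ _ => F₅.var x (by omega) (by omega)
  have l₅ : Choice G T d κ.choice u σ₅.var := l₄.congr fun x h => F₅.var x (by omega) (by omega)
  have a₅ : ∀ b, b ≠ 3 → b ≠ 4 → b ≠ 5 → b ≠ 6 → σ₅.arr b = σ.arr b := fun b h3 h4 h5 h6 =>
    (F₅.arr b (by simp [h3, h6])).trans (a₄ b h4 h5 h6)
  -- the marks
  obtain ⟨F₆, V₆⟩ := run_setArray (w := w) (N := N) (a := 2) (by decide)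
    (e := .updated 2 (.var 16)) (by decide) (σ := σ₅) c₅.side
  set σ₆ := (setArray 2 (.updated 2 (.var 16))).run w N σ₅ with hσ₆
  have c₆ : Constants N n d σ₆.var := c₅.congr fun x h _ _ => F₆.var x (by omega) (by omega)
  have a₆ : ∀ b, b ≠ 2 → b ≠ 3 → b ≠ 4 → b ≠ 5 → b ≠ 6 → σ₆.arr b = σ.arr b :=
    fun b h2 h3 h4 h5 h6 => (F₆.arr b (by simp [h2, h6])).trans (a₅ b h3 h4 h5 h6)
  -- the new configuration
  have hlast : ∀ τ : St, Choice G T d κ.choice u τ.var →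
      (τ.var 16 = 0 ↔ κ.choice u + 1 ≠ T.numChoices d u) := fun τ hτ => by
    rw [ne_eq, ← hτ.last, not_not]
  set κ' : Config (Fin n) (ZMod (2 ^ N)) :=
    { choice := fun z => if z = u then (if κ.choice u + 1 = T.numChoices d u then 0 else
          κ.choice u + 1)
        else if κ.choice u + 1 ≠ T.numChoices d u ∧ T.anc u z then 0 else κ.choice z
      done := fun z => if z = u then κ.choice u + 1 = T.numChoices d u
        else if κ.choice u + 1 ≠ T.numChoices d u ∧ T.anc u z then False else κ.done z
      sum := fun z => if z = u then
          κ.sum u + choiceWeight G T N d κ.choice u * ∏ z ∈ T.childFinset u, κ.sum z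
        else if κ.choice u + 1 ≠ T.numChoices d u ∧ T.anc u z then 0 else κ.sum z } with hκ'
  have upd : ∀ (τ : St) (A : Fin 8 → ℕ → ℕ → ℕ) (D : Fin n → ℕ → ℕ), Choice G T d κ.choice u τ.var →
      Tables d G T D A → ∀ (z : Fin n) (j : ℕ), j < N → ∀ (a : Fin 8) (e : Expr),
      (z = u → (Expr.updated a e).eval w N A
        (Function.update (Function.update τ.var 30 z) 31 j) =
          e.eval w N A (Function.update (Function.update τ.var 30 z) 31 j)) ∧
      (z ≠ u → κ.choice u + 1 ≠ T.numChoices d u ∧ T.anc u z → (Expr.updated a e).eval w N A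
        (Function.update (Function.update τ.var 30 z) 31 j) = 0) ∧
      (z ≠ u → ¬ (κ.choice u + 1 ≠ T.numChoices d u ∧ T.anc u z) → (Expr.updated a e).eval w N A
        (Function.update (Function.update τ.var 30 z) 31 j) = A a z j) := by
    intro τ A D hτ hA z j hj a e
    have e16 : Function.update (Function.update τ.var 30 z.1) 31 j 16 = τ.var 16 := by simp
    obtain ⟨h1, h2, h3⟩ := Expr.eval_updated hP hA (u := u) (z := z) (j := j)
      (v := Function.update (Function.update τ.var 30 z) 31 j) (by simp [hτ.loaded.vertex])
      (by simp) (by simp) hj a e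
    rw [e16, hlast τ hτ] at h2 h3
    exact ⟨h1, fun h4 h5 => h2 h4 h5.1 h5.2, h3⟩
  have hH' : Holds G T N d κ' σ₆.arr := by
    refine ⟨⟨?_, ?_, fun z j hj => ?_⟩, fun z => ?_, fun z j hj => ?_, fun z => ?_⟩
    · rw [a₆ 0 (by decide) (by decide) (by decide) (by decide) (by decide)]
      exact hH.tables.adj
    · rw [a₆ 1 (by decide) (by decide) (by decide) (by decide) (by decide)]
      exact hH.tables.anc
    · rw [F₆.arr 3 (by decide), V₅ z (by omega) j (by omega)]
      obtain ⟨h1, h2, h3⟩ := upd σ₄ σ₄.arr _ l₄ t₄ z j (by omega) 3 .nextDigit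
      by_cases hz : z = u
      · rw [h1 hz, Expr.eval_nextDigit hP t₄ (by simp [c₄.size]) (by simp [c₄.bound])
          (by simp [l₄.loaded.vertex]) (hI.lt u) (by simp) hj, hz]
        simp [hκ', digits]
      · by_cases hr : κ.choice u + 1 ≠ T.numChoices d u ∧ T.anc u z
        · rw [h2 hz hr]
          simp [hκ', hz, digits, hr, Expr.digit_zero]
        · rw [h3 hz hr, t₄.dig z j hj]
          simp only [hκ', digits, hz, hr, if_false]
    · rw [V₆ z (by omega) 0 (by omega)]
      have t₅ : Tables d G T (fun z j => σ₅.arr 3 z j) σ₅.arr := ⟨by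
        rw [a₅ 0 (by decide) (by decide) (by decide) (by decide)]; exact hH.tables.adj, by
        rw [a₅ 1 (by decide) (by decide) (by decide) (by decide)]; exact hH.tables.anc,
        fun _ _ _ => rfl⟩
      obtain ⟨h1, h2, h3⟩ := upd σ₅ σ₅.arr _ l₅ t₅ z 0 (by omega) 2 (.var 16)
      by_cases hz : z = u
      · rw [h1 hz, Expr.eval_var (a := σ₅.var 16) (by simp), l₅.last]
        simp [hκ', hz]
      · by_cases hr : κ.choice u + 1 ≠ T.numChoices d u ∧ T.anc u z
        · rw [h2 hz hr]
          simp [hκ', hz, hr]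
        · rw [h3 hz hr, a₅ 2 (by decide) (by decide) (by decide) (by decide), hH.done]
          simp only [hκ', hz, hr, if_false]
    all_goals
      have key : ∀ j < N, σ₆.arr 4 z j = if z = u then bit (fun j => σ.arr 4 u j + σ₃.arr 5 0 j) j
          else if κ.choice u + 1 ≠ T.numChoices d u ∧ T.anc u z then 0 else σ.arr 4 z j := by
        intro j hj
        rw [F₆.arr 4 (by decide), F₅.arr 4 (by decide), V₄ z (by omega) j hj]
        obtain ⟨h1, h2, h3⟩ := upd σ₃ σ₃.arr _ l₃ t₃ z j hj 4 (.bitOf .sumDigit)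
        have e4 : σ₃.arr 4 = σ.arr 4 := a₃ 4 (by decide) (by decide)
        have hb : ∀ j < N, σ₃.arr 4 u j ≤ 1 := by rw [e4]; exact hH.bit u
        by_cases hz : z = u
        · rw [h1 hz, if_pos hz]
          refine Expr.eval_bitOf hP (by simp) hj (fun k hk => ?_) (fun k hk r => ?_) ?_
          · have := m5 k (by omega)
            have := hH.bit u k (by omega)
            omega
          · rw [Expr.eval_sumDigit hP (j := k) (by simp) (by omega) (u := u)
              (by simp [l₃.loaded.vertex]) (by omega) (m5 k (by omega)) (hb k (by omega)), e4]
          · rw [Expr.eval_sumDigit hP (j := j) (by simp) (by omega) (u := u)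
              (by simp [l₃.loaded.vertex]) (by omega) (m5 j (by omega)) (hb j (by omega)), e4]
        · rw [if_neg hz]
          by_cases hr : κ.choice u + 1 ≠ T.numChoices d u ∧ T.anc u z
          · rw [h2 hz hr, if_pos hr]
          · rw [h3 hz hr, if_neg hr, e4]
    · rw [key j hj]
      split_ifs
      · exact bit_le_one _ _
      · omega
      · exact hH.bit z j hj
    · rw [rowVal_congr key]
      by_cases hz : z = u
      · simp only [hκ', hz, if_true]
        rw [← p₃, ← hH.sum u, ← rowVal_add]
        exact rowVal_bit N _
      · simp only [hκ', hz, if_false]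
        split_ifs
        · exact rowVal_zero N
        · exact hH.sum z
  have hI' : κ'.Inv T (T.numChoices d) (choiceWeight G T N d) ∧
      ∀ b, (∀ u, T.numChoices d u ≤ b) →
        κ'.potential T (T.numChoices d) b < κ.potential T (T.numChoices d) b := by
    have hlt := hI.lt u
    by_cases hB : κ.choice u + 1 = T.numChoices d u
    · refine hI.finish hW hund hdesc hB ?_ ?_ ?_ fun z hz => ⟨?_, ?_, ?_⟩
      · simp [hκ', hB]
      · simp [hκ', hB]
      · simp [hκ']
      all_goals simp [hκ', hz, hB]
    · refine hI.advance hW hund hdesc (by omega) ?_ ?_ ?_ (fun z hz hzu => ⟨?_, ?_, ?_⟩)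
        fun z hz => ⟨?_, ?_, ?_⟩
      · simp [hκ', hB]
      · simp [hκ', hB]
      · simp [hκ']
      · simp [hκ', hB, hz, hzu]
      · simp [hκ', hB, hz, hzu]
      · simp [hκ', hB, hz, hzu]
      all_goals
        have hzu : z ≠ u := fun h => hz (h ▸ T.refl' _)
        simp [hκ', hz, hzu]
  clear_value σ₆ κ'
  clear upd
  obtain ⟨v', r', c', n', b'⟩ := run_pick (w := w) hP hH' c₆
  rw [r']
  exact ⟨κ', hH', hI'.1, hI'.2, c', n', b',
    F₆.input.trans (F₅.input.trans (F₄.input.trans (m3.trans F₂.input))),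
    F₆.output.trans (F₅.output.trans (F₄.output.trans (m4.trans F₂.output)))⟩

end

end Cmd

end WordRAM

/-! ## Costs are polynomial -/

namespace WordRAM

/-- Functions with a polynomial bound. -/
def PolyBound (f : ℕ → ℕ) : Prop := ∃ K, ∀ N, 1 ≤ N → f N ≤ K * N ^ K

namespace PolyBound

variable {f g : ℕ → ℕ}

theorem const (a : ℕ) : PolyBound fun _ => a :=
  ⟨a, fun _ hN => Nat.le_mul_of_pos_right a (Nat.pow_pos hN)⟩

theorem add (hf : PolyBound f) (hg : PolyBound g) : PolyBound fun N => f N + g N := by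
  obtain ⟨K, hK⟩ := hf
  obtain ⟨L, hL⟩ := hg
  refine ⟨K + L, fun N hN => (Nat.add_le_add (hK N hN) (hL N hN)).trans ?_⟩
  rw [add_mul]
  exact Nat.add_le_add (Nat.mul_le_mul_left _ (Nat.pow_le_pow_right hN (by omega)))
    (Nat.mul_le_mul_left _ (Nat.pow_le_pow_right hN (by omega)))

theorem mul_self (hf : PolyBound f) : PolyBound fun N => N * f N := by
  obtain ⟨K, hK⟩ := hf
  refine ⟨K + 1, fun N hN => (Nat.mul_le_mul_left N (hK N hN)).trans ?_⟩
  rw [show N * (K * N ^ K) = K * N ^ (K + 1) by ring]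
  exact Nat.mul_le_mul_right _ (by omega)

end PolyBound

theorem Expr.polyBound_cost (e : Expr) : PolyBound fun N => e.cost N := by
  induction e with
  | lit a => exact .const 1
  | var x => exact .const 1
  | arr a i j hi hj => exact (hi.add hj).add (.const 20)
  | op o e f he hf => exact (he.add hf).add (.const 1)
  | ite c e f hc he hf => exact ((hc.add he).add hf).add (.const 1)
  | fold i x b e f hb he hf => exact ((hb.add he).add (hf.add (.const 10)).mul_self).add (.const 20)

theorem Cmd.polyBound_cost (c : Cmd) : PolyBound fun N => c.cost N := by
  induction c with
  | skip => exact .const 1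
  | assign x e => exact e.polyBound_cost.add (.const 1)
  | store a i j e =>
    exact ((i.polyBound_cost.add j.polyBound_cost).add e.polyBound_cost).add (.const 20)
  | read x => exact .const 1
  | write e => exact e.polyBound_cost.add (.const 1)
  | seq p q hp hq => exact hp.add hq
  | ite c p q hp hq => exact ((c.polyBound_cost.add hp).add hq).add (.const 1)
  | forRange i b p hp => exact (b.polyBound_cost.add (hp.add (.const 10)).mul_self).add (.const 20)

/-! ## Reading the input -/

namespace Cmd

theorem tri_comp {w S N : ℕ} (hF : Fits w S N) (c : Cmd) {σ : St} {s : State} (h : Rep w N σ s) :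
    Tri w S (c.comp 0) s (c.cost N) (Rep w N (c.run w N σ)) :=
  (c.comp_spec hF 0 σ s s (.refl h)).weaken le_rfl fun _ h => h.1

theorem tri_loop {w S N : ℕ} (hF : Fits w S N) (c : Cmd) (x : ℕ) (J : ℕ → St → Prop)
    (hJ : ∀ k σ, J k σ → σ.var x ≠ 0 → ∃ k' < k, J k' (c.run w N σ)) {k : ℕ} {σ : St} {s : State}
    (h : Rep w N σ s) (hk : J k σ) :
    Tri w S (.loop (rv x) (c.comp 0)) s (k * (c.cost N + 1) + 1)
      (fun s' => ∃ σ' k', Rep w N σ' s' ∧ J k' σ' ∧ σ'.var x = 0) := by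
  refine (Tri.loop_variant (fun k s => ∃ σ, Rep w N σ s ∧ J k σ) ?_ k s ⟨σ, h, hk⟩).weaken le_rfl ?_
  · rintro k s ⟨σ, h, hk⟩ hx
    rw [h.var] at hx
    obtain ⟨k', hk', hJ'⟩ := hJ k σ hk hx
    exact (tri_comp hF c h).weaken le_rfl fun s' hs' => ⟨k', hk', _, hs', hJ'⟩
  · rintro s' ⟨hx, k', σ', h', hJ'⟩
    exact ⟨σ', k', h', hJ', by rw [← h'.var]; exact hx⟩

/-- Read a matrix into the array `a`. -/
def readMatrix (a : Fin 8) : Cmd :=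
  .forRange 30 (.var 0) (.forRange 31 (.var 0)
    (.seq (.read 33) (.store a (.var 30) (.var 31) (.var 33))))

section

variable {w N n : ℕ}

theorem run_readMatrix (hn : n ≤ N) (h2 : 2 ≤ 2 ^ w) (a : Fin 8) (r : Fin n → Fin n → Prop)
    {σ : St} (h0 : σ.var 0 = n) {rest : List ℕ} (hin : σ.input = matrixBits r ++ rest) :
    (∀ x < 20, ((readMatrix a).run w N σ).var x = σ.var x) ∧
      (∀ b ≠ a, ((readMatrix a).run w N σ).arr b = σ.arr b) ∧
      (∀ i j : Fin n, ((readMatrix a).run w N σ).arr a i j =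
        open Classical in if r i j then 1 else 0) ∧
      (∀ i j, n ≤ i ∨ n ≤ j → ((readMatrix a).run w N σ).arr a i j = σ.arr a i j) ∧
      ((readMatrix a).run w N σ).input = rest ∧ ((readMatrix a).run w N σ).output = σ.output := by
  classical
  simp only [readMatrix]
  rw [Cmd.run, Expr.eval_var h0, min_eq_left hn]
  set f : Fin n → Fin n → ℕ := fun i j => if r i j then 1 else 0 with hf
  have hlt : ∀ i j, f i j < 2 ^ w := fun i j => by
    simp only [hf]; split_ifs <;> omega
  have hbits : matrixBits r = (List.finRange n).flatMap fun i => (List.finRange n).map (f i) := by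
    rw [matrixBits]
  rw [hbits] at hin
  have key := iter_induction (a := σ) (f := fun k (τ : St) =>
      (Cmd.forRange 31 (.var 0) (.seq (.read 33) (.store a (.var 30) (.var 31) (.var 33)))).run w N
        { τ with var := Function.update τ.var 30 k })
    (fun k τ => (∀ x < 20, τ.var x = σ.var x) ∧ (∀ b ≠ a, τ.arr b = σ.arr b) ∧
      (∀ i j : Fin n, i.1 < k → τ.arr a i j = f i j) ∧
      (∀ i j, n ≤ i ∨ n ≤ j → τ.arr a i j = σ.arr a i j) ∧
      τ.input = (((List.finRange n).drop k).flatMap fun i => (List.finRange n).map (f i)) ++ rest ∧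
      τ.output = σ.output) n
    ⟨fun _ _ => rfl, fun _ _ => rfl, fun i _ hi => absurd hi (Nat.not_lt_zero _), fun _ _ _ => rfl,
      hin, rfl⟩ ?_
  · obtain ⟨k1, k2, k3, k4, k5, k6⟩ := key
    refine ⟨k1, k2, fun i j => k3 i j i.isLt, k4, ?_, k6⟩
    rw [k5, List.drop_of_length_le (by simp), List.flatMap_nil, List.nil_append]
  rintro k hk τ ⟨i1, i2, i3, i4, i5, i6⟩
  obtain ⟨i, rfl⟩ : ∃ i : Fin n, i.1 = k := ⟨⟨k, hk⟩, rfl⟩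
  rw [List.drop_eq_getElem_cons (by simp), List.flatMap_cons, List.getElem_finRange,
    List.append_assoc] at i5
  simp only [Fin.cast_mk, Fin.eta] at i5
  set rest' := (((List.finRange n).drop (i.1 + 1)).flatMap fun i => (List.finRange n).map (f i)) ++
    rest with hrest'
  rw [Cmd.run, Expr.eval_var (show Function.update τ.var 30 i.1 0 = n by
    rw [Function.update_of_ne (by omega), i1 0 (by omega), h0]), min_eq_left hn]
  have key := iter_induction (a := ({ τ with var := Function.update τ.var 30 i.1 } : St))
    (f := fun k (ρ : St) =>
      (Cmd.seq (.read 33) (.store a (.var 30) (.var 31) (.var 33))).run w N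
        { ρ with var := Function.update ρ.var 31 k })
    (fun k ρ => (∀ x < 20, ρ.var x = σ.var x) ∧ ρ.var 30 = i.1 ∧ (∀ b ≠ a, ρ.arr b = σ.arr b) ∧
      (∀ i' j : Fin n, (i'.1 < i.1 ∨ (i' = i ∧ j.1 < k)) → ρ.arr a i' j = f i' j) ∧
      (∀ i j, n ≤ i ∨ n ≤ j → ρ.arr a i j = σ.arr a i j) ∧
      ρ.input = ((List.finRange n).drop k).map (f i) ++ rest' ∧ ρ.output = σ.output) n
    ⟨fun x hx => by rw [← i1 x hx]; exact Function.update_of_ne (by omega) _ _, by simp, i2,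
      fun i' j h => i3 i' j (by simpa using h), i4, i5, i6⟩ ?_
  · obtain ⟨k1, k2, k3, k4, k5, k6, k7⟩ := key
    refine ⟨k1, k3, fun i' j h => k4 i' j ?_, k5, ?_, k7⟩
    · rcases Nat.lt_succ_iff_lt_or_eq.1 h with h' | h'
      · exact Or.inl h'
      · exact Or.inr ⟨Fin.ext h', j.isLt⟩
    · rw [k6, List.drop_of_length_le (by simp), List.map_nil, List.nil_append]
  rintro k hk ρ ⟨j1, j2, j3, j4, j5, j6, j7⟩
  obtain ⟨j, rfl⟩ : ∃ j : Fin n, j.1 = k := ⟨⟨k, hk⟩, rfl⟩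
  rw [List.drop_eq_getElem_cons (by simp), List.map_cons, List.getElem_finRange,
    List.cons_append] at j6
  simp only [Fin.cast_mk, Fin.eta] at j6
  have e30 : Function.update (Function.update ρ.var 31 j.1) 33 (f i j) 30 = i.1 := by simp [j2]
  have e31 : Function.update (Function.update ρ.var 31 j.1) 33 (f i j) 31 = j.1 := by simp
  have e33 : Function.update (Function.update ρ.var 31 j.1) 33 (f i j) 33 = f i j := by simp
  have hiN : i.1 < N := by omega
  have hjN : j.1 < N := by omega
  simp only [Cmd.run, Expr.eval, j6, List.headD_cons, List.tail_cons, Nat.mod_eq_of_lt (hlt i j),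
    e30, e31, e33, hiN, hjN, and_self, if_true]
  refine ⟨fun x hx => ?_, trivial, fun b hb => ?_, fun i' j' h => ?_, fun i' j' h => ?_, trivial, j7⟩
  · rw [Function.update_of_ne (by omega), Function.update_of_ne (by omega), j1 x hx]
  · rw [Function.update_of_ne hb, j3 b hb]
  · rw [Function.update_self]
    by_cases hi : i' = i
    · subst hi
      rw [Function.update_self]
      by_cases hj : j' = j
      · rw [hj, Function.update_self]
      · rw [Function.update_of_ne (fun h => hj (Fin.ext h))]
        refine j4 i' j' (Or.inr ⟨rfl, ?_⟩)
        rcases h with h | h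
        · omega
        · have : j'.1 ≠ j.1 := fun h => hj (Fin.ext h)
          omega
    · rw [Function.update_of_ne (fun h => hi (Fin.ext h))]
      exact j4 i' j' (Or.inl (by
        rcases h with h | h
        · exact h
        · exact absurd h.1 hi))
  · rw [Function.update_self]
    by_cases hi : i' = i.1
    · rw [hi, Function.update_self, Function.update_of_ne (by omega)]
      exact j5 _ _ (Or.inr (by omega))
    · rw [Function.update_of_ne hi]
      exact j5 _ _ h

end

/-- Read everything but the digits of the depth bound. -/
def readGraph : Cmd :=
  .seq (.assign 5 (.op .mul (.lit 8) (.op .mul (.var 0) (.op .mul (.var 0) (.var 0))))) <|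
    .seq (.assign 2 (.op .mul (.op .mul (.lit 4) (.var 0)) (.var 0))) <|
    .seq (readMatrix 0) <| .seq (readMatrix 1) <| .seq (.read 40) <|
    .ite (.var 40) (.assign 41 (.lit 0)) (.seq (.read 42) (.assign 41 (.op .lt (.var 42) (.lit 2))))

/-- Process a digit of the depth bound, and read the next one. -/
def readDigit : Cmd :=
  .seq (.assign 43 (.op .add (.op .mul (.lit 2) (.var 1)) (.var 42))) <|
    .seq (.assign 1 (.ite (.op .lt (.var 43) (.var 0)) (.var 43) (.var 0))) <|
    .seq (.read 42) (.assign 41 (.op .lt (.var 42) (.lit 2)))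

/-- Find the first vertex, unless the depth bound is zero. -/
def start : Cmd := .ite (.var 1) pick .skip

/-- Write the bits of the result, without leading zeros. -/
def writeResult : Cmd :=
  .ite (.var 1)
    (.seq (.assign 44 (.lit 0)) <| .seq (.assign 47 (.fold 36 37 (.var 0) (.lit 0)
        (.ite (.op .eq (.depth 36) (.lit 1)) (.var 36) (.var 37)))) <|
      .forRange 45 (.op .sub (.var 5) (.op .mul (.var 2) (.var 0))) <|
        .seq (.assign 46 (.arr 4 (.var 47) (.op .sub (.op .sub (.var 5) (.lit 1)) (.var 45)))) <|
        .seq (.ite (.var 46) (.assign 44 (.lit 1)) .skip) <|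
        .ite (.var 44) (.write (.var 46)) .skip)
    .skip

section

variable {w N n : ℕ}

theorem binary_two_mul_add {q b : ℕ} (hb : b < 2) (h : 2 * q + b ≠ 0) :
    binary (2 * q + b) = binary q ++ [b] := by
  have hd : Nat.digits 2 (b + 2 * q) = b :: Nat.digits 2 q :=
    Nat.digits_add 2 (by omega) b q hb (by omega)
  rw [binary, add_comm, hd, List.reverse_cons, binary]

theorem foldl_binary (m : ℕ) : (binary m).foldl (fun a x => 2 * a + x) 0 = m := by
  rw [binary, List.foldl_reverse]
  have : ∀ l : List ℕ, l.foldr (fun x a => 2 * a + x) 0 = Nat.ofDigits 2 l := by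
    intro l
    induction l with
    | nil => simp
    | cons x l ih => rw [List.foldr_cons, ih, Nat.ofDigits_cons]; ring
  rw [this, Nat.ofDigits_digits]

theorem binary_lt {m x : ℕ} (h : x ∈ binary m) : x < 2 :=
  Nat.digits_lt_base (by omega) (List.mem_reverse.1 h)

theorem length_binary_le (m : ℕ) : (binary m).length ≤ m := by
  rw [binary, List.length_reverse, Nat.digits_length_le_iff (by omega)]
  exact Nat.lt_two_pow_self

end

end Cmd

end WordRAM

namespace WordRAM

open RootedForest

namespace Cmd

section

variable {w N n d : ℕ} {G : SimpleGraph (Fin n)} {T : RootedForest (Fin n)}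

open Classical in
/-- The state while the digits of the depth bound `D` are read: `k` digits are left. -/
def Reading (G : SimpleGraph (Fin n)) (T : RootedForest (Fin n)) (N D k : ℕ) (σ : St) : Prop :=
  ∃ (p : ℕ) (l : List ℕ), l.length = k ∧ (∀ x ∈ l, x < 2) ∧
    l.foldl (fun a x => 2 * a + x) p = D ∧ Constants N n (min p n) σ.var ∧
    (∀ i j : Fin n, σ.arr 0 i j = if G.Adj i j then 1 else 0) ∧
    (∀ i j : Fin n, σ.arr 1 i j = if T.anc i j then 1 else 0) ∧
    (∀ b, b ≠ 0 → b ≠ 1 → ∀ i j, σ.arr b i j = 0) ∧ σ.var 3 = 0 ∧ σ.output = [] ∧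
    (σ.var 41 ≠ 0 ↔ l ≠ []) ∧ (l ≠ [] → σ.var 42 :: σ.input = l ++ [2])

theorem reading_readDigit (hP : Params w N n 0) {D k : ℕ} {σ : St} (h : Reading G T N D k σ)
    (hx : σ.var 41 ≠ 0) : ∃ k' < k, Reading G T N D k' (readDigit.run w N σ) := by
  have hn := hP.nN
  have h2 := hP.two
  obtain ⟨p, l, hl, hb, hf, hc, h0, h1, hz, h3, ho, h41, h42⟩ := h
  obtain ⟨x, l, rfl⟩ := List.exists_cons_of_ne_nil (h41.1 hx)
  have h42' := h42 (by simp)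
  rw [List.cons_append, List.cons.injEq] at h42'
  have hx2 : x < 2 := hb x (by simp)
  refine ⟨l.length, by simp at hl; omega, ?_⟩
  have e43 : (Expr.op .add (.op .mul (.lit 2) (.var 1)) (.var 42)).eval w N σ.arr σ.var =
      2 * min p n + x :=
    Expr.eval_add (Expr.eval_mul (Expr.eval_lit (hP.lt_word (by omega))) (Expr.eval_var hc.bound)
      (hP.lt_word (by omega))) (Expr.eval_var h42'.1) (hP.lt_word (by omega))
  set v₁ := Function.update σ.var 43 (2 * min p n + x) with hv₁
  have e1 : (Expr.ite (.op .lt (.var 43) (.var 0)) (.var 43) (.var 0)).eval w N σ.arr v₁ =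
      min (2 * p + x) n := by
    have hlt := Expr.eval_lt_iff (N := N) (A := σ.arr) (v := v₁) h2 (e := .var 43) (f := .var 0)
    have e43' : (Expr.var 43).eval w N σ.arr v₁ = 2 * min p n + x := by simp [Expr.eval, hv₁]
    have e0 : (Expr.var 0).eval w N σ.arr v₁ = n := by simp [Expr.eval, hv₁, hc.size]
    rw [e43', e0] at hlt
    by_cases h : 2 * min p n + x < n
    · rw [Expr.eval_ite_pos (hlt.2 h), e43']; omega
    · rw [Expr.eval_ite_neg fun h' => h (hlt.1 h'), e0]; omega
  have hne : ∃ y r, l ++ [2] = y :: r ∧ y ≤ 2 ∧ (y < 2 ↔ l ≠ []) ∧ (l ≠ [] → y :: r = l ++ [2]) := by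
    cases l with
    | nil => exact ⟨2, [], rfl, le_rfl, by simp, by simp⟩
    | cons y l => exact ⟨y, l ++ [2], rfl, (hb y (by simp)).le, by simp [hb y], fun _ => rfl⟩
  obtain ⟨y, r, hyr, hy2, hylt, hyl⟩ := hne
  have hy : y % 2 ^ w = y := Nat.mod_eq_of_lt (hP.lt_word (by have := hP.eight; omega))
  set v₂ := Function.update v₁ 1 (min (2 * p + x) n) with hv₂
  set v₃ := Function.update v₂ 42 y with hv₃
  have hrun : readDigit.run w N σ = ⟨Function.update v₃ 41
      ((Expr.op .lt (.var 42) (.lit 2)).eval w N σ.arr v₃), σ.arr, r, σ.output⟩ := by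
    simp only [readDigit, Cmd.run, e43, ← hv₁, e1, ← hv₂, h42'.2, hyr, List.headD_cons,
      List.tail_cons, hy, ← hv₃]
  rw [hrun]
  refine ⟨2 * p + x, l, rfl, fun z hz => hb z (by simp [hz]), by simpa using hf, ?_, h0, h1, hz,
    by simpa [hv₃, hv₂, hv₁] using h3, ho, ?_, ?_⟩
  · constructor
    · simpa [hv₃, hv₂, hv₁] using hc.size
    · simp [hv₃, hv₂, hv₁]
    · simpa [hv₃, hv₂, hv₁] using hc.bits
    · simpa [hv₃, hv₂, hv₁] using hc.side
  · dsimp only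
    rw [Function.update_self, Expr.eval_lt_iff h2, Expr.eval_var (a := y) (by simp [hv₃]),
      Expr.eval_lit (hP.lt_word (by have := hP.eight; omega)), hylt]
  · intro h
    simpa [hv₃] using hyl h

open Classical in
theorem reading_readGraph (hP : Params w N n 0) (hN : N = 8 * n * n * n) (D : ℤ) {σ : St}
    (hvar : ∀ x, σ.var x = if x = 0 then n else 0) (harr : ∀ a i j, σ.arr a i j = 0)
    (ho : σ.output = [])
    (hin : σ.input = matrixBits G.Adj ++ (matrixBits T.anc ++
      ((if D < 0 then 1 else 0) :: (binary D.natAbs ++ [2])))) :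
    ∃ k ≤ D.toNat, Reading G T N D.toNat k (readGraph.run w N σ) := by
  have hn := hP.nN
  have h2 := hP.two
  have h8 := hP.eight
  have l : ∀ a ≤ 8, ∀ (A : Fin 8 → ℕ → ℕ → ℕ) v, (Expr.lit a).eval w N A v = a := fun a ha A v =>
    Expr.eval_lit (hP.lt_word (by omega))
  have hpos := hP.pos
  have hnn : n * n ≤ n * n * n := Nat.le_mul_of_pos_right _ hpos
  have e5 : (Expr.op .mul (.lit 8) (.op .mul (.var 0) (.op .mul (.var 0) (.var 0)))).eval w N σ.arr
      σ.var = N := by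
    have h0 : σ.var 0 = n := by simp [hvar]
    have hN' : N = 8 * (n * (n * n)) := by rw [hN]; ring
    have hN'' : n * (n * n) = n * n * n := by ring
    refine Eq.trans ?_ hN'.symm
    exact Expr.eval_mul (l 8 le_rfl _ _) (Expr.eval_mul (Expr.eval_var h0) (Expr.eval_mul
      (Expr.eval_var h0) (Expr.eval_var h0) (hP.lt_word (by omega)))
      (hP.lt_word (by omega))) (hP.lt_word (by omega))
  set v₁ := Function.update σ.var 5 N with hv₁
  have e2 : (Expr.op .mul (.op .mul (.lit 4) (.var 0)) (.var 0)).eval w N σ.arr v₁ =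
      4 * n * n := by
    have h0 : v₁ 0 = n := by simp [hv₁, hvar]
    have hN' : 4 * n * n = 4 * (n * n) := by ring
    have hN'' : 8 * n * n * n = 8 * (n * n * n) := by ring
    exact Expr.eval_mul (Expr.eval_mul (l 4 (by omega) _ _) (Expr.eval_var h0)
      (hP.lt_word (by omega))) (Expr.eval_var h0) (hP.lt_word (by omega))
  set v₂ := Function.update v₁ 2 (4 * n * n) with hv₂
  set σ₂ : St := { σ with var := v₂ } with hσ₂
  have hrun : readGraph.run w N σ = (Cmd.seq (.read 40)
    (.ite (.var 40) (.assign 41 (.lit 0)) (.seq (.read 42) (.assign 41 (.op .lt (.var 42) (.lit 2)))))).run w N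
      ((readMatrix 1).run w N ((readMatrix 0).run w N σ₂)) := by
    simp only [readGraph, Cmd.run, e5, ← hv₁, e2, ← hv₂, hσ₂]
  rw [hrun]
  obtain ⟨i1, i2, i3, i4, i5, i6⟩ := run_readMatrix (w := w) (N := N) hn.le h2 0 G.Adj (σ := σ₂)
    (by simp [hσ₂, hv₂, hv₁, hvar]) hin
  set σ₃ := (readMatrix 0).run w N σ₂
  obtain ⟨j1, j2, j3, j4, j5, j6⟩ := run_readMatrix (w := w) (N := N) hn.le h2 1 T.anc (σ := σ₃)
    (by rw [i1 0 (by omega)]; simp [hσ₂, hv₂, hv₁, hvar]) i5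
  set σ₄ := (readMatrix 1).run w N σ₃
  have hv : ∀ x < 20, σ₄.var x = v₂ x := fun x hx => (j1 x hx).trans (i1 x hx)
  clear_value σ₃ σ₄
  have hc : ∀ v : ℕ → ℕ, (∀ x < 20, v x = v₂ x) → Constants N n (min 0 n) v := by
    intro v hv
    constructor <;> rw [hv _ (by omega)] <;> simp [hv₂, hv₁, hvar]
  have a0 : ∀ i j : Fin n, σ₄.arr 0 i j = if G.Adj i j then 1 else 0 := fun i j => by
    rw [j2 0 (by decide)]; exact i3 i j
  have az : ∀ b, b ≠ 0 → b ≠ 1 → ∀ i j, σ₄.arr b i j = 0 := fun b h0 h1 i j => by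
    rw [j2 b h1, i2 b h0]; exact harr b i j
  have ho' : σ₄.output = [] := by rw [j6, i6]; exact ho
  have h1w : 1 % 2 ^ w = 1 := Nat.mod_eq_of_lt (by omega)
  have h2w : 2 % 2 ^ w = 2 := Nat.mod_eq_of_lt (hP.lt_word (by omega))
  by_cases hD : D < 0
  · rw [if_pos hD] at j5
    set v₃ := Function.update σ₄.var 40 1 with hv₃
    have hrun : (Cmd.seq (.read 40) (.ite (.var 40) (.assign 41 (.lit 0))
        (.seq (.read 42) (.assign 41 (.op .lt (.var 42) (.lit 2)))))).run w N σ₄ =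
        ⟨Function.update v₃ 41 0, σ₄.arr, binary D.natAbs ++ [2], σ₄.output⟩ := by
      simp only [Cmd.run, Expr.eval, j5, List.headD_cons, List.tail_cons, h1w, ← hv₃,
        Nat.zero_mod]
      rw [if_pos (by simp [hv₃])]
    rw [hrun]
    refine ⟨0, Nat.zero_le _, 0, [], rfl, by simp, by simp [Int.toNat_of_nonpos hD.le], hc _ ?_, a0,
      j3, az, ?_, ho', by simp, by simp⟩
    · intro x hx
      dsimp only
      rw [Function.update_of_ne (by omega), hv₃, Function.update_of_ne (by omega), hv x hx]
    · simp [hv₃, hv 3, hv₂, hv₁, hvar]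
  · rw [if_neg hD] at j5
    have hDn : D.natAbs = D.toNat := by omega
    rw [hDn] at j5
    have hne : ∃ y r, binary D.toNat ++ [2] = y :: r ∧ y ≤ 2 ∧ (y < 2 ↔ binary D.toNat ≠ []) := by
      cases hbin : binary D.toNat with
      | nil => exact ⟨2, [], rfl, le_rfl, by simp⟩
      | cons y l =>
        have hy : y < 2 := binary_lt (m := D.toNat) (by rw [hbin]; simp)
        exact ⟨y, l ++ [2], rfl, hy.le, by simp [hy]⟩
    obtain ⟨y, r, hyr, hy2, hylt⟩ := hne
    rw [hyr] at j5
    have hy : y % 2 ^ w = y := Nat.mod_eq_of_lt (hP.lt_word (by omega))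
    set v₃ := Function.update σ₄.var 40 0 with hv₃
    set v₄ := Function.update v₃ 42 y with hv₄
    have hrun : (Cmd.seq (.read 40) (.ite (.var 40) (.assign 41 (.lit 0))
        (.seq (.read 42) (.assign 41 (.op .lt (.var 42) (.lit 2)))))).run w N σ₄ =
        ⟨Function.update v₄ 41 ((Expr.op .lt (.var 42) (.lit 2)).eval w N σ₄.arr v₄), σ₄.arr, r,
          σ₄.output⟩ := by
      have e40 : (Expr.var 40).eval w N σ₄.arr v₃ = 0 := by simp [Expr.eval, hv₃]
      simp only [Cmd.run, j5, List.headD_cons, List.tail_cons, Nat.zero_mod, ← hv₃, e40, ne_eq,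
        not_true_eq_false, if_false, hy, ← hv₄]
    rw [hrun]
    refine ⟨_, length_binary_le D.toNat, 0, _, rfl, fun x hx => binary_lt hx, foldl_binary _,
      hc _ ?_, a0, j3, az, ?_, ho', ?_, ?_⟩
    · intro x hx
      dsimp only
      rw [Function.update_of_ne (by omega), hv₄, Function.update_of_ne (by omega), hv₃,
        Function.update_of_ne (by omega), hv x hx]
    · simp [hv₄, hv₃, hv 3, hv₂, hv₁, hvar]
    · dsimp only
      rw [Function.update_self, Expr.eval_lt_iff h2, Expr.eval_var (a := y) (by simp [hv₄]),
        l 2 (by omega), hylt]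
    · intro _
      simp [hv₄, hyr]

theorem run_assign (x : ℕ) (e : Expr) (σ : St) : (Cmd.assign x e).run w N σ =
    ⟨Function.update σ.var x (e.eval w N σ.arr σ.var), σ.arr, σ.input, σ.output⟩ := rfl

theorem run_writeResult (hP : Params w N n d) (hd : d ≠ 0) {σ : St} (hc : Constants N n d σ.var)
    (ho : σ.output = []) {D : Fin n → ℕ → ℕ} (hA : Tables d G T D σ.arr) {root : Fin n}
    (hr : ∀ v, T.anc root v) (hb : ∀ j < N, σ.arr 4 root j ≤ 1) :
    (writeResult.run w N σ).output =
      binary ((∑ j ∈ Finset.range N, σ.arr 4 root j * 2 ^ j) / 2 ^ (4 * n * n * n)) := by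
  have hn := hP.nN
  have h2 := hP.two
  have h8 := hP.eight
  have hdn := hP.le
  have hsize : 4 * n * n * n ≤ N := by
    refine le_trans ?_ hP.size
    exact Nat.mul_le_mul_left _ (by omega)
  set v₁ := Function.update σ.var 44 0 with hv₁
  have c₁ : Constants N n d v₁ := hc.congr fun x hx _ _ => Function.update_of_ne (by omega) _ _
  have eroot : (Expr.fold 36 37 (.var 0) (.lit 0)
      (.ite (.op .eq (.depth 36) (.lit 1)) (.var 36) (.var 37))).eval w N σ.arr v₁ = root := by
    have key := Expr.eval_fold_induction (w := w) (N := N) (A := σ.arr) (v := v₁) (i := 36) (x := 37)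
      (b := .var 0) (e := .lit 0)
      (f := .ite (.op .eq (.depth 36) (.lit 1)) (.var 36) (.var 37))
      (fun k r => root.1 < k → r = root) (Expr.eval_var c₁.size) hn.le
      (fun h => absurd h (Nat.not_lt_zero _)) ?_
    · exact key root.isLt
    intro k hk r ih hk'
    obtain ⟨y, rfl⟩ : ∃ y : Fin n, y.1 = k := ⟨⟨k, hk⟩, rfl⟩
    have hiff := Expr.eval_eq_iff (N := N) (A := σ.arr)
      (v := Function.update (Function.update v₁ 36 y.1) 37 r) h2 (e := .depth 36) (f := .lit 1)
    rw [Expr.eval_depth hP hA (u := y) (by simp [c₁.size]) (by omega) (by omega) (by simp),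
      Expr.eval_lit (hP.lt_word (by omega)), T.depthAt_eq_one_iff ⟨root, hr⟩] at hiff
    by_cases hy : y = root
    · rw [Expr.eval_ite_pos (hiff.2 (hy ▸ hr)), hy]
      simp [Expr.eval]
    · rw [Expr.eval_ite_neg fun h => hy (T.antisymm' _ _ (hiff.1 h root) (hr y))]
      have : root.1 ≠ y.1 := fun h => hy (Fin.ext h.symm)
      simpa [Expr.eval] using ih (by omega)
  set v₂ := Function.update v₁ 47 root.1 with hv₂
  have c₂ : Constants N n d v₂ := c₁.congr fun x hx _ _ => Function.update_of_ne (by omega) _ _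
  set m := 4 * n * n * n with hm
  have ebound : (Expr.op .sub (.var 5) (.op .mul (.var 2) (.var 0))).eval w N σ.arr v₂ = N - m :=
    Expr.eval_sub (Expr.eval_var c₂.side) (Expr.eval_mul (Expr.eval_var c₂.bits)
      (Expr.eval_var c₂.size) (hP.lt_word (by omega))) (hP.lt_word (by omega)) hsize
  set f := σ.arr 4 root with hf
  set body : Cmd := .seq (.assign 46 (.arr 4 (.var 47)
    (.op .sub (.op .sub (.var 5) (.lit 1)) (.var 45)))) <|
      .seq (.ite (.var 46) (.assign 44 (.lit 1)) .skip) <|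
        .ite (.var 44) (.write (.var 46)) .skip with hbody
  have hrun : writeResult.run w N σ = iter (fun k (τ : St) => body.run w N
      { τ with var := Function.update τ.var 45 k }) { σ with var := v₂ } (N - m) := by
    have e1 : (Expr.var 1).eval w N σ.arr σ.var ≠ 0 := by rw [Expr.eval_var hc.bound]; exact hd
    have e0 : (Expr.lit 0).eval w N σ.arr σ.var = 0 := Nat.zero_mod _
    rw [writeResult, Cmd.run, if_pos e1, run_seq, run_seq, run_assign, run_assign, e0]
    dsimp only
    rw [← hv₁, eroot, ← hv₂, Cmd.run]
    dsimp only
    rw [ebound, min_eq_left (Nat.sub_le _ _)]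
  rw [hrun]
  have key := iter_induction (a := ({ σ with var := v₂ } : St)) (f := fun k (τ : St) => body.run w N
      { τ with var := Function.update τ.var 45 k })
    (fun k τ => τ.arr = σ.arr ∧ τ.var 5 = N ∧ τ.var 47 = root ∧ ∃ q,
      q * 2 ^ (N - k) + ∑ j ∈ Finset.range (N - k), f j * 2 ^ j =
        ∑ j ∈ Finset.range N, f j * 2 ^ j ∧
      (τ.var 44 ≠ 0 ↔ q ≠ 0) ∧ τ.output = binary q) (N - m)
    ⟨rfl, c₂.side, by simp [hv₂], 0, by simp, by simp [hv₂, hv₁], by simp [ho, binary]⟩ ?_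
  · obtain ⟨-, -, -, q, hq, -, hout⟩ := key
    rw [hout]
    congr 1
    rw [show N - (N - m) = m by omega] at hq
    have hlt : ∑ j ∈ Finset.range m, f j * 2 ^ j < 2 ^ m := by
      have h1 : ∑ j ∈ Finset.range m, f j * 2 ^ j ≤ ∑ j ∈ Finset.range m, 2 ^ j :=
        Finset.sum_le_sum fun j hj => by
          have := hb j (by have := Finset.mem_range.1 hj; omega)
          exact (Nat.mul_le_mul_right _ this).trans (one_mul _).le
      exact h1.trans_lt (Nat.geomSum_lt le_rfl fun k hk => Finset.mem_range.1 hk)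
    rw [← hq, add_comm, Nat.add_mul_div_right _ _ (by positivity), Nat.div_eq_of_lt hlt, zero_add]
  rintro k hk τ ⟨i1, i2, i3, q, i4, i5, i6⟩
  have hb' := hb (N - 1 - k) (by omega)
  set b := f (N - 1 - k) with hbd
  set u₁ := Function.update τ.var 45 k with hu₁
  have eb : (Expr.arr 4 (.var 47) (.op .sub (.op .sub (.var 5) (.lit 1)) (.var 45))).eval w N τ.arr
      u₁ = b := by
    rw [i1]
    exact Expr.eval_arr (Expr.eval_var (by simp [hu₁, i3])) (Expr.eval_sub (Expr.eval_sub
      (Expr.eval_var (by simp [hu₁, i2])) (Expr.eval_lit (hP.lt_word (by omega)))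
      (hP.lt_word (by omega)) (by omega)) (Expr.eval_var (by simp [hu₁])) (hP.lt_word (by omega))
      (by omega)) (by omega) (by omega)
  have h1w : 1 % 2 ^ w = 1 := Nat.mod_eq_of_lt (by omega)
  have hq' : (2 * q + b) * 2 ^ (N - (k + 1)) + ∑ j ∈ Finset.range (N - (k + 1)), f j * 2 ^ j =
      ∑ j ∈ Finset.range N, f j * 2 ^ j := by
    rw [← i4, show N - k = N - (k + 1) + 1 by omega, Finset.sum_range_succ, hbd,
      show N - 1 - k = N - (k + 1) by omega, pow_succ]
    ring
  set u₂ := Function.update u₁ 46 b with hu₂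
  set u₃ := if b ≠ 0 then Function.update u₂ 44 1 else u₂ with hu₃
  have e44 : u₃ 44 ≠ 0 ↔ 2 * q + b ≠ 0 := by
    rw [hu₃]
    split_ifs with h
    · simp [h]
    · have : u₂ 44 = τ.var 44 := by simp [hu₂, hu₁]
      rw [this, i5]; omega
  have e46 : u₃ 46 = b := by
    rw [hu₃]; split_ifs <;> simp [hu₂]
  have hbrun : body.run w N { τ with var := u₁ } =
      ⟨u₃, τ.arr, τ.input, if u₃ 44 ≠ 0 then τ.output ++ [b] else τ.output⟩ := by
    have e46' : u₂ 46 = b := by simp [hu₂]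
    rw [hbody, run_seq, run_assign]
    dsimp only
    rw [eb, ← hu₂, run_seq]
    have hs : Cmd.run w N (.ite (.var 46) (.assign 44 (.lit 1)) .skip)
        ⟨u₂, τ.arr, τ.input, τ.output⟩ = ⟨u₃, τ.arr, τ.input, τ.output⟩ := by
      simp only [Cmd.run, Expr.eval, e46', h1w, hu₃]
      split_ifs <;> rfl
    rw [hs]
    simp only [Cmd.run, Expr.eval, e46]
    split_ifs <;> rfl
  rw [hbrun]
  refine ⟨i1, ?_, ?_, 2 * q + b, hq', e44, ?_⟩
  · dsimp only
    rw [hu₃]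
    split_ifs <;> simp [hu₂, hu₁, i2]
  · dsimp only
    rw [hu₃]
    split_ifs <;> simp [hu₂, hu₁, i3]
  · dsimp only
    by_cases h : 2 * q + b = 0
    · rw [if_neg (by rw [e44]; simpa using h), i6, h, show q = 0 by omega]
    · rw [if_pos (e44.2 h), i6, binary_two_mul_add (by omega) h]

end

end Cmd

end WordRAM

/-! ## The program -/

namespace WordRAM

open RootedForest Cmd

/-- Read the number of vertices, and compute the side of the arrays. -/
def readSize : Program :=
  block [.read (rv 0), .const (sc 0) 8, .op .mul 0 (rv 0) (rv 0), .op .mul 0 0 (rv 0),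
    .op .mul 0 0 (sc 0)]

/-- The program that counts sensible elimination trees. -/
def countProgram : Program :=
  block [readSize, readGraph.comp 0, .loop (rv 41) (readDigit.comp 0), start.comp 0,
    .loop (rv 3) (step.comp 0), writeResult.comp 0]

section

variable {w S N n : ℕ} {G : SimpleGraph (Fin n)} {T : RootedForest (Fin n)}

theorem readSize_spec (hn : 0 < n) (hN : N = 8 * n * n * n) (hw : 8 * N * N ≤ 2 ^ w)
    (rest : List ℕ) : Tri w S readSize (initial (n :: rest)) 5
      (Rep w N ⟨fun x => if x = 0 then n else 0, fun _ _ _ => 0, rest, []⟩) := by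
  have hnn : n * n ≤ n * n * n := Nat.le_mul_of_pos_right _ hn
  have hn1 : n ≤ n * n := Nat.le_mul_of_pos_right _ hn
  have hNa : N = 8 * (n * n * n) := by rw [hN]; ring
  have hNw : N < 2 ^ w := by nlinarith
  refine (Tri.seq (Tri.read (Q := fun s => s = { initial (n :: rest) with
      reg := Function.update (fun _ => 0) (rv 0) n, input := rest }) ?_) fun s h1 =>
    Tri.seq (Tri.const (Q := fun s => s = { initial (n :: rest) with
      reg := Function.update (Function.update (fun _ => 0) (rv 0) n) (sc 0) 8, input := rest }) ?_)
      fun s h2 =>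
    Tri.seq (Tri.op (Q := fun s => s = { initial (n :: rest) with
      reg := Function.update (Function.update (Function.update (fun _ => 0) (rv 0) n) (sc 0) 8)
        0 (n * n), input := rest }) ?_) fun s h3 =>
    Tri.seq (Tri.op (Q := fun s => s = { initial (n :: rest) with
      reg := Function.update (Function.update (Function.update (fun _ => 0) (rv 0) n) (sc 0) 8)
        0 (n * n * n), input := rest }) ?_) fun s h4 => Tri.op ?_).weaken
      (show 1 + (1 + (1 + (1 + 1))) ≤ 5 by omega) (fun _ h => h)
  · simp [initial, Nat.mod_eq_of_lt (show n < 2 ^ w by omega)]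
  · rw [h1]
    simp [initial, Nat.mod_eq_of_lt (show 8 < 2 ^ w by nlinarith)]
  · rw [h2]
    simp [initial, Op.eval, rv, sc, Nat.mod_eq_of_lt (show n * n < 2 ^ w by omega)]
  · rw [h3]
    simp [initial, Op.eval, rv, sc, Nat.mod_eq_of_lt (show n * n * n < 2 ^ w by omega)]
  · rw [h4]
    have hlast : n * n * n * 8 = N := by rw [hNa]; ring
    have hreg : Op.eval w .mul (n * n * n) 8 = N := by
      simp [Op.eval, hlast, Nat.mod_eq_of_lt hNw]
    refine ⟨⟨fun x => ?_, fun _ _ _ => by positivity⟩, ?_, fun x => ?_, fun _ _ _ _ _ => rfl, rfl,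
      rfl⟩
    · dsimp only; split_ifs
      · omega
      · positivity
    · simp [rv, sc, hreg]
    · have h1 : rv x ≠ 0 := by unfold rv; omega
      have h2 : rv x ≠ sc 0 := by unfold rv sc; omega
      by_cases hx : x = 0
      · simp [hx, rv, sc]
      · have h3 : rv x ≠ rv 0 := by unfold rv; omega
        simp [Function.update_apply, h1, h2, h3, hx]

theorem one_le_depth (R : RootedForest (Fin n)) (hn : 0 < n) : 1 ≤ R.depth :=
  (R.one_le_depthAt ⟨0, hn⟩).trans (Finset.le_sup (f := R.depthAt) (Finset.mem_univ _))

theorem depth_le (R : RootedForest (Fin n)) : R.depth ≤ n :=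
  Finset.sup_le fun u _ => by simpa using R.depthAt_le_card u

theorem countSensible_min (hn : 0 < n) (d : ℤ) :
    countSensible G T d = countSensible G T ((min d.toNat n : ℕ) : ℤ) := by
  unfold countSensible
  congr 1
  ext R
  have h1 := one_le_depth R hn
  have h2 := depth_le R
  simp only [Set.mem_ofPred_eq]
  refine and_congr_right fun _ => and_congr_left fun _ => ?_
  omega

theorem countSensible_zero (hn : 0 < n) : countSensible G T ((0 : ℕ) : ℤ) = 0 := by
  unfold countSensible
  rw [Set.ncard_eq_zero]
  ext R
  have h1 := one_le_depth R hn
  simp only [Set.mem_ofPred_eq, Set.mem_empty_iff_false, iff_false]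
  omega

open Classical in
theorem card_depthChoices {V : Type*} [Fintype V] (T : RootedForest V) (d : ℕ) :
    (T.depthChoices d).card = ∏ u, T.depthAt u * ((d + 1) * (d + 1)) := by
  simp [depthChoices, Fintype.card_piFinset]

theorem card_depthChoices_lt (hn : 0 < n) {d : ℕ} (hd : d ≤ n) :
    (T.depthChoices d).card < 2 ^ (4 * n * n) := by
  have h1 : (T.depthChoices d).card ≤ (2 ^ (3 * n)) ^ n := by
    rw [card_depthChoices]
    refine (Finset.prod_le_pow_card _ _ (2 ^ (3 * n)) fun u _ => ?_).trans (by simp)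
    have h2 : T.depthAt u ≤ 2 ^ n := by
      have := T.depthAt_le_card u
      rw [Fintype.card_fin] at this
      exact this.trans Nat.lt_two_pow_self.le
    have h3 : d + 1 ≤ 2 ^ n := (Nat.succ_le_succ hd).trans Nat.lt_two_pow_self
    calc _ ≤ 2 ^ n * (2 ^ n * 2 ^ n) := Nat.mul_le_mul h2 (Nat.mul_le_mul h3 h3)
      _ = _ := by rw [← pow_add, ← pow_add]; congr 1; ring
  refine h1.trans_lt ?_
  rw [← pow_mul]
  refine Nat.pow_lt_pow_right (by omega) ?_
  have : 0 < n * n := Nat.mul_pos hn hn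
  nlinarith

theorem numChoices_le {D d : ℕ} (hd : d ≤ D) (u : Fin n) :
    T.numChoices d u ≤ T.depth * ((D + 1) * (D + 1)) * 2 ^ D := by
  rw [numChoices_eq]
  have h1 : T.depthAt u ≤ T.depth := Finset.le_sup (Finset.mem_univ _)
  gcongr
  omega

/-- The configurations during the iteration. -/
def Iterating (G : SimpleGraph (Fin n)) (T : RootedForest (Fin n)) (N d b k : ℕ) (σ : St) : Prop :=
  Constants N n d σ.var ∧ σ.output = [] ∧ (d = 0 ∧ σ.var 3 = 0 ∨
    d ≠ 0 ∧ ∃ κ : Config (Fin n) (ZMod (2 ^ N)), Holds G T N d κ σ.arr ∧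
      κ.Inv T (T.numChoices d) (choiceWeight G T N d) ∧ κ.potential T (T.numChoices d) b ≤ k ∧
      IsNext T κ (σ.var 4) ∧ (σ.var 3 ≠ 0 ↔ σ.var 4 < n))

theorem iterating_step {d b k : ℕ} (hP : Params w N n d) (hb : ∀ u, T.numChoices d u ≤ b) {σ : St}
    (h : Iterating G T N d b k σ) (h3 : σ.var 3 ≠ 0) :
    ∃ k' < k, Iterating G T N d b k' (step.run w N σ) := by
  obtain ⟨hc, ho, ⟨-, h⟩ | ⟨hd, κ, hH, hI, hk, hnext, h34⟩⟩ := h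
  · exact absurd h h3
  obtain ⟨κ', r1, r2, r3, r4, r5, r6, -, r8⟩ := run_step hP hH hI hc hnext (h34.1 h3)
  exact ⟨_, (r3 b hb).trans_le hk, r4, r8.trans ho, Or.inr ⟨hd, κ', r1, r2, le_rfl, r5, r6⟩⟩

theorem iterating_start {D b : ℕ} (hP : Params w N n (min D n))
    (hb : ∀ u, T.numChoices (min D n) u ≤ b) {k : ℕ} {σ : St} (h : Reading G T N D k σ)
    (h41 : σ.var 41 = 0) {M : ℕ} (hM : min D n ≠ 0 → n * (b + 1) ^ T.depth ≤ M) :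
    Iterating G T N (min D n) b M (start.run w N σ) := by
  obtain ⟨p, l, -, -, hf, hc, h0, h1, hz, h3, ho, h41', -⟩ := h
  obtain rfl : l = [] := by
    by_contra hl
    exact h41'.2 hl h41
  obtain rfl : p = D := hf
  by_cases hd : min p n = 0
  · have hrun : start.run w N σ = σ := if_neg (by rw [Expr.eval_var hc.bound, hd]; simp)
    rw [hrun]
    exact ⟨hc, ho, Or.inl ⟨hd, h3⟩⟩
  · have hrun : start.run w N σ = pick.run w N σ := if_pos (by rw [Expr.eval_var hc.bound]; exact hd)
    rw [hrun]
    set κ : Config (Fin n) (ZMod (2 ^ N)) := ⟨fun _ => 0, fun _ => False, fun _ => 0⟩ with hκ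
    have hH : Holds G T N (min p n) κ σ.arr := by
      refine ⟨⟨h0, h1, fun i j _ => ?_⟩, fun u => ?_, fun u j _ => ?_, fun u => ?_⟩
      · rw [hz 3 (by decide) (by decide)]
        exact (Expr.digit_zero _ _).symm
      · rw [hz 2 (by decide) (by decide)]
        simp [hκ]
      · rw [hz 4 (by decide) (by decide)]
        omega
      · exact (rowVal_congr fun j _ => hz 4 (by decide) (by decide) u j).trans (rowVal_zero N)
    obtain ⟨v, r1, r2, r3, r4⟩ := run_pick hP hH hc
    rw [r1]
    refine ⟨r2, ho, Or.inr ⟨hd, κ, hH, Config.Inv.init (fun u => ?_) (fun _ => rfl) (fun _ h => h)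
      (fun _ => rfl), ?_, r3, r4⟩⟩
    · exact Finset.prod_pos fun j _ => T.radix_pos _ u j
    · refine (Config.potential_le (k := T.depth) κ hb fun u => ?_).trans ((le_of_eq ?_).trans (hM hd))
      · exact Finset.le_sup (f := T.depthAt) (Finset.mem_univ u)
      · rw [Fintype.card_fin]

theorem writeResult_spec {d b k : ℕ} (hP : Params w N n d) (hT : T.IsElimTree G) {σ : St}
    (h : Iterating G T N d b k σ) (h3 : σ.var 3 = 0) :
    (writeResult.run w N σ).output = binary (countSensible G T d) := by
  obtain ⟨hc, ho, ⟨rfl, h⟩ | ⟨hd, κ, hH, hI, hk, hnext, h34⟩⟩ := h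
  · have hrun : writeResult.run w N σ = σ := if_neg (by rw [Expr.eval_var hc.bound]; simp)
    rw [hrun, ho, countSensible_zero hP.pos]
    simp [binary]
  · obtain ⟨root, hr⟩ := hT.1
    obtain ⟨u, hu, -⟩ | ⟨-, hdone⟩ := hnext
    · exact absurd h3 (h34.2 (by rw [hu]; exact u.isLt))
    rw [run_writeResult hP hd hc ho hH.tables hr (hH.bit root)]
    congr 1
    obtain ⟨Z, hZ, hlt, hsum⟩ := exists_sum_weights T G d hT (4 * n * n) (by simpa using hP.pos)
      (card_depthChoices_lt hP.pos hP.le)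
    rw [Fintype.card_fin] at hZ hlt
    rw [← hZ]
    congr 1
    have h1 := hI.sum_root (choiceWeight_congr (G := G) (T := T) (N := N) (d := d)) hr (hdone root)
    unfold choiceWeight at h1
    have h1 : κ.sum root = (Z : ZMod (2 ^ N)) := h1.trans (by convert hsum (ZMod (2 ^ N)))
    rw [← hH.sum root, rowVal, ZMod.natCast_eq_natCast_iff'] at h1
    have h2 : ∑ j ∈ Finset.range N, σ.arr 4 root j * 2 ^ j < 2 ^ N := by
      have h1 : ∑ j ∈ Finset.range N, σ.arr 4 root j * 2 ^ j ≤ ∑ j ∈ Finset.range N, 2 ^ j :=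
        Finset.sum_le_sum fun j hj => (Nat.mul_le_mul_right _
          (hH.bit root j (Finset.mem_range.1 hj))).trans (one_mul _).le
      exact h1.trans_lt (Nat.geomSum_lt le_rfl fun k hk => Finset.mem_range.1 hk)
    rwa [Nat.mod_eq_of_lt h2, Nat.mod_eq_of_lt (hlt.trans_le
      (Nat.pow_le_pow_right (by omega) hP.size))] at h1

theorem countProgram_spec (hn : 0 < n) (hN : N = 8 * n * n * n) (hw : 8 * N * N ≤ 2 ^ w)
    (hS : 8 * N * N ≤ S) (hT : T.IsElimTree G) (d : ℤ) {b M : ℕ}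
    (hb : ∀ u, T.numChoices (min d.toNat n) u ≤ b)
    (hM : min d.toNat n ≠ 0 → n * (b + 1) ^ T.depth ≤ M) :
    Tri w S countProgram (initial (encode G T d))
      (5 + (readGraph.cost N + ((d.toNat * (readDigit.cost N + 1) + 1) + (start.cost N +
        ((M * (step.cost N + 1) + 1) + writeResult.cost N)))))
      (fun s => s.output = binary (countSensible G T d)) := by
  have hNa : N = 8 * (n * n * n) := by rw [hN]; ring
  have hnn : n * n ≤ n * n * n := Nat.le_mul_of_pos_right _ hn
  have hn1 : n ≤ n * n := Nat.le_mul_of_pos_right _ hn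
  have hF : Fits w S N := ⟨by omega, hS, hw⟩
  have hP : ∀ d ≤ n, Params w N n d := fun d hd => by
    refine ⟨hn, hw, ?_, by omega, hd⟩
    rw [hNa, show 4 * n * n * (n + 1) = 4 * (n * n * n) + 4 * (n * n) by ring]
    omega
  have hin : encode G T d = n :: (matrixBits G.Adj ++ (matrixBits T.anc ++
      ((if d < 0 then 1 else 0) :: (binary d.natAbs ++ [2])))) := by
    simp [encode]
  rw [hin]
  refine Tri.seq (readSize_spec hn hN hw _) fun s₁ h₁ => Tri.seq (tri_comp hF readGraph h₁)
    fun s₂ h₂ => ?_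
  obtain ⟨k, hk, hread⟩ := reading_readGraph (G := G) (T := T) (hP 0 (by omega)) hN d
    (σ := ⟨fun x => if x = 0 then n else 0, fun _ _ _ => 0, _, []⟩) (fun _ => rfl)
    (fun _ _ _ => rfl) rfl rfl
  refine Tri.seq ((tri_loop hF readDigit 41 (Reading G T N d.toNat)
    (fun k σ h hx => reading_readDigit (hP 0 (by omega)) h hx) h₂ hread).weaken
    (by gcongr) fun _ h => h) fun s₃ ⟨σ₃, k₃, h₃, hr₃, h41⟩ => ?_
  refine Tri.seq (tri_comp hF start h₃) fun s₄ h₄ => ?_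
  have hst := iterating_start (hP _ (Nat.min_le_right _ _)) hb hr₃ h41 hM
  refine Tri.seq (tri_loop hF step 3 (Iterating G T N (min d.toNat n) b)
    (fun k σ h hx => iterating_step (hP _ (Nat.min_le_right _ _)) hb h hx) h₄ hst)
    fun s₅ ⟨σ₅, k₅, h₅, hr₅, h3⟩ => ?_
  refine (tri_comp hF writeResult h₅).weaken le_rfl fun s₆ h₆ => ?_
  rw [h₆.output, writeResult_spec (hP _ (Nat.min_le_right _ _)) hT hr₅ h3, countSensible_min hn d]

end

/-! ## Bounds on the running time -/

theorem exists_time_bound : ∃ K, ∀ (N D M : ℕ), 1 ≤ N →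
    5 + (readGraph.cost N + ((D * (readDigit.cost N + 1) + 1) + (start.cost N +
        ((M * (step.cost N + 1) + 1) + writeResult.cost N)))) ≤ K * N ^ K * (1 + D + M) := by
  obtain ⟨K, hK⟩ := ((((readGraph.polyBound_cost.add readDigit.polyBound_cost).add
    start.polyBound_cost).add step.polyBound_cost).add writeResult.polyBound_cost).add (.const 10)
  refine ⟨K, fun N D M hN => ?_⟩
  have hK := hK N hN
  dsimp only at hK
  refine le_trans ?_ (Nat.mul_le_mul_right _ hK)
  generalize readGraph.cost N = a
  generalize readDigit.cost N = b
  generalize start.cost N = c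
  generalize step.cost N = e
  generalize writeResult.cost N = f
  obtain ⟨X, hX⟩ : ∃ X, X = a + b + c + e + f + 10 := ⟨_, rfl⟩
  rw [← hX]
  have h1 : D * (b + 1) ≤ X * D := by
    rw [mul_comm]; exact Nat.mul_le_mul_right _ (by omega)
  have h2 : M * (e + 1) ≤ X * M := by
    rw [mul_comm]; exact Nat.mul_le_mul_right _ (by omega)
  have h3 : X * (1 + D + M) = X + X * D + X * M := by ring
  omega

theorem choices_add_one_le {D k : ℕ} (hD : 1 ≤ D) (hk : 1 ≤ k) :
    k * ((D + 1) * (D + 1)) * 2 ^ D + 1 ≤ (D * k * 2 ^ D) ^ 5 := by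
  set y := D * k * 2 ^ D with hy
  have h2 : 2 ≤ 2 ^ D := by
    calc 2 = 2 ^ 1 := rfl
      _ ≤ 2 ^ D := Nat.pow_le_pow_right (by omega) hD
  have hDk : 1 ≤ D * k := Nat.mul_pos hD hk
  have hy2 : 2 ≤ y := h2.trans (Nat.le_mul_of_pos_left _ hDk)
  have hDy : D ≤ y := by
    rw [hy, mul_assoc]
    exact Nat.le_mul_of_pos_right _ (Nat.mul_pos hk (by positivity))
  have h3 : k * ((D + 1) * (D + 1)) * 2 ^ D ≤ 4 * (y * y) := by
    calc k * ((D + 1) * (D + 1)) * 2 ^ D ≤ k * ((2 * D) * (2 * D)) * 2 ^ D := by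
          gcongr <;> omega
      _ = 4 * (D * y) := by rw [hy]; ring
      _ ≤ 4 * (y * y) := by gcongr
  have h4 : 4 ≤ y * y := Nat.mul_le_mul hy2 hy2
  calc _ ≤ 4 * (y * y) + 1 := by omega
    _ ≤ 8 * (y * y) := by omega
    _ ≤ y ^ 3 * (y * y) := Nat.mul_le_mul_right _ (Nat.pow_le_pow_left hy2 3)
    _ = y ^ 5 := by ring

theorem word_size_bound {n : ℕ} : 8 * (8 * n * n * n) * (8 * n * n * n) ≤
    2 ^ (15 * (Nat.log 2 n + 1)) := by
  have h1 : n < 2 ^ (Nat.log 2 n + 1) := Nat.lt_pow_succ_log_self (by omega) n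
  have h2 : 2 ≤ 2 ^ (Nat.log 2 n + 1) := by
    calc 2 = 2 ^ 1 := rfl
      _ ≤ _ := Nat.pow_le_pow_right (by omega) (by omega)
  rw [mul_comm 15, pow_mul]
  set L := 2 ^ (Nat.log 2 n + 1)
  calc 8 * (8 * n * n * n) * (8 * n * n * n) = 2 ^ 9 * n ^ 6 := by ring
    _ ≤ L ^ 9 * L ^ 6 := Nat.mul_le_mul (Nat.pow_le_pow_left h2 9) (Nat.pow_le_pow_left h1.le 6)
    _ = L ^ 15 := by rw [← pow_add]

theorem time_bound {K n D k M : ℕ} (hn : 1 ≤ n) (hk : 1 ≤ k)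
    (hM : M ≤ if D = 0 then 0 else n * (k * ((D + 1) * (D + 1)) * 2 ^ D + 1) ^ k) :
    K * (8 * n * n * n) ^ K * (1 + D + M) ≤
      (3 * (K * 8 ^ K) + 3 * K + 1000) * ((D * k * 2 ^ D) ^ k + 1) ^ (3 * (K * 8 ^ K) + 3 * K + 1000)
        * n ^ (3 * (K * 8 ^ K) + 3 * K + 1000) := by
  set C := 3 * (K * 8 ^ K) + 3 * K + 1000 with hC
  set X := (D * k * 2 ^ D) ^ k with hX
  have hX5 : 1 ≤ (X + 1) ^ 5 := Nat.one_le_pow _ _ (by omega)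
  have hnX : 1 ≤ n * (X + 1) ^ 5 := Nat.mul_pos hn hX5
  have hDM : D ≤ n * (X + 1) ^ 5 ∧ M ≤ n * (X + 1) ^ 5 := by
    by_cases hD : D = 0
    · rw [if_pos hD] at hM
      omega
    · rw [if_neg hD] at hM
      have hD1 : 1 ≤ D := by omega
      have hy : D ≤ D * k * 2 ^ D := by
        rw [mul_assoc]
        exact Nat.le_mul_of_pos_right _ (Nat.mul_pos hk (by positivity))
      have hDX : D ≤ X := hy.trans (Nat.le_self_pow (by omega) _)
      refine ⟨?_, hM.trans ?_⟩
      · calc D ≤ X + 1 := by omega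
          _ ≤ (X + 1) ^ 5 := Nat.le_self_pow (by omega) _
          _ ≤ n * (X + 1) ^ 5 := Nat.le_mul_of_pos_left _ hn
      · refine Nat.mul_le_mul_left n ?_
        calc _ ≤ ((D * k * 2 ^ D) ^ 5) ^ k := Nat.pow_le_pow_left (choices_add_one_le hD1 hk) k
          _ = X ^ 5 := by rw [hX, ← pow_mul, ← pow_mul, mul_comm 5 k]
          _ ≤ (X + 1) ^ 5 := Nat.pow_le_pow_left (by omega) 5
  calc K * (8 * n * n * n) ^ K * (1 + D + M)
      ≤ K * (8 * n * n * n) ^ K * (3 * (n * (X + 1) ^ 5)) := by gcongr; omega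
    _ = 3 * (K * 8 ^ K) * (X + 1) ^ 5 * n ^ (3 * K + 1) := by
        rw [show 8 * n * n * n = 8 * n ^ 3 by ring, mul_pow, ← pow_mul, pow_succ n (3 * K)]; ring
    _ ≤ C * (X + 1) ^ C * n ^ C := by
        gcongr <;> omega

theorem single_exponential_bound {C a D k n t : ℕ} (hk : k ≤ 2 ^ (a * D))
    (ht : t ≤ C * ((D * k * 2 ^ D) ^ k + 1) ^ C * n ^ C) :
    t ≤ (C * 2 ^ C + C * (a + 2)) * 2 ^ ((C * 2 ^ C + C * (a + 2)) * (D * k)) * n ^ C := by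
  refine ht.trans (Nat.mul_le_mul_right _ ?_)
  have h1 : (D * k * 2 ^ D) ^ k ≤ 2 ^ ((a + 2) * (D * k)) := by
    calc (D * k * 2 ^ D) ^ k ≤ (2 ^ D * 2 ^ (a * D) * 2 ^ D) ^ k := by
          gcongr
          exact Nat.lt_two_pow_self.le
      _ = _ := by rw [← pow_add, ← pow_add, ← pow_mul]; congr 1; ring
  have h2 : (D * k * 2 ^ D) ^ k + 1 ≤ 2 * 2 ^ ((a + 2) * (D * k)) := by
    have : 1 ≤ 2 ^ ((a + 2) * (D * k)) := Nat.one_le_two_pow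
    omega
  calc C * ((D * k * 2 ^ D) ^ k + 1) ^ C ≤ C * (2 * 2 ^ ((a + 2) * (D * k))) ^ C := by gcongr
    _ = C * 2 ^ C * 2 ^ (C * (a + 2) * (D * k)) := by
        rw [mul_pow, ← pow_mul, show (a + 2) * (D * k) * C = C * (a + 2) * (D * k) by ring,
          mul_assoc C (2 ^ C)]
    _ ≤ _ := by
        gcongr
        · omega
        · omega
        · omega

end WordRAM

theorem mainTheorem2 :
    ∃ (P : WordRAM.Program) (c C : ℕ) (D : ℕ → ℕ),
      ∀ (n : ℕ) (G : SimpleGraph (Fin n)) (T : RootedForest (Fin n)) (d : ℤ),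
        G.Connected → T.IsElimTree G →
          ∃ t : ℕ,
            WordRAM.Outputs (c * (Nat.log 2 n + 1)) (C * n ^ C) P (WordRAM.encode G T d) t
                (WordRAM.binary (RootedForest.countSensible G T d)) ∧
              t ≤ C * ((d.toNat * T.depth * 2 ^ d.toNat) ^ T.depth + 1) ^ C * n ^ C ∧
              ∀ a : ℕ, T.depth ≤ 2 ^ (a * d.toNat) →
                t ≤ D a * 2 ^ (D a * (d.toNat * T.depth)) * n ^ C := by
  obtain ⟨K, hK⟩ := WordRAM.exists_time_bound
  set C := 3 * (K * 8 ^ K) + 3 * K + 1000 with hC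
  refine ⟨WordRAM.countProgram, 15, C, fun a => C * 2 ^ C + C * (a + 2), fun n G T d hG hT => ?_⟩
  have hn : 1 ≤ n := by
    obtain ⟨v⟩ := hG.nonempty
    exact Nat.one_le_of_lt v.isLt
  have hS : 8 * (8 * n * n * n) * (8 * n * n * n) ≤ C * n ^ C := by
    calc 8 * (8 * n * n * n) * (8 * n * n * n) = 512 * n ^ 6 := by ring
      _ ≤ C * n ^ C := Nat.mul_le_mul (by omega) (Nat.pow_le_pow_right hn (by omega))
  set M := if d.toNat = 0 then 0 else
    n * (T.depth * ((d.toNat + 1) * (d.toNat + 1)) * 2 ^ d.toNat + 1) ^ T.depth with hM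
  obtain ⟨t, s, hexec, ht, hout⟩ := WordRAM.countProgram_spec (M := M) hn rfl
    WordRAM.word_size_bound hS hT d (fun u => WordRAM.numChoices_le (Nat.min_le_left _ _) u)
    (fun h => by rw [hM, if_neg (by omega)])
  have hbound := (ht.trans (hK _ _ _ (by
    have : 0 < n * n * n := Nat.mul_pos (Nat.mul_pos hn hn) hn
    nlinarith))).trans (WordRAM.time_bound hn (WordRAM.one_le_depth T hn) hM.le)
  exact ⟨t, ⟨s, hexec, hout⟩, hbound, fun a ha => WordRAM.single_exponential_bound ha hbound⟩
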